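/- Let $d,n\ge 1$ and $\lambda,C_0,\Lambda_0>0$. Let $A=A(y_1,\dots,y_n)$, $y_i\in\mathbb R^d$, be a smooth real $d\times d$ matrix function such that, for all $y$, (i) $\xi\cdot A\xi\ge\lambda|\xi|^2$ and $|A\xi|\le\lambda^{-1}|\xi|$ for all $\xi\in\mathbb R^d$ (Euclidean norms); (ii) $A$ is 1-periodic in each $y_i$; (iii) $|\mathbf D_n^\ell A|\le C_0\Lambda_0^\ell\,\ell!$ for all $\ell\ge0$, where $\mathbf D_n=(\nabla_{y_1},\dots,\nabla_{y_n})$ and the norm of a tensor is the sum of the absolute values of its entries. *Effective matrix.* For $\delta=(\delta_1,\dots,\delta_n)\in(0,\infty)^n$ and $\tau>0$ put $\widehat\nabla_n=\sum_{i=1}^n\delta_i^{-1}\nabla_{y_i}$. For $1\le j\le d$ let $\mathcal X^j\in L^2(\mathbb T^{d\times n})$ with $\widehat\nabla_n\mathcal X^j\in L^2$ be the weak solution on the torus of $$-\widehat\nabla_n\cdot A\widehat\nabla_n\mathcal X^j+\tau^2\mathcal X^j=\widehat\nabla_n\cdot(Ae_j),$$ and let $\overline A=\overline A(\tau,\delta)=\langle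 A+A\widehat\nabla_n\mathcal X\rangle$, the average being over $\mathbb T^{d\times n}$. *Reiterated-homogenization matrix.* Put $A_n=A$, and for $k=n,\dots,1$ put $A_{k-1}(y_1,\dots,y_{k-1})=\int_{\mathbb T^d}(A_k+A_k\nabla_{y_k}\chi_k)\,dy_k$, where for fixed $(y_1,\dots,y_{k-1})$ the function $\chi_k^j$ is a weak 1-periodic solution of $-\nabla_{y_k}\cdot A_k\nabla_{y_k}\chi_k^j=\nabla_{y_k}\cdot(A_ke_j)$ in $\mathbb T^d$. The last one, $A_0$, is a constant matrix. Then $\overline A(\tau,\delta)$ (for all $\tau>0$ and $\delta\in(0,\infty)^n$) and $A_0$ exist and are unique, and the following holds. 1. There are constants $C,c>0$ depending only on $(d,n,\lambda,C_0,\Lambda_0)$ and, for every $\kappa>0$, constants $c_2,\dots,c_n>0$ depending only on $(d,n,\lambda,C_0,\Lambda_0)$ and $\kappa$, such that: if $\varepsilon_1>\varepsilon_2>\dots>\varepsilon_n>0$ satisfy $$\varepsilon_j\le\frac{c_j\,\varepsilon_{j-1}}{1+\log(\varepsilon_1/\varepsilon_{j-1})}\qquad(2\le j\le n),$$ if $\delta_i=\varepsilon_i/\varepsilon_1$,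 and if $\tau>0$ satisfies $\tau^2\ge\kappa\max_{2\le j\le n}e^{-c\,\varepsilon_{j-1}/\varepsilon_j}$, then $$|A_0-\overline A(\tau,\delta)|\le C\Big(\tau^2+\delta_2+\frac{\delta_3}{\delta_2}+\dots+\frac{\delta_n}{\delta_{n-1}}\Big).$$ (For $n=1$ the conditions indexed by $j$ are void and the right-hand side is $C\tau^2$.) 2. With $\delta_1=1$, $$A_0=\lim_{\tau\to0}\ \lim_{\delta_2\to0}\cdots\lim_{\delta_n\to0}\overline A(\tau,\delta),$$ where every inner limit exists for all fixed positive values of the remaining parameters. -/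

import Mathlib

open MeasureTheory Filter Topology
open scoped ContDiff Matrix

noncomputable section

namespace Multiscale

/-- The space of the variables `y = (y_1, …, y_n)` with `y_i ∈ ℝ^d`. -/
abbrev Var (d n : ℕ) : Type := Fin n → Fin d → ℝ

/-- The unit periodicity cell `[0,1)^{d × n}`, which represents the torus `𝕋^{d × n}`. -/
def cell (d n : ℕ) : Set (Var d n) :=
  {y | ∀ i k, 0 ≤ y i k ∧ y i k < 1}

/-- `f` is 1-periodic in each of the variables `y_1, …, y_n`. -/
def IsPeriodic {d n : ℕ} {E : Type*} (f : Var d n → E) : Prop :=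
  ∀ (z : Fin n → Fin d → ℤ) (y : Var d n), f (fun i k => y i k + (z i k : ℝ)) = f y

/-- The unit vector of `ℝ^{d × n}` in the direction of the `k`-th coordinate of `y_i`. -/
def unitVec {d n : ℕ} (i : Fin n) (k : Fin d) : Var d n :=
  Pi.single i (Pi.single k 1)

/-- The `k`-th component of `∑ i, δ_i⁻¹ ∇_{y_i} φ`. -/
def hatGrad {d n : ℕ} (δ : Fin n → ℝ) (φ : Var d n → ℝ) (y : Var d n) (k : Fin d) : ℝ :=
  ∑ i, (δ i)⁻¹ * fderiv ℝ φ y (unitVec i k)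

/-- The tensor norm (sum of the absolute values of all the entries) of the `ℓ`-th total
derivative, in all the variables `y_1, …, y_n`, of the matrix function `A` at `y`. -/
def derivNorm {d n : ℕ} (A : Var d n → Matrix (Fin d) (Fin d) ℝ) (ℓ : ℕ) (y : Var d n) : ℝ :=
  ∑ a, ∑ b, ∑ J : Fin ℓ → Fin n × Fin d,
    |iteratedFDeriv ℝ ℓ (fun x => A x a b) y (fun p => unitVec (J p).1 (J p).2)|

/-- Coefficient matrices with characters `(d, n, lam, C₀, Λ₀)`: elliptic and bounded (with respect
to the Euclidean norm of `ℝ^d`), periodic, and real analytic with quantitative bounds. -/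
structure IsCoefficient {d n : ℕ} (lam C₀ Λ₀ : ℝ)
    (A : Var d n → Matrix (Fin d) (Fin d) ℝ) : Prop where
  elliptic : ∀ y (ξ : Fin d → ℝ), lam * (ξ ⬝ᵥ ξ) ≤ ξ ⬝ᵥ (A y *ᵥ ξ)
  bounded : ∀ y (ξ : Fin d → ℝ), √((A y *ᵥ ξ) ⬝ᵥ (A y *ᵥ ξ)) ≤ lam⁻¹ * √(ξ ⬝ᵥ ξ)
  periodic : IsPeriodic A
  smooth : ∀ a b, ContDiff ℝ ∞ (fun y => A y a b)
  analytic : ∀ (ℓ : ℕ) (y : Var d n), derivNorm A ℓ y ≤ C₀ * Λ₀ ^ ℓ * (ℓ.factorial : ℝ)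

/-- `X` is a weak solution on the torus `𝕋^{d × n}`, with `∇̂ = ∑ i, δ_i⁻¹ ∇_{y_i}`, of
`-∇̂ · B ∇̂ X + τ² X = ∇̂ · (B v)`, and `G = ∇̂ X` is its weak directional gradient; both are in
`L²(𝕋^{d × n})`, that is, in `L²` of the cell. The test functions are smooth and periodic. -/
structure IsWeakCorrector {d n : ℕ} (δ : Fin n → ℝ) (τ : ℝ)
    (B : Var d n → Matrix (Fin d) (Fin d) ℝ) (v : Fin d → ℝ)
    (X : Var d n → ℝ) (G : Var d n → Fin d → ℝ) : Prop where
  memLp : MemLp X 2 (volume.restrict (cell d n))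
  memLp_grad : ∀ k, MemLp (fun y => G y k) 2 (volume.restrict (cell d n))
  weak_grad : ∀ φ : Var d n → ℝ, ContDiff ℝ ∞ φ → IsPeriodic φ → ∀ k,
    ∫ y in cell d n, G y k * φ y = - ∫ y in cell d n, X y * hatGrad δ φ y k
  weak_eq : ∀ φ : Var d n → ℝ, ContDiff ℝ ∞ φ → IsPeriodic φ →
    (∫ y in cell d n, (B y *ᵥ G y) ⬝ᵥ hatGrad δ φ y) + τ ^ 2 * ∫ y in cell d n, X y * φ y
      = - ∫ y in cell d n, (B y *ᵥ v) ⬝ᵥ hatGrad δ φ y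

/-- `M = ⟨B + B ∇̂ X⟩`, where the `j`-th column of `X` is a weak solution of
`-∇̂ · B ∇̂ X^j + τ² X^j = ∇̂ · (B e_j)` and `⟨ ⟩` is the average over `𝕋^{d × n}`.
For one scale, `δ = 1` and `τ = 0` this is the classical periodic homogenized matrix. -/
def IsEffectiveMatrix {d n : ℕ} (δ : Fin n → ℝ) (τ : ℝ)
    (B : Var d n → Matrix (Fin d) (Fin d) ℝ) (M : Matrix (Fin d) (Fin d) ℝ) : Prop :=
  ∀ j, ∃ (X : Var d n → ℝ) (G : Var d n → Fin d → ℝ),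
    IsWeakCorrector δ τ B (Pi.single j 1) X G ∧
      ∀ i, M i j = ∫ y in cell d n, (B y i j + (B y *ᵥ G y) i)

/-- `M` is obtained from `A` by reiterated homogenization: first the last variable `y_n` is
homogenized for every fixed `(y_1, …, y_{n-1})`, which gives `A'(y_1, …, y_{n-1})`; then `A'` is
treated in the same way, until no variable is left. -/
def IsReiteratedMatrix {d : ℕ} : (n : ℕ) → (Var d n → Matrix (Fin d) (Fin d) ℝ) →
    Matrix (Fin d) (Fin d) ℝ → Prop
  | 0, A, M => M = A (fun i => i.elim0)
  | n + 1, A, M => ∃ A' : Var d n → Matrix (Fin d) (Fin d) ℝ,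
      (∀ x : Var d n, IsEffectiveMatrix (n := 1) (fun _ => 1) 0
        (fun z => A (Fin.snoc (α := fun _ => Fin d → ℝ) x (z 0))) (A' x)) ∧
      IsReiteratedMatrix n A' M

/-- `lim_{s_1 → 0+} lim_{s_2 → 0+} ⋯ lim_{s_m → 0+} f (s_1, …, s_m) = L`: the limit in the last
variable is taken first, it exists for all positive values of the other ones, and so on. -/
def HasIteratedLimit {E : Type*} [TopologicalSpace E] :
    (m : ℕ) → ((Fin m → ℝ) → E) → E → Prop
  | 0, f, L => f (fun i => i.elim0) = L
  | m + 1, f, L => ∃ g : (Fin m → ℝ) → E,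
      (∀ s : Fin m → ℝ, (∀ i, 0 < s i) →
        Tendsto (fun t => f (Fin.snoc (α := fun _ => ℝ) s t)) (𝓝[>] 0) (𝓝 (g s))) ∧
      HasIteratedLimit m g L

end Multiscale

end

open MeasureTheory Filter Topology
open scoped ContDiff Matrix

noncomputable section

/-! The scales are removed one at a time, the fastest first. Let δ be the weight of the last
variable y_n and A' the matrix obtained from A by homogenizing y_n. In the basis of exponentials the
directional gradient has the symbol 2πi κ with κ = κ' + δ⁻¹ ℓ, where ℓ is the integer frequency in
y_n and κ' collects the slower variables. Let U₀, with gradient G₀, solve the problem for A', and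
let V, of mean zero in y_n, be the corrector of A in y_n alone with data e_j + G₀; call H its
y_n-gradient and R its slow gradient. The true solution is compared with U₀ + δ V, whose gradient is
G₀ + H + δ R.

By the definition of A', the flux A(H + e_j + G₀) minus the flux of A' has mean zero and no
divergence in y_n (`repr_flux_eq`). It is therefore the fast divergence of a skew potential, and
paired with a gradient it is worth only δ times a slow derivative (`exists_flux_corrector`). The
term τ² δ V gains another δ because V has no mean in y_n (`exists_fast_corrector`). An energy
estimate for the difference then bounds the error of one step by a constant times δ_n Σ δ_i⁻¹ + τ
δ_n² Σ δ_i⁻¹ + τ² δ_n², sums over i < n (`norm_grad_sub_le`, `exists_step_bound`).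

The slow derivatives of V and of the flux are bounded uniformly in δ and τ by translating the
equation: the commutator of a translation with multiplication by A is controlled by the Lipschitz
constant of A (`IsCorrector.norm_map_sub_le`), and a function on which translations act in a
Lipschitz way is differentiable in L² (`exists_deriv`).

Homogenization keeps the ellipticity constant and worsens the bound and the Lipschitz constant by
controlled factors (`IsHomogenization.isLipCoeff`), so the step can be iterated
(`exists_scaleError_bound`). For decreasing weights starting at 1 the accumulated error reduces to
τ² plus the consecutive ratios (`scaleError_le`). The iterated limit comes from the same one-step
bound with the remaining parameters frozen (`hasIteratedLimit`). -/

namespace Multiscale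

/-! ### Gradient and divergence through Fourier symbols; energy estimates. -/

section Fourier

open scoped InnerProductSpace

variable {E I : Type*} [NormedAddCommGroup E] [InnerProductSpace ℂ E]
  (e : HilbertBasis I ℂ E) {d : ℕ}

/-- Vector fields with components in `E`. -/
abbrev VField (d : ℕ) (E : Type*) : Type _ := PiLp 2 (fun _ : Fin d => E)

theorem norm_sq_eq_tsum (f : E) : HasSum (fun k => ‖e.repr f k‖ ^ 2) (‖f‖ ^ 2) := by
  have h := e.hasSum_inner_mul_inner f f
  rw [inner_self_eq_norm_sq_to_K] at h
  have h2 := Complex.hasSum_re h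
  have h3 : ∀ k, (⟪f, e k⟫_ℂ * ⟪e k, f⟫_ℂ).re = ‖e.repr f k‖ ^ 2 := fun k => by
    rw [HilbertBasis.repr_apply_apply]
    have := inner_mul_symm_re_eq_norm (𝕜 := ℂ) f (e k)
    rw [norm_mul, norm_inner_symm f, ← sq] at this
    exact this
  simp only [h3] at h2
  exact_mod_cast h2

/-- Riesz–Fischer, with the bound required on finite sets of frequencies only. This suits difference
quotients, whose limit is taken mode by mode. The basis identifies `E` with ℓ², which supplies the
completeness. -/
theorem exists_of_sum_le (a : I → ℂ) {C : ℝ} (hC : 0 ≤ C)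
    (h : ∀ s : Finset I, ∑ k ∈ s, ‖a k‖ ^ 2 ≤ C ^ 2) :
    ∃ g : E, (∀ k, e.repr g k = a k) ∧ ‖g‖ ≤ C := by
  have hs : Summable fun k => ‖a k‖ ^ 2 :=
    summable_of_sum_le (fun k => by positivity) h
  have hm : Memℓp a 2 := memℓp_gen (by simpa using hs)
  refine ⟨e.repr.symm ⟨a, hm⟩, fun k => by simp, ?_⟩
  have h1 := norm_sq_eq_tsum e (e.repr.symm ⟨a, hm⟩)
  have h2 : ‖e.repr.symm ⟨a, hm⟩‖ ^ 2 ≤ C ^ 2 := by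
    rw [← h1.tsum_eq]
    exact Real.tsum_le_of_sum_le (fun k => by positivity) (fun s => by simpa using h s)
  exact (sq_le_sq₀ (norm_nonneg _) hC).1 h2

theorem sum_repr_le (f : E) (s : Finset I) : ∑ k ∈ s, ‖e.repr f k‖ ^ 2 ≤ ‖f‖ ^ 2 :=
  sum_le_hasSum s (fun k _ => by positivity) (norm_sq_eq_tsum e f)

theorem repr_ext {f g : E} (h : ∀ k, e.repr f k = e.repr g k) : f = g :=
  e.repr.injective (by ext k; exact h k)

/-- Fourier multipliers with a bounded symbol. -/
theorem exists_multiplier (m : I → ℂ) (hm : ∀ k, ‖m k‖ ≤ 1) (f : E) :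
    ∃ g : E, (∀ k, e.repr g k = m k * e.repr f k) ∧ ‖g‖ ≤ ‖f‖ := by
  refine exists_of_sum_le e _ (norm_nonneg f) fun s => le_trans ?_ (sum_repr_le e f s)
  refine Finset.sum_le_sum fun k _ => ?_
  rw [norm_mul]
  have := hm k
  gcongr
  nlinarith [norm_nonneg (m k), norm_nonneg (e.repr f k)]

theorem hasSum_inner (f g : E) :
    HasSum (fun k => (starRingEnd ℂ) (e.repr f k) * e.repr g k) ⟪f, g⟫_ℂ := by
  simpa only [HilbertBasis.repr_apply_apply, inner_conj_symm] using e.hasSum_inner_mul_inner f g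

theorem hasSum_inner_field (f g : VField d E) :
    HasSum (fun k => ∑ b, (starRingEnd ℂ) (e.repr (f b) k) * e.repr (g b) k) ⟪f, g⟫_ℂ := by
  rw [PiLp.inner_apply]
  refine hasSum_sum fun b _ => ?_
  exact hasSum_inner e (f b) (g b)

/-- `g` is the directional gradient of `x` with symbol `2πi κ`. -/
def IsGrad (κ : I → Fin d → ℝ) (x : E) (g : VField d E) : Prop :=
  ∀ k b, e.repr (g b) k = 2 * Real.pi * Complex.I * κ k b * e.repr x k

/-- `s` is the divergence of `f` with symbol `2πi κ`. -/
def IsDiv (κ : I → Fin d → ℝ) (f : VField d E) (s : E) : Prop :=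
  ∀ k, ∑ b, 2 * Real.pi * Complex.I * κ k b * e.repr (f b) k = e.repr s k

variable {e} {κ : I → Fin d → ℝ}

theorem IsGrad.add {x y : E} {g h : VField d E} (hx : IsGrad e κ x g) (hy : IsGrad e κ y h) :
    IsGrad e κ (x + y) (g + h) := fun k b => by
  simp only [PiLp.add_apply, map_add, lp.coeFn_add, Pi.add_apply, hx k b, hy k b]; ring

theorem IsGrad.sub {x y : E} {g h : VField d E} (hx : IsGrad e κ x g) (hy : IsGrad e κ y h) :
    IsGrad e κ (x - y) (g - h) := fun k b => by
  simp only [PiLp.sub_apply, map_sub, lp.coeFn_sub, Pi.sub_apply, hx k b, hy k b]; ring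

theorem IsGrad.smul {x : E} {g : VField d E} (c : ℂ) (hx : IsGrad e κ x g) :
    IsGrad e κ (c • x) (c • g) := fun k b => by
  simp only [PiLp.smul_apply, map_smul, lp.coeFn_smul, Pi.smul_apply, hx k b, smul_eq_mul]; ring

theorem IsDiv.sub {f h : VField d E} {s t : E} (hf : IsDiv e κ f s) (hh : IsDiv e κ h t) :
    IsDiv e κ (f - h) (s - t) := fun k => by
  simp only [PiLp.sub_apply, map_sub, lp.coeFn_sub, Pi.sub_apply, ← hf k, ← hh k, mul_sub,
    Finset.sum_sub_distrib]

theorem IsDiv.add {f h : VField d E} {s t : E} (hf : IsDiv e κ f s) (hh : IsDiv e κ h t) :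
    IsDiv e κ (f + h) (s + t) := fun k => by
  simp only [PiLp.add_apply, map_add, lp.coeFn_add, Pi.add_apply, ← hf k, ← hh k, mul_add,
    Finset.sum_add_distrib]

theorem IsDiv.smul {f : VField d E} {s : E} (c : ℂ) (hf : IsDiv e κ f s) :
    IsDiv e κ (c • f) (c • s) := fun k => by
  simp only [PiLp.smul_apply, map_smul, lp.coeFn_smul, Pi.smul_apply, ← hf k, smul_eq_mul,
    Finset.mul_sum]
  exact Finset.sum_congr rfl fun b _ => by ring

/-- Integration by parts: since κ is real, the conjugate of 2πi κ is its negative. -/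
theorem IsGrad.inner_eq {x s : E} {g f : VField d E} (hg : IsGrad e κ x g) (hf : IsDiv e κ f s) :
    ⟪g, f⟫_ℂ = -⟪x, s⟫_ℂ := by
  refine (hasSum_inner_field e g f).unique ?_
  refine (hasSum_inner e x s).neg.congr_fun fun k => ?_
  rw [← hf k, Finset.mul_sum, ← Finset.sum_neg_distrib]
  refine Finset.sum_congr rfl fun b _ => ?_
  rw [hg k b]
  simp only [map_mul, Complex.conj_ofReal, Complex.conj_I, map_ofNat]
  ring

/-- Coercive bounded operators on vector fields. -/
structure IsElliptic (lam Mu : ℝ) (𝔸 : VField d E →L[ℂ] VField d E) : Prop where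
  coercive : ∀ g, lam * ‖g‖ ^ 2 ≤ (⟪g, 𝔸 g⟫_ℂ).re
  bounded : ∀ g, ‖𝔸 g‖ ≤ Mu * ‖g‖

/-- `x` solves the problem with operator `𝔸` and data `v`, and `g` is the gradient of `x`. -/
structure IsCorrector (e : HilbertBasis I ℂ E) (κ : I → Fin d → ℝ) (τ : ℝ)
    (𝔸 : VField d E →L[ℂ] VField d E) (v : VField d E) (x : E) (g : VField d E) : Prop where
  grad : IsGrad e κ x g
  div : IsDiv e κ (𝔸 (g + v)) ((τ ^ 2 : ℂ) • x)

theorem re_inner_smul_self_nonneg (τ : ℝ) (x : E) : 0 ≤ (⟪x, (τ ^ 2 : ℂ) • x⟫_ℂ).re := by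
  rw [inner_smul_right, inner_self_eq_norm_sq_to_K]
  have : (τ : ℂ) ^ 2 * (‖x‖ : ℂ) ^ 2 = ((τ ^ 2 * ‖x‖ ^ 2 : ℝ) : ℂ) := by push_cast; rfl
  exact (congrArg Complex.re this).ge.trans' (by rw [Complex.ofReal_re]; positivity)

theorem re_inner_le (g f : VField d E) : (⟪g, f⟫_ℂ).re ≤ ‖g‖ * ‖f‖ :=
  (Complex.re_le_norm _).trans (norm_inner_le_norm _ _)

theorem le_div_of_mul_sq_le {lam a b : ℝ} (hlam : 0 < lam) (ha : 0 ≤ a) (hb : 0 ≤ b)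
    (h : lam * a ^ 2 ≤ a * b) : a ≤ lam⁻¹ * b := by
  rcases ha.eq_or_lt with rfl | ha
  · positivity
  · rw [inv_mul_eq_div, le_div_iff₀ hlam]
    nlinarith

/-- Energy estimate: if `∇·(𝔸 D + r) = τ² y` with `D = ∇y` then `D` is controlled by `r`. -/
theorem energy_le {lam Mu τ : ℝ} (hlam : 0 < lam) {𝔸 : VField d E →L[ℂ] VField d E}
    (hA : IsElliptic lam Mu 𝔸) {y : E} {D r : VField d E} (hD : IsGrad e κ y D)
    (hr : IsDiv e κ (𝔸 D + r) ((τ ^ 2 : ℂ) • y)) : ‖D‖ ≤ lam⁻¹ * ‖r‖ := by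
  refine le_div_of_mul_sq_le hlam (norm_nonneg _) (norm_nonneg _) ?_
  -- The equation is tested with `y` itself; the term τ²‖y‖² has the favourable sign and is dropped.
  have h1 := congrArg Complex.re (hD.inner_eq hr)
  rw [inner_add_right, Complex.add_re, Complex.neg_re] at h1
  have h2 := re_inner_smul_self_nonneg τ y
  have h3 := hA.coercive D
  have h4 := re_inner_le (-D) r
  rw [inner_neg_left, norm_neg, Complex.neg_re] at h4
  linarith

variable {lam Mu τ : ℝ} {𝔸 𝔹 : VField d E →L[ℂ] VField d E} {v : VField d E}

theorem IsCorrector.norm_grad_le (hlam : 0 < lam) (hA : IsElliptic lam Mu 𝔸) {x : E}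
    {g : VField d E} (h : IsCorrector e κ τ 𝔸 v x g) : ‖g‖ ≤ lam⁻¹ * (Mu * ‖v‖) := by
  have := energy_le hlam hA (r := 𝔸 v) h.grad (by rw [← map_add]; exact h.div)
  exact this.trans (by gcongr; exact hA.bounded v)

/-- Stability of the gradient of the solution under perturbations of the operator. -/
theorem IsCorrector.norm_sub_le (hlam : 0 < lam) (hA : IsElliptic lam Mu 𝔸) {x x' : E}
    {g g' : VField d E} (h : IsCorrector e κ τ 𝔸 v x g) (h' : IsCorrector e κ τ 𝔹 v x' g') :
    ‖g - g'‖ ≤ lam⁻¹ * ‖(𝔸 - 𝔹) (g' + v)‖ := by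
  refine energy_le hlam hA (τ := τ) (h.grad.sub h'.grad) ?_
  have := h.div.sub h'.div
  convert this using 1
  · simp only [sub_apply, map_add, map_sub]; abel
  · rw [smul_sub]

/-- Only the gradient is determined: for τ = 0 the function is free on the frequencies where κ
vanishes. -/
theorem IsCorrector.grad_unique (hlam : 0 < lam) (hA : IsElliptic lam Mu 𝔸) {x x' : E}
    {g g' : VField d E} (h : IsCorrector e κ τ 𝔸 v x g) (h' : IsCorrector e κ τ 𝔸 v x' g') :
    g = g' := by
  have := h.norm_sub_le hlam hA h'
  simp only [sub_self, zero_apply, norm_zero, mul_zero] at this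
  exact sub_eq_zero.1 (norm_le_zero_iff.1 this)

/-- Componentwise action of an isometry on vector fields. -/
def mapField {E' : Type*} [NormedAddCommGroup E'] [InnerProductSpace ℂ E'] (T : E' →ₗᵢ[ℂ] E) :
    VField d E' →ₗᵢ[ℂ] VField d E where
  toFun g := WithLp.toLp 2 fun b => T (g b)
  map_add' g h := by ext b; simp
  map_smul' c g := by ext b; simp
  norm_map' g := by simp [PiLp.norm_eq_of_L2]

@[simp] theorem mapField_apply {E' : Type*} [NormedAddCommGroup E'] [InnerProductSpace ℂ E']
    (T : E' →ₗᵢ[ℂ] E) (g : VField d E') (b : Fin d) : mapField T g b = T (g b) := rfl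

theorem IsGrad.map {T : E →ₗᵢ[ℂ] E} {χ : I → ℂ} (hT : ∀ f k, e.repr (T f) k = χ k * e.repr f k)
    {x : E} {g : VField d E} (h : IsGrad e κ x g) : IsGrad e κ (T x) (mapField T g) := fun k b => by
  rw [mapField_apply, hT, hT, h k b]; ring

theorem IsDiv.map {T : E →ₗᵢ[ℂ] E} {χ : I → ℂ} (hT : ∀ f k, e.repr (T f) k = χ k * e.repr f k)
    {f : VField d E} {s : E} (h : IsDiv e κ f s) : IsDiv e κ (mapField T f) (T s) := fun k => by
  rw [hT, ← h k, Finset.mul_sum]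
  refine Finset.sum_congr rfl fun b _ => ?_
  rw [mapField_apply, hT]; ring

/-- Regularity: translations (isometries which are diagonal in the Fourier basis) act on
correctors in a Lipschitz way. -/
theorem IsCorrector.norm_map_sub_le (hlam : 0 < lam) (hA : IsElliptic lam Mu 𝔸)
    {T : E →ₗᵢ[ℂ] E} {χ : I → ℂ} (hT : ∀ f k, e.repr (T f) k = χ k * e.repr f k) {x : E}
    {g : VField d E} (h : IsCorrector e κ τ 𝔸 v x g) :
    ‖mapField T g - g‖ ≤ lam⁻¹ * (‖mapField T (𝔸 (g + v)) - 𝔸 (mapField T (g + v))‖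
      + Mu * ‖mapField T v - v‖) := by
  -- `T` commutes with gradient and divergence, so `T x` solves the same problem up to the
  -- commutator of `T` with `𝔸` and the change of the data.
  have h1 := energy_le hlam hA (τ := τ) ((h.grad.map hT).sub h.grad)
    (r := (mapField T (𝔸 (g + v)) - 𝔸 (mapField T (g + v))) + 𝔸 (mapField T v - v)) (by
      have := (h.div.map hT).sub h.div
      convert this using 1
      · simp only [map_add, map_sub]; abel
      · rw [smul_sub, map_smul])
  refine h1.trans ?_
  gcongr
  exact (norm_add_le _ _).trans (add_le_add le_rfl (hA.bounded _))

end Fourier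

theorem norm_field_le {d : ℕ} {E : Type*} [NormedAddCommGroup E] (g : VField d E) :
    ‖g‖ ≤ ∑ b, ‖g b‖ := by
  rw [PiLp.norm_eq_of_L2]
  refine Real.sqrt_le_iff.2 ⟨by positivity, ?_⟩
  exact Finset.sum_sq_le_sq_sum_of_nonneg fun b _ => norm_nonneg _

theorem norm_apply_le {d : ℕ} {E : Type*} [NormedAddCommGroup E] (g : VField d E) (b : Fin d) :
    ‖g b‖ ≤ ‖g‖ := PiLp.norm_apply_le g b

open scoped InnerProductSpace in
/-- The Lax–Milgram lemma on a complete subspace. -/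
theorem exists_mem_forall_inner_eq_zero {Z : Type*} [NormedAddCommGroup Z] [InnerProductSpace ℂ Z]
    (K : Submodule ℂ Z) [CompleteSpace K] (𝔹 : Z →L[ℂ] Z) (c : NNReal) (hc : 0 < c)
    (h : ∀ u ∈ K, c * ‖u‖ ^ 2 ≤ (⟪𝔹 u, u⟫_ℂ).re) (z : Z) :
    ∃ u ∈ K, ∀ w ∈ K, ⟪𝔹 u + z, w⟫_ℂ = 0 := by
  let P : Z →L[ℂ] K := K.orthogonalProjectionOnto
  let T : K →L[ℂ] K := P ∘L 𝔹 ∘L K.subtypeL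
  have hP : ∀ (z : Z) (u : K), ⟪P z, u⟫_ℂ = ⟪z, (u : Z)⟫_ℂ := fun z u =>
    K.inner_orthogonalProjectionOnto_eq_of_mem_right u z
  have hT : ∀ u : K, ‖u‖ ^ 2 * (c : ℝ) ≤ ‖⟪T u, u⟫_ℂ‖ := fun u => by
    have h1 : ⟪T u, u⟫_ℂ = ⟪𝔹 u, (u : Z)⟫_ℂ := hP _ _
    rw [h1, mul_comm]
    exact (h u u.2).trans (Complex.re_le_norm _)
  have hunit : IsUnit T := ContinuousLinearMap.isUnit_of_forall_le_norm_inner_map (𝕜 := ℂ) (E := K)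
    T (c := c) hc hT
  obtain ⟨u, hu⟩ := (ContinuousLinearMap.isUnit_iff_bijective.1 hunit).2 (-P z)
  refine ⟨u, u.2, fun w hw => ?_⟩
  have h1 : ⟪T u, (⟨w, hw⟩ : K)⟫_ℂ = ⟪𝔹 u, w⟫_ℂ := hP _ _
  rw [hu, inner_neg_left, hP] at h1
  rw [inner_add_left, ← h1]
  exact neg_add_cancel _

/-! ### Existence of correctors by the Lax–Milgram lemma. -/

section Existence

open scoped InnerProductSpace

variable {E I : Type*} [NormedAddCommGroup E] [InnerProductSpace ℂ E]
  {e : HilbertBasis I ℂ E} {d : ℕ} {κ : I → Fin d → ℝ}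

theorem hasSum_norm_sq_field (e : HilbertBasis I ℂ E) (g : VField d E) :
    HasSum (fun k => ∑ b, ‖e.repr (g b) k‖ ^ 2) (‖g‖ ^ 2) := by
  rw [PiLp.norm_sq_eq_of_L2]
  exact hasSum_sum fun b _ => norm_sq_eq_tsum e (g b)

/-- Poincaré inequality with constant 1: on every frequency that `x` charges, |2πκ| ≥ 1. -/
theorem IsGrad.norm_le {x : E} {g : VField d E} (h : IsGrad e κ x g)
    (hx : ∀ k, e.repr x k = 0 ∨ 1 ≤ ∑ b, κ k b ^ 2) : ‖x‖ ≤ ‖g‖ := by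
  refine (sq_le_sq₀ (norm_nonneg _) (norm_nonneg _)).1 ?_
  refine hasSum_le (fun k => ?_) (norm_sq_eq_tsum e x) (hasSum_norm_sq_field e g)
  have h1 : ∑ b, ‖e.repr (g b) k‖ ^ 2 = (2 * Real.pi) ^ 2 * (∑ b, κ k b ^ 2) * ‖e.repr x k‖ ^ 2 := by
    rw [Finset.mul_sum, Finset.sum_mul]
    refine Finset.sum_congr rfl fun b _ => ?_
    rw [h k b]
    simp only [norm_mul, mul_pow, Complex.norm_I, Complex.norm_real, Real.norm_eq_abs, sq_abs,
      Complex.norm_ofNat, mul_one]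
  rw [h1]
  rcases hx k with h0 | h0
  · simp [h0]
  · have : (1 : ℝ) ≤ (2 * Real.pi) ^ 2 := by nlinarith [Real.pi_gt_three]
    have h2 : 1 ≤ (2 * Real.pi) ^ 2 * (∑ b, κ k b ^ 2) := by nlinarith
    nlinarith [sq_nonneg ‖e.repr x k‖]

theorem continuous_repr (e : HilbertBasis I ℂ E) (k : I) : Continuous fun x : E => e.repr x k := by
  simp only [HilbertBasis.repr_apply_apply]
  fun_prop

/-- Pairs of a function without resonant frequencies and its gradient. -/
def gradSpace (e : HilbertBasis I ℂ E) (κ : I → Fin d → ℝ) :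
    Submodule ℂ (WithLp 2 (E × VField d E)) where
  carrier := {u | IsGrad e κ u.fst u.snd ∧ ∀ k, κ k = 0 → e.repr u.fst k = 0}
  add_mem' {u v} hu hv := ⟨hu.1.add hv.1, fun k hk => by
    simp [hu.2 k hk, hv.2 k hk]⟩
  zero_mem' := ⟨fun k b => by simp, fun k _ => by simp⟩
  smul_mem' c u hu := ⟨hu.1.smul c, fun k hk => by simp [hu.2 k hk]⟩

theorem isClosed_gradSpace (e : HilbertBasis I ℂ E) (κ : I → Fin d → ℝ) :
    IsClosed (gradSpace e κ : Set (WithLp 2 (E × VField d E))) := by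
  have h1 : Continuous fun u : WithLp 2 (E × VField d E) => u.fst := by fun_prop
  have h2 : ∀ b, Continuous fun u : WithLp 2 (E × VField d E) => u.snd b := fun b => by fun_prop
  have h3 : (gradSpace e κ : Set (WithLp 2 (E × VField d E)))
      = (⋂ k, ⋂ b, {u | e.repr (u.snd b) k = 2 * Real.pi * Complex.I * κ k b * e.repr u.fst k}) ∩
        ⋂ k, ⋂ (_ : κ k = 0), {u | e.repr u.fst k = 0} := by
    ext u
    simp only [Set.mem_inter_iff, Set.mem_iInter, Set.mem_ofPred_eq]
    exact Iff.rfl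
  rw [h3]
  refine IsClosed.inter ?_ ?_
  · exact isClosed_iInter fun k => isClosed_iInter fun b =>
      isClosed_eq ((continuous_repr e k).comp (h2 b))
        (continuous_const.mul ((continuous_repr e k).comp h1))
  · exact isClosed_iInter fun k => isClosed_iInter fun _ =>
      isClosed_eq ((continuous_repr e k).comp h1) continuous_const

variable [CompleteSpace E] {lam Mu τ : ℝ} {𝔸 : VField d E →L[ℂ] VField d E}

/-- Lax–Milgram on the closed space `gradSpace` of pairs (function, gradient). Coercivity in the
function comes from τ² when τ ≠ 0, and from the Poincaré inequality when the frequencies have a gap;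
the second case serves the cell problems with τ = 0. Removing the frequencies with κ = 0 makes the
Poincaré inequality available and normalizes the solution. -/
theorem exists_corrector (hlam : 0 < lam) (hA : IsElliptic lam Mu 𝔸)
    (h : τ ≠ 0 ∨ ∀ k, κ k = 0 ∨ 1 ≤ ∑ b, κ k b ^ 2) (v : VField d E) :
    ∃ x g, IsCorrector e κ τ 𝔸 v x g ∧ ∀ k, κ k = 0 → e.repr x k = 0 := by
  classical
  set Z := WithLp 2 (E × VField d E) with hZ
  let Ψ := WithLp.prodContinuousLinearEquiv 2 ℂ E (VField d E)
  obtain ⟨𝔹, hB0⟩ : ∃ 𝔹 : Z →L[ℂ] Z, ∀ u : Z, 𝔹 u = WithLp.toLp 2 ((τ ^ 2 : ℂ) • u.fst, 𝔸 u.snd) :=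
    ⟨Ψ.symm.toContinuousLinearMap ∘L
      (((τ ^ 2 : ℂ) • ContinuousLinearMap.id ℂ E).prodMap 𝔸) ∘L Ψ.toContinuousLinearMap,
      fun u => rfl⟩
  have hB : ∀ u w : Z, ⟪𝔹 u, w⟫_ℂ = ⟪(τ ^ 2 : ℂ) • u.fst, w.fst⟫_ℂ + ⟪𝔸 u.snd, w.snd⟫_ℂ :=
    fun u w => by rw [hB0]; exact WithLp.prod_inner_apply _ _
  obtain ⟨c, hc, hcoer⟩ : ∃ c : ℝ, 0 < c ∧ ∀ u ∈ gradSpace e κ,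
      c * ‖u‖ ^ 2 ≤ τ ^ 2 * ‖u.fst‖ ^ 2 + lam * ‖u.snd‖ ^ 2 := by
    rcases h with hτ | hgap
    · refine ⟨min (τ ^ 2) lam, lt_min (by positivity) hlam, fun u _ => ?_⟩
      rw [WithLp.prod_norm_sq_eq_of_L2, mul_add]
      gcongr
      · exact min_le_left _ _
      · exact min_le_right _ _
    -- Half of the coercivity in the gradient pays for the function.
    · refine ⟨lam / 2, by positivity, fun u hu => ?_⟩
      have h1 : ‖u.fst‖ ≤ ‖u.snd‖ := hu.1.norm_le fun k => (hgap k).imp (hu.2 k) id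
      rw [WithLp.prod_norm_sq_eq_of_L2]
      have h2 : ‖u.fst‖ ^ 2 ≤ ‖u.snd‖ ^ 2 := by gcongr
      nlinarith [sq_nonneg (τ * ‖u.fst‖)]
  have : CompleteSpace (gradSpace e κ : Submodule ℂ Z) :=
    (isClosed_gradSpace e κ).completeSpace_coe
  lift c to NNReal using hc.le
  obtain ⟨u, hu, hu'⟩ := exists_mem_forall_inner_eq_zero (gradSpace e κ : Submodule ℂ Z) 𝔹 c
    (by exact_mod_cast hc) (fun u hu => by
      rw [hB, Complex.add_re]
      have h2 : (⟪(τ ^ 2 : ℂ) • u.fst, u.fst⟫_ℂ).re = τ ^ 2 * ‖u.fst‖ ^ 2 := by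
        rw [inner_smul_left, inner_self_eq_norm_sq_to_K]
        have : (starRingEnd ℂ) ((τ : ℂ) ^ 2) * (‖u.fst‖ : ℂ) ^ 2
            = ((τ ^ 2 * ‖u.fst‖ ^ 2 : ℝ) : ℂ) := by simp
        exact (congrArg Complex.re this).trans (Complex.ofReal_re _)
      have h3 : (⟪𝔸 u.snd, u.snd⟫_ℂ).re = (⟪u.snd, 𝔸 u.snd⟫_ℂ).re := by
        rw [← inner_conj_symm, Complex.conj_re]
      have h4 := hcoer u hu
      have h5 := hA.coercive u.snd
      linarith) (WithLp.toLp 2 (0, 𝔸 v))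
  have key : ∀ w ∈ gradSpace e κ, ⟪(τ ^ 2 : ℂ) • u.fst, w.fst⟫_ℂ
      + ⟪𝔸 (u.snd + v), w.snd⟫_ℂ = 0 := fun w hw => by
    have h1 := hu' w hw
    have h2 : ⟪(WithLp.toLp 2 (0, 𝔸 v) : Z), w⟫_ℂ = ⟪𝔸 v, w.snd⟫_ℂ := by
      rw [WithLp.prod_inner_apply]
      simp
    rw [inner_add_left, h2, hB] at h1
    rw [map_add, inner_add_left, ← add_assoc, ← h1]
  refine ⟨u.fst, u.snd, ⟨hu.1, fun k => ?_⟩, hu.2⟩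
  by_cases hk : κ k = 0
  · simp [hk, hu.2 k hk]
  -- Testing with a single mode and its gradient isolates the `k`-th coefficient of the divergence
  -- equation.
  have hw : (WithLp.toLp 2 (e k, WithLp.toLp 2 fun b => (2 * Real.pi * Complex.I * κ k b) • e k) : Z)
      ∈ gradSpace e κ := by
    refine ⟨fun j b => ?_, fun j hj => ?_⟩
    · change e.repr ((2 * Real.pi * Complex.I * κ k b) • e k) j = _ * e.repr (e k) j
      rw [map_smul, lp.coeFn_smul, Pi.smul_apply, smul_eq_mul, HilbertBasis.repr_self]
      by_cases hjk : j = k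
      · subst hjk; rfl
      · simp [lp.single_apply, hjk]
    · change e.repr (e k) j = 0
      rw [HilbertBasis.repr_self]
      have hjk : j ≠ k := fun h => hk (h ▸ hj)
      simp [lp.single_apply, hjk]
  have h1 := key _ hw
  have h2 : ∀ y : E, ⟪y, e k⟫_ℂ = (starRingEnd ℂ) (e.repr y k) := fun y => by
    rw [HilbertBasis.repr_apply_apply, inner_conj_symm]
  rw [PiLp.inner_apply] at h1
  change ⟪(τ ^ 2 : ℂ) • u.fst, e k⟫_ℂ + ∑ b, ⟪(𝔸 (u.snd + v)) b,
    (2 * Real.pi * Complex.I * κ k b) • e k⟫_ℂ = 0 at h1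
  simp only [inner_smul_right, h2] at h1
  have h3 := congrArg (starRingEnd ℂ) h1
  simp only [map_add, map_sum, map_mul, Complex.conj_conj, Complex.conj_ofReal, Complex.conj_I,
    map_ofNat, map_zero, mul_neg, neg_mul, Finset.sum_neg_distrib] at h3
  exact (sub_eq_zero.1 (by rw [sub_eq_add_neg, map_add 𝔸]; exact h3)).symm

end Existence

/-! ### Derivatives from Lipschitz translations. -/

section Derivative

open scoped InnerProductSpace

variable {E I : Type*} [NormedAddCommGroup E] [InnerProductSpace ℂ E]
  {e : HilbertBasis I ℂ E}

/-- A function on which a one-parameter group of translations acts in a Lipschitz way has a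
derivative in that direction. -/
theorem exists_deriv {T : ℝ → E →ₗᵢ[ℂ] E} {p : I → ℝ}
    (hT : ∀ h f k, e.repr (T h f) k = Complex.exp (2 * Real.pi * Complex.I * p k * h) * e.repr f k)
    {f : E} {C : ℝ} (hC : 0 ≤ C) (hf : ∀ h, ‖T h f - f‖ ≤ C * |h|) :
    ∃ f' : E, (∀ k, e.repr f' k = 2 * Real.pi * Complex.I * p k * e.repr f k) ∧ ‖f'‖ ≤ C := by
  refine exists_of_sum_le e _ hC fun s => ?_
  have h1 : ∀ k, Tendsto (fun h : ℝ => ‖(h : ℝ)⁻¹ • (Complex.exp (2 * Real.pi * Complex.I * p k * h)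
      - 1) * e.repr f k‖ ^ 2) (𝓝[≠] 0)
      (𝓝 (‖2 * Real.pi * Complex.I * p k * e.repr f k‖ ^ 2)) := fun k => by
    have hd : HasDerivAt (fun h : ℝ => Complex.exp (2 * Real.pi * Complex.I * p k * h))
        (2 * Real.pi * Complex.I * p k) 0 := by
      have h0 : HasDerivAt (fun h : ℝ => (2 * Real.pi * Complex.I * p k * (h : ℂ)))
          (2 * Real.pi * Complex.I * p k) 0 := by
        simpa using (Complex.ofRealCLM.hasDerivAt (x := (0 : ℝ))).const_mul
          (2 * Real.pi * Complex.I * p k)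
      simpa using h0.cexp
    have := hasDerivAt_iff_tendsto_slope_zero.1 hd
    simp only [zero_add, Complex.ofReal_zero, mul_zero, Complex.exp_zero] at this
    exact ((this.mul_const _).norm).pow 2
  -- On finitely many modes the difference quotients converge termwise, and their uniform bound by
  -- `C` survives in the limit.
  refine le_of_tendsto (tendsto_finsetSum s fun k _ => h1 k) ?_
  filter_upwards [self_mem_nhdsWithin] with h hh
  have hh' : 0 < |h| := abs_pos.2 hh
  have h2 : ∀ k, ‖(h : ℝ)⁻¹ • (Complex.exp (2 * Real.pi * Complex.I * p k * h) - 1) * e.repr f k‖ ^ 2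
      = (|h|⁻¹) ^ 2 * ‖e.repr (T h f - f) k‖ ^ 2 := fun k => by
    rw [map_sub, lp.coeFn_sub, Pi.sub_apply, hT, ← sub_one_mul, norm_mul, norm_smul, norm_mul,
      norm_inv, Real.norm_eq_abs]
    ring
  simp only [h2]
  rw [← Finset.mul_sum]
  have h3 := sum_repr_le e (T h f - f) s
  have h4 : ‖T h f - f‖ ^ 2 ≤ (C * |h|) ^ 2 := by have := hf h; gcongr
  calc _ ≤ (|h|⁻¹) ^ 2 * (C * |h|) ^ 2 := by gcongr; exact h3.trans h4
    _ = C ^ 2 := by field_simp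

end Derivative

/-! ### Flux correctors: gaining a factor δ from the fast frequencies. -/

section ScaleElimination

open scoped InnerProductSpace

variable {E I : Type*} [NormedAddCommGroup E] [InnerProductSpace ℂ E]
  {e : HilbertBasis I ℂ E} {d : ℕ}

/-- The symbol `ℓ_b / |ℓ|²`. -/
def rieszSymbol (ℓ : I → Fin d → ℝ) (b : Fin d) (k : I) : ℂ := ((ℓ k b / ∑ c, ℓ k c ^ 2 : ℝ) : ℂ)

/-- The gap |ℓ| ≥ 1 makes the inverse of the fast gradient bounded; at ℓ = 0 the division by zero
gives the harmless value 0. -/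
theorem norm_rieszSymbol_le {ℓ : I → Fin d → ℝ} (hℓ : ∀ k, ℓ k = 0 ∨ 1 ≤ ∑ b, ℓ k b ^ 2)
    (b : Fin d) (k : I) : ‖rieszSymbol ℓ b k‖ ≤ 1 := by
  rw [rieszSymbol, Complex.norm_real, Real.norm_eq_abs]
  rcases hℓ k with h | h
  · simp [h]
  · rw [abs_div, abs_of_pos (a := ∑ c, ℓ k c ^ 2) (by linarith), div_le_one (by linarith)]
    have h1 : ℓ k b ^ 2 ≤ ∑ c, ℓ k c ^ 2 :=
      Finset.single_le_sum (f := fun c => ℓ k c ^ 2) (fun c _ => sq_nonneg _) (Finset.mem_univ b)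
    have h2 : |ℓ k b| ^ 2 ≤ (∑ c, ℓ k c ^ 2) ^ 2 := by rw [sq_abs]; nlinarith
    exact (sq_le_sq₀ (abs_nonneg _) (by linarith)).1 h2

/-- A field which is solenoidal with respect to the fast frequencies `ℓ`, and has no slow part,
pairs with gradients up to an error of the order of the scale ratio. -/
theorem exists_flux_corrector {κ κ' ℓ : I → Fin d → ℝ} {δ K : ℝ} (hδ : 0 < δ)
    (hκ : ∀ k b, κ k b = κ' k b + δ⁻¹ * ℓ k b) (hℓ : ∀ k, ℓ k = 0 ∨ 1 ≤ ∑ b, ℓ k b ^ 2)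
    {σ : VField d E} (hσ : ∀ k, ℓ k = 0 → ∀ b, e.repr (σ b) k = 0)
    (hdiv : ∀ k, ∑ b, (ℓ k b : ℂ) * e.repr (σ b) k = 0)
    (hD : ∀ b c, ∃ f : E, (∀ k, e.repr f k = κ' k c * e.repr (σ b) k) ∧ ‖f‖ ≤ K) :
    ∃ S : VField d E, ‖S‖ ≤ d * (2 * d * K) ∧
      ∀ (w : E) (W : VField d E), IsGrad e κ w W → ⟪W, σ⟫_ℂ = δ * ⟪W, S⟫_ℂ := by
  choose Y hY hYK using hD
  choose M hM hMn using fun b f => exists_multiplier e _ (norm_rieszSymbol_le hℓ b) f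
  -- With m = ℓ/|ℓ|², the skew tensor Φ_cb = m_c σ_b - m_b σ_c satisfies ℓ·Φ = σ, because ℓ·σ = 0.
  -- By skewness κ annihilates κ·Φ = κ'·Φ + δ⁻¹ σ, so κ·σ = δ κ·S with S = -κ'·Φ. This `S` involves
  -- only slow derivatives of σ; below, `q` stands for κ'·m.
  refine ⟨WithLp.toLp 2 fun b => M b (∑ c, Y c c) - ∑ c, M c (Y b c), ?_, fun w W hW => ?_⟩
  · refine (norm_field_le _).trans ?_
    have : ∀ b ∈ Finset.univ, ‖M b (∑ c, Y c c) - ∑ c, M c (Y b c)‖ ≤ 2 * d * K := fun b _ => by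
      have h1 : ‖M b (∑ c, Y c c)‖ ≤ d * K := by
        refine (hMn _ _).trans ((norm_sum_le _ _).trans ?_)
        exact (Finset.sum_le_card_nsmul _ _ K fun c _ => hYK c c).trans (by simp)
      have h2 : ‖∑ c, M c (Y b c)‖ ≤ d * K := by
        refine (norm_sum_le _ _).trans ?_
        exact (Finset.sum_le_card_nsmul _ _ K fun c _ => (hMn _ _).trans (hYK b c)).trans (by simp)
      have := norm_sub_le (M b (∑ c, Y c c)) (∑ c, M c (Y b c))
      linarith
    exact (Finset.sum_le_card_nsmul _ _ _ this).trans (by simp)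
  · refine (hasSum_inner_field e W σ).unique ?_
    refine ((hasSum_inner_field e W _).mul_left (δ : ℂ)).congr_fun fun k => ?_
    have hS : ∀ b, e.repr ((WithLp.toLp 2 fun b => M b (∑ c, Y c c) - ∑ c, M c (Y b c) :
        VField d E) b) k = rieszSymbol ℓ b k * (∑ c, κ' k c * e.repr (σ c) k)
          - (∑ c, rieszSymbol ℓ c k * κ' k c) * e.repr (σ b) k := fun b => by
      change e.repr (M b (∑ c, Y c c) - ∑ c, M c (Y b c)) k = _
      rw [map_sub, lp.coeFn_sub, Pi.sub_apply, hM, map_sum, map_sum, lp.coeFn_sum, lp.coeFn_sum,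
        Finset.sum_apply, Finset.sum_apply, Finset.sum_mul]
      simp only [hM, hY, mul_assoc]
    have hW' : ∀ b, (starRingEnd ℂ) (e.repr (W b) k)
        = (-(2 * Real.pi * Complex.I) * (starRingEnd ℂ) (e.repr w k)) * κ k b := fun b => by
      rw [hW k b]
      simp only [map_mul, Complex.conj_ofReal, Complex.conj_I, map_ofNat]
      ring
    simp only [hS, hW', mul_assoc, ← Finset.mul_sum]
    rw [mul_left_comm (δ : ℂ), mul_left_comm (δ : ℂ)]
    congr 2
    rcases hℓ k with h0 | h0
    · simp [hσ k h0]
    have hN : ((∑ c, ℓ k c ^ 2 : ℝ) : ℂ) ≠ 0 := by exact_mod_cast (by linarith : _ ≠ (0 : ℝ))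
    have hδ' : (δ : ℂ) ≠ 0 := by exact_mod_cast hδ.ne'
    set N : ℂ := ((∑ c, ℓ k c ^ 2 : ℝ) : ℂ) with hNdef
    set a' : ℂ := ∑ c, κ' k c * e.repr (σ c) k with ha'
    set q : ℂ := ∑ c, rieszSymbol ℓ c k * κ' k c with hq
    have ha : ∑ b, (κ k b : ℂ) * e.repr (σ b) k = a' := by
      have : ∀ b, (κ k b : ℂ) * e.repr (σ b) k
          = κ' k b * e.repr (σ b) k + (δ : ℂ)⁻¹ * (ℓ k b * e.repr (σ b) k) := fun b => by
        rw [hκ]; push_cast; ring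
      simp only [this, Finset.sum_add_distrib, ← Finset.mul_sum, hdiv k, mul_zero, add_zero]
      exact ha'.symm
    have hp : ∑ b, (κ k b : ℂ) * rieszSymbol ℓ b k = q + (δ : ℂ)⁻¹ := by
      have : ∀ b, (κ k b : ℂ) * rieszSymbol ℓ b k
          = rieszSymbol ℓ b k * κ' k b + (δ : ℂ)⁻¹ * (N⁻¹ * ((ℓ k b ^ 2 : ℝ) : ℂ)) := fun b => by
        rw [hκ, rieszSymbol, Complex.ofReal_div, ← hNdef]; push_cast; field_simp
      simp only [this, Finset.sum_add_distrib, ← Finset.mul_sum]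
      rw [← Complex.ofReal_sum, ← hNdef, inv_mul_cancel₀ hN, mul_one]
    have h1 : ∑ b, (κ k b : ℂ) * (rieszSymbol ℓ b k * a' - q * e.repr (σ b) k)
        = (q + (δ : ℂ)⁻¹) * a' - q * a' := by
      have : ∀ b, (κ k b : ℂ) * (rieszSymbol ℓ b k * a' - q * e.repr (σ b) k)
          = (κ k b * rieszSymbol ℓ b k) * a' - q * (κ k b * e.repr (σ b) k) := fun b => by ring
      simp only [this, Finset.sum_sub_distrib, ← Finset.mul_sum, ← Finset.sum_mul, ha, hp]
    rw [ha, h1]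
    field_simp
    ring

/-- The pairing of a purely fast function with a function `w` is of the order of the scale ratio
times the gradient of `w`. -/
theorem exists_fast_corrector {κ κ' ℓ : I → Fin d → ℝ} {δ K K₀ : ℝ} (hδ : 0 < δ)
    (hκ : ∀ k b, κ k b = κ' k b + δ⁻¹ * ℓ k b) (hℓ : ∀ k, ℓ k = 0 ∨ 1 ≤ ∑ b, ℓ k b ^ 2)
    {V : E} (hV : ∀ k, ℓ k = 0 → e.repr V k = 0) (hVn : ‖V‖ ≤ K₀)
    (hD : ∀ c, ∃ f : E, (∀ k, e.repr f k = κ' k c * e.repr V k) ∧ ‖f‖ ≤ K) :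
    ∃ (Z : VField d E) (z : E), ‖Z‖ ≤ d * K₀ ∧ ‖z‖ ≤ d * K ∧
      ∀ (w : E) (W : VField d E), IsGrad e κ w W → ⟪w, V⟫_ℂ = δ * (⟪W, Z⟫_ℂ + ⟪w, z⟫_ℂ) := by
  choose Y hY hYK using hD
  choose M hM hMn using fun b f => exists_multiplier e _ (norm_rieszSymbol_le hℓ b) f
  -- With m = ℓ/|ℓ|² one has κ·m = κ'·m + δ⁻¹ on the support of `V`, hence V = δ((κ·m)V - (κ'·m)V).
  -- In the first term κ is moved onto `w` and becomes `W`, whence the factor i/(2π); the second is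
  -- a slow derivative of `V`.
  refine ⟨WithLp.toLp 2 fun b => (Complex.I / (2 * Real.pi)) • M b V, -∑ b, M b (Y b), ?_, ?_,
    fun w W hW => ?_⟩
  · refine (norm_field_le _).trans ?_
    have : ∀ b ∈ Finset.univ, ‖(Complex.I / (2 * Real.pi)) • M b V‖ ≤ K₀ := fun b _ => by
      rw [norm_smul]
      have h1 : ‖Complex.I / (2 * Real.pi)‖ ≤ 1 := by
        rw [norm_div, Complex.norm_I, norm_mul, Complex.norm_ofNat, Complex.norm_real,
          Real.norm_of_nonneg Real.pi_pos.le, div_le_one (by positivity)]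
        linarith [Real.pi_gt_three]
      calc _ ≤ 1 * ‖M b V‖ := by gcongr
        _ ≤ K₀ := by rw [one_mul]; exact (hMn _ _).trans hVn
    exact (Finset.sum_le_card_nsmul _ _ _ this).trans (by simp)
  · rw [norm_neg]
    refine (norm_sum_le _ _).trans ?_
    exact (Finset.sum_le_card_nsmul _ _ K fun c _ => (hMn _ _).trans (hYK c)).trans (by simp)
  · refine (hasSum_inner e w V).unique ?_
    refine (((hasSum_inner_field e W _).add (hasSum_inner e w _)).mul_left (δ : ℂ)).congr_fun
      fun k => ?_
    have hS : ∀ b, e.repr ((WithLp.toLp 2 fun b => (Complex.I / (2 * Real.pi)) • M b V :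
        VField d E) b) k = (Complex.I / (2 * Real.pi)) * (rieszSymbol ℓ b k * e.repr V k) :=
      fun b => by
        change e.repr ((Complex.I / (2 * Real.pi)) • M b V) k = _
        rw [map_smul, lp.coeFn_smul, Pi.smul_apply, smul_eq_mul, hM]
    have hz : e.repr (-∑ b, M b (Y b)) k
        = -((∑ b, rieszSymbol ℓ b k * κ' k b) * e.repr V k) := by
      rw [map_neg, lp.coeFn_neg, Pi.neg_apply, map_sum, lp.coeFn_sum, Finset.sum_apply,
        Finset.sum_mul]
      simp only [hM, hY, mul_assoc]
    have hπ : (Real.pi : ℂ) ≠ 0 := by exact_mod_cast Real.pi_ne_zero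
    have hW' : ∀ b, (starRingEnd ℂ) (e.repr (W b) k)
        * ((Complex.I / (2 * Real.pi)) * (rieszSymbol ℓ b k * e.repr V k))
        = (κ k b * rieszSymbol ℓ b k) * ((starRingEnd ℂ) (e.repr w k) * e.repr V k) := fun b => by
      rw [hW k b]
      simp only [map_mul, Complex.conj_ofReal, Complex.conj_I, map_ofNat]
      field_simp
      ring_nf
      simp only [Complex.I_sq]
      ring
    simp only [hS, hz, hW', ← Finset.sum_mul]
    rcases hℓ k with h0 | h0
    · simp [hV k h0]
    have hN : ((∑ c, ℓ k c ^ 2 : ℝ) : ℂ) ≠ 0 := by exact_mod_cast (by linarith : _ ≠ (0 : ℝ))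
    have hδ' : (δ : ℂ) ≠ 0 := by exact_mod_cast hδ.ne'
    set N : ℂ := ((∑ c, ℓ k c ^ 2 : ℝ) : ℂ) with hNdef
    have hp : ∑ b, (κ k b : ℂ) * rieszSymbol ℓ b k
        = (∑ c, rieszSymbol ℓ c k * κ' k c) + (δ : ℂ)⁻¹ := by
      have : ∀ b, (κ k b : ℂ) * rieszSymbol ℓ b k
          = rieszSymbol ℓ b k * κ' k b + (δ : ℂ)⁻¹ * (N⁻¹ * ((ℓ k b ^ 2 : ℝ) : ℂ)) := fun b => by
        rw [hκ, rieszSymbol, Complex.ofReal_div, ← hNdef]; push_cast; field_simp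
      simp only [this, Finset.sum_add_distrib, ← Finset.mul_sum]
      rw [← Complex.ofReal_sum, ← hNdef, inv_mul_cancel₀ hN, mul_one]
    rw [hp]
    field_simp
    ring

end ScaleElimination

/-! ### Error of the two-scale expansion. -/

section StepEstimate

open scoped InnerProductSpace

/-- Meant for a = ‖W‖ and t = τ‖w‖: the zeroth-order part of the energy absorbs error terms in `w`
as long as they carry a factor τ. -/
theorem le_of_quadratic_le {lam a t α β : ℝ} (hlam : 0 < lam) (ha : 0 ≤ a) (ht : 0 ≤ t)
    (hα : 0 ≤ α) (hβ : 0 ≤ β) (h : lam * a ^ 2 + t ^ 2 ≤ a * α + t * β) :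
    a ≤ 2 / min lam 1 * (α + β) := by
  have hm : 0 < min lam 1 := lt_min hlam one_pos
  have h1 : min lam 1 * a ^ 2 ≤ lam * a ^ 2 := by gcongr; exact min_le_left _ _
  have h2 : min lam 1 * t ^ 2 ≤ 1 * t ^ 2 := by gcongr; exact min_le_right _ _
  have h3 : min lam 1 * (a + t) ^ 2 ≤ 2 * (α + β) * (a + t) := by
    have : (a + t) ^ 2 ≤ 2 * (a ^ 2 + t ^ 2) := by nlinarith [sq_nonneg (a - t)]
    have h4 : min lam 1 * (a + t) ^ 2 ≤ min lam 1 * (2 * (a ^ 2 + t ^ 2)) := by gcongr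
    nlinarith [mul_nonneg ha hβ, mul_nonneg ht hα]
  rcases (add_nonneg ha ht).eq_or_lt with h0 | h0
  · have : a = 0 := by linarith
    rw [this]; positivity
  · have : min lam 1 * (a + t) ≤ 2 * (α + β) := by nlinarith
    rw [div_mul_eq_mul_div, le_div_iff₀ hm]
    nlinarith

/-- The constant in the estimate for the elimination of one scale. -/
def stepConst (d : ℕ) (lam Mu : ℝ) : ℝ :=
  2 / min lam 1 * (2 * d + 2 * d ^ 2 + 7 * d * Mu) + 7 * d

/-- Arithmetic of the step estimate. The four error terms in `h` come from `Z`, `z`, `S` and `R` in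
`norm_grad_sub_le`; the summand added to `a` in `hN` is the size of δ R. -/
theorem le_stepConst_mul {d : ℕ} {lam Mu δ τ K K₀ a t N : ℝ} (hlam : 0 < lam) (hMu : 0 ≤ Mu)
    (hδ : 0 ≤ δ) (hτ : 0 ≤ τ) (hK : 0 ≤ K) (hK₀ : 0 ≤ K₀) (ha : 0 ≤ a) (ht : 0 ≤ t)
    (h : lam * a ^ 2 + (τ * t) ^ 2 ≤ τ ^ 2 * δ ^ 2 * (a * (d * K₀))
      + τ ^ 2 * δ ^ 2 * (t * (d * K)) + δ * (a * (d * (2 * d * K))) + δ * (a * (Mu * (7 * d * K))))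
    (hN : N ≤ a + δ * (7 * d * K)) :
    N ≤ stepConst d lam Mu * (δ * K + τ * δ ^ 2 * K + τ ^ 2 * δ ^ 2 * K₀) := by
  have main := le_of_quadratic_le (t := τ * t)
    (α := τ ^ 2 * δ ^ 2 * (d * K₀) + δ * (d * (2 * d * K)) + δ * (Mu * (7 * d * K)))
    (β := τ * δ ^ 2 * (d * K)) hlam ha (by positivity) (by positivity)
    (by positivity) (h.trans_eq (by ring))
  have hm : 0 < min lam 1 := lt_min hlam one_pos
  set T := δ * K + τ * δ ^ 2 * K + τ ^ 2 * δ ^ 2 * K₀ with hT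
  have t0 : 0 ≤ δ * K := by positivity
  have t0' : 0 ≤ τ * δ ^ 2 * K := by positivity
  have t0'' : 0 ≤ τ ^ 2 * δ ^ 2 * K₀ := by positivity
  have t1 : δ * K ≤ T := by linarith
  have t2 : τ * δ ^ 2 * K + τ ^ 2 * δ ^ 2 * K₀ ≤ T := by linarith
  have hsum : τ ^ 2 * δ ^ 2 * (d * K₀) + δ * (d * (2 * d * K)) + δ * (Mu * (7 * d * K))
      + τ * δ ^ 2 * (d * K) ≤ (2 * d + 2 * d ^ 2 + 7 * d * Mu) * T := by
    have u1 : (d : ℝ) * (τ * δ ^ 2 * K + τ ^ 2 * δ ^ 2 * K₀) ≤ d * T := by gcongr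
    have u2 : (2 * d ^ 2 + 7 * d * Mu) * (δ * K) ≤ (2 * d ^ 2 + 7 * d * Mu) * T := by gcongr
    have u3 : 0 ≤ (d : ℝ) * T := by positivity
    linarith
  calc N ≤ a + δ * (7 * d * K) := hN
    _ ≤ 2 / min lam 1 * ((2 * d + 2 * d ^ 2 + 7 * d * Mu) * T) + 7 * d * T := by
      refine add_le_add (main.trans (by gcongr)) ?_
      calc δ * (7 * d * K) = 7 * d * (δ * K) := by ring
        _ ≤ 7 * d * T := by gcongr
    _ = stepConst d lam Mu * T := by rw [stepConst]; ring

variable {E I : Type*} [NormedAddCommGroup E] [InnerProductSpace ℂ E]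
  {e : HilbertBasis I ℂ E} {d : ℕ} {lam Mu δ τ K K₀ : ℝ} {𝔸 : VField d E →L[ℂ] VField d E}
  {κ κ' ℓ : I → Fin d → ℝ} {ξ g G₀ H F₀ : VField d E} {x U₀ V : E}

set_option maxHeartbeats 800000 in
-- The difference w = x - (U₀ + δ V), with gradient `W`, is tested against its own equation. The
-- fluxes of the exact and of the homogenized problem are integrated by parts. What remains is the
-- pairing of `W` with the residual flux σ, of `w` with τ² δ V, and of `W` with 𝔸(δ R); the two flux
-- lemmas make the first O(δ) and the second O(τ²δ²).
theorem norm_grad_sub_le (hlam : 0 < lam) (hMu : 0 ≤ Mu) (hδ : 0 < δ) (hτ : 0 < τ)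
    (hA : IsElliptic lam Mu 𝔸)
    (hκ : ∀ k b, κ k b = κ' k b + δ⁻¹ * ℓ k b) (hℓ : ∀ k, ℓ k = 0 ∨ 1 ≤ ∑ b, ℓ k b ^ 2)
    (hx : IsCorrector e κ τ 𝔸 ξ x g) (hU₀ : IsGrad e κ U₀ G₀)
    (hF₀ : IsDiv e κ F₀ ((τ ^ 2 : ℂ) • U₀)) (hF₀' : ∀ k, ℓ k ≠ 0 → ∀ b, e.repr (F₀ b) k = 0)
    (hV : IsCorrector e ℓ 0 𝔸 (ξ + G₀) V H) (hV₀ : ∀ k, ℓ k = 0 → e.repr V k = 0)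
    (hσ : ∀ k, ℓ k = 0 → ∀ b, e.repr (𝔸 (H + (ξ + G₀)) b) k = e.repr (F₀ b) k)
    (hDV : ∀ c, ∃ f : E, (∀ k, e.repr f k = κ' k c * e.repr V k) ∧ ‖f‖ ≤ K)
    (hDσ : ∀ b c, ∃ f : E,
      (∀ k, e.repr f k = κ' k c * e.repr ((𝔸 (H + (ξ + G₀)) - F₀) b) k) ∧ ‖f‖ ≤ K)
    (hK : 0 ≤ K) (hVn : ‖V‖ ≤ K₀) :
    ‖g - (G₀ + H)‖ ≤ stepConst d lam Mu * (δ * K + τ * δ ^ 2 * K + τ ^ 2 * δ ^ 2 * K₀) := by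
  have hK₀ : 0 ≤ K₀ := (norm_nonneg _).trans hVn
  set P := H + (ξ + G₀) with hP
  set σ := 𝔸 P - F₀ with hσdef
  obtain ⟨S, hSn, hS⟩ := exists_flux_corrector (e := e) (σ := σ) hδ hκ hℓ
    (fun k hk b => by
      rw [hσdef, PiLp.sub_apply, map_sub, lp.coeFn_sub, Pi.sub_apply, hσ k hk b, sub_self])
    -- Fast divergence of σ: for ℓ ≠ 0 the field `F₀` is absent, and `𝔸 P` is divergence free by the
    -- equation of `V`, where τ = 0.
    (fun k => by
      by_cases hk : ℓ k = 0
      · simp [hk]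
      have h1 := hV.div k
      rw [← hP] at h1
      simp only [Complex.ofReal_zero, ne_eq, OfNat.ofNat_ne_zero, not_false_eq_true, zero_pow,
        zero_smul, map_zero, lp.coeFn_zero, Pi.zero_apply, mul_assoc, ← Finset.mul_sum] at h1
      have hπ : (Real.pi : ℂ) ≠ 0 := by exact_mod_cast Real.pi_ne_zero
      have h2 : ∑ b, (ℓ k b : ℂ) * e.repr (𝔸 P b) k = 0 := by
        simpa [hπ] using h1
      rw [← h2]
      refine Finset.sum_congr rfl fun b _ => ?_
      rw [hσdef, PiLp.sub_apply, map_sub, lp.coeFn_sub, Pi.sub_apply, hF₀' k hk b, sub_zero]) hDσ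
  obtain ⟨Z, z, hZn, hzn, hZ⟩ := exists_fast_corrector (e := e) hδ hκ hℓ hV₀ hVn hDV
  choose Y hY hYK using hDV
  -- `R` is the slow gradient of `V`; in its bound, 7 dominates 2π.
  let R : VField d E := WithLp.toLp 2 fun b => (2 * Real.pi * Complex.I) • Y b
  have hRn : ‖R‖ ≤ 7 * d * K := by
    refine (norm_field_le _).trans ?_
    have : ∀ b ∈ Finset.univ, ‖(2 * Real.pi * Complex.I) • Y b‖ ≤ 7 * K := fun b _ => by
      rw [norm_smul]
      have h1 : ‖(2 * Real.pi * Complex.I : ℂ)‖ ≤ 7 := by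
        simp only [norm_mul, Complex.norm_ofNat, Complex.norm_real, Complex.norm_I,
          Real.norm_of_nonneg Real.pi_pos.le, mul_one]
        linarith [Real.pi_lt_d2]
      have := hYK b
      gcongr
    exact (Finset.sum_le_card_nsmul _ _ _ this).trans_eq (by simp; ring)
  have hδ' : (δ : ℂ) ≠ 0 := by exact_mod_cast hδ.ne'
  have hU : IsGrad e κ (U₀ + (δ : ℂ) • V) (G₀ + (H + (δ : ℂ) • R)) := by
    refine hU₀.add fun k b => ?_
    rw [PiLp.add_apply, PiLp.smul_apply]
    change e.repr (H b + (δ : ℂ) • (2 * Real.pi * Complex.I) • Y b) k = _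
    rw [map_add, map_smul, map_smul, map_smul]
    simp only [lp.coeFn_add, lp.coeFn_smul, Pi.add_apply, Pi.smul_apply, smul_eq_mul, hY,
      hV.grad k b, hκ k b]
    push_cast
    field_simp
    ring
  have hW := hx.grad.sub hU
  set w := x - (U₀ + (δ : ℂ) • V) with hw
  set W := g - (G₀ + (H + (δ : ℂ) • R)) with hWdef
  have e1 := hW.inner_eq hx.div
  have e2 := hW.inner_eq hF₀
  have e3 := hS w W hW
  have e4 := hZ w W hW
  have hdec : 𝔸 W = 𝔸 (g + ξ) - σ - F₀ - (δ : ℂ) • 𝔸 R := by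
    rw [hσdef, hWdef, hP]
    simp only [map_sub, map_add, map_smul]
    abel
  have hxw : x = w + U₀ + (δ : ℂ) • V := by rw [hw]; abel
  have e5 : ⟪w, (τ ^ 2 : ℂ) • x⟫_ℂ = ⟪w, (τ ^ 2 : ℂ) • w⟫_ℂ + ⟪w, (τ ^ 2 : ℂ) • U₀⟫_ℂ
      + (τ ^ 2 : ℂ) * (δ * ⟪w, V⟫_ℂ) := by
    conv_lhs => rw [hxw]
    simp only [smul_add, inner_add_right, inner_smul_right]
  -- The terms with `U₀` cancel: the contribution of `F₀` is exactly the τ²U₀ part of τ²x.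
  have key : ⟪W, 𝔸 W⟫_ℂ + ⟪w, (τ ^ 2 : ℂ) • w⟫_ℂ
      = -(((τ ^ 2 * δ ^ 2 : ℝ) : ℂ) * ⟪W, Z⟫_ℂ + ((τ ^ 2 * δ ^ 2 : ℝ) : ℂ) * ⟪w, z⟫_ℂ
        + (δ : ℂ) * ⟪W, S⟫_ℂ + (δ : ℂ) * ⟪W, 𝔸 R⟫_ℂ) := by
    rw [hdec, inner_sub_right, inner_sub_right, inner_sub_right, inner_smul_right, e1, e2, e3, e5,
      e4]
    push_cast
    ring
  have hre := congrArg Complex.re key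
  simp only [Complex.add_re, Complex.neg_re, Complex.re_ofReal_mul] at hre
  have f1 : (⟪w, (τ ^ 2 : ℂ) • w⟫_ℂ).re = (τ * ‖w‖) ^ 2 := by
    rw [inner_smul_right, inner_self_eq_norm_sq_to_K]
    have : (τ : ℂ) ^ 2 * (‖w‖ : ℂ) ^ 2 = (((τ * ‖w‖) ^ 2 : ℝ) : ℂ) := by push_cast; ring
    exact (congrArg Complex.re this).trans (Complex.ofReal_re _)
  have f2 := hA.coercive W
  have lower : ∀ {G : Type _} [NormedAddCommGroup G] [InnerProductSpace ℂ G] (p q : G),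
      -(‖p‖ * ‖q‖) ≤ (⟪p, q⟫_ℂ).re := fun p q =>
    (abs_le.1 ((Complex.abs_re_le_norm _).trans (norm_inner_le_norm p q))).1
  have f3 := lower W Z
  have f4 := lower w z
  have f5 := lower W S
  have f6 := lower W (𝔸 R)
  have g3 : ‖W‖ * ‖Z‖ ≤ ‖W‖ * (d * K₀) := by gcongr
  have g4 : ‖w‖ * ‖z‖ ≤ ‖w‖ * (d * K) := by gcongr
  have g5 : ‖W‖ * ‖S‖ ≤ ‖W‖ * (d * (2 * d * K)) := by gcongr
  have g6 : ‖W‖ * ‖𝔸 R‖ ≤ ‖W‖ * (Mu * (7 * d * K)) := by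
    gcongr
    exact (hA.bounded R).trans (by gcongr)
  have hc : 0 < τ ^ 2 * δ ^ 2 := by positivity
  have k3 : -(τ ^ 2 * δ ^ 2 * (⟪W, Z⟫_ℂ).re) ≤ τ ^ 2 * δ ^ 2 * (‖W‖ * (d * K₀)) := by
    rw [← mul_neg]; gcongr; linarith
  have k4 : -(τ ^ 2 * δ ^ 2 * (⟪w, z⟫_ℂ).re) ≤ τ ^ 2 * δ ^ 2 * (‖w‖ * (d * K)) := by
    rw [← mul_neg]; gcongr; linarith
  have k5 : -(δ * (⟪W, S⟫_ℂ).re) ≤ δ * (‖W‖ * (d * (2 * d * K))) := by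
    rw [← mul_neg]; gcongr; linarith
  have k6 : -(δ * (⟪W, 𝔸 R⟫_ℂ).re) ≤ δ * (‖W‖ * (Mu * (7 * d * K))) := by
    rw [← mul_neg]; gcongr; linarith
  have hfin : g - (G₀ + H) = W + (δ : ℂ) • R := by rw [hWdef]; abel
  refine le_stepConst_mul (t := ‖w‖) hlam hMu hδ.le hτ.le hK hK₀ (norm_nonneg W) (norm_nonneg w)
    (by linarith) ?_
  rw [hfin]
  refine (norm_add_le _ _).trans (add_le_add le_rfl ?_)
  rw [norm_smul, Complex.norm_real, Real.norm_of_nonneg hδ.le]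
  gcongr

end StepEstimate

theorem integral_comp_measurePreserving {α β F : Type*} [MeasurableSpace α] [MeasurableSpace β]
    [NormedAddCommGroup F] [NormedSpace ℝ F] {μ : Measure α} {ν : Measure β} {T : α → β}
    (hT : MeasurePreserving T μ ν) {f : β → F} (hf : AEStronglyMeasurable f ν) :
    ∫ x, f (T x) ∂μ = ∫ y, f y ∂ν := by
  rw [← integral_map hT.measurable.aemeasurable (by rwa [hT.map_eq]), hT.map_eq]

/-! ### The cell as a torus: translations and the Fourier basis. -/

section Cell

variable {d n : ℕ}

/-- The Lebesgue measure of the periodicity cell. -/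
def cellMeasure (d n : ℕ) : Measure (Var d n) := volume.restrict (cell d n)

/-- The Lebesgue measure of the unit interval. -/
def unitMeasure : Measure ℝ := volume.restrict (Set.Ico 0 1)

instance : IsProbabilityMeasure unitMeasure := ⟨by simp [unitMeasure]⟩

theorem cell_eq_pi (d n : ℕ) :
    cell d n = Set.univ.pi fun _ => Set.univ.pi fun _ => Set.Ico (0 : ℝ) 1 := by
  ext y
  simp only [Set.mem_univ_pi, Set.mem_Ico]
  exact Iff.rfl

theorem measurableSet_cell (d n : ℕ) : MeasurableSet (cell d n) := by
  rw [cell_eq_pi]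
  exact MeasurableSet.univ_pi fun _ => MeasurableSet.univ_pi fun _ => measurableSet_Ico

theorem cellMeasure_eq_pi (d n : ℕ) :
    cellMeasure d n = Measure.pi fun _ : Fin n => Measure.pi fun _ : Fin d => unitMeasure := by
  rw [cellMeasure, cell_eq_pi, volume_pi, Measure.restrict_pi_pi]
  simp only [volume_pi, Measure.restrict_pi_pi]
  rfl

instance : IsProbabilityMeasure (cellMeasure d n) := by
  rw [cellMeasure_eq_pi]; infer_instance

theorem ae_mem_cell (d n : ℕ) : ∀ᵐ y ∂cellMeasure d n, y ∈ cell d n :=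
  ae_restrict_mem (measurableSet_cell d n)

/-- The torus of dimension `d n`. -/
abbrev Torus (d n : ℕ) : Type := UnitAddTorus (Fin n × Fin d)

/-- The normalized measure of the torus. -/
def torusMeasure (d n : ℕ) : Measure (Torus d n) :=
  Measure.pi fun _ => (AddCircle.haarAddCircle : Measure UnitAddCircle)

/-- The projection onto the torus. -/
def toTorus (y : Var d n) : Torus d n := fun p => (y p.1 p.2 : UnitAddCircle)

/-- The representative in the cell of a point of the torus. -/
def repr (t : Torus d n) : Var d n := fun i k => (AddCircle.equivIco 1 0 (t (i, k)) : ℝ)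

/-- The representative in the cell of a point of the space. -/
def fract (y : Var d n) : Var d n := fun i k => Int.fract (y i k)

theorem repr_toTorus (y : Var d n) : repr (toTorus y) = fract y := by
  ext i k
  have := AddCircle.coe_equivIco_mk_apply (p := (1 : ℝ)) (y i k)
  rw [div_one, mul_one] at this
  exact this

theorem fract_of_mem {y : Var d n} (hy : y ∈ cell d n) : fract y = y := by
  ext i k
  exact Int.fract_eq_self.2 (hy i k)

theorem measurePreserving_unit :
    MeasurePreserving ((↑) : ℝ → UnitAddCircle) unitMeasure AddCircle.haarAddCircle := by
  have h := AddCircle.measurePreserving_mk 1 0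
  rw [zero_add, AddCircle.volume_eq_smul_haarAddCircle, ENNReal.ofReal_one, one_smul,
    ← restrict_Ico_eq_restrict_Ioc] at h
  exact h

theorem measurePreserving_toTorus :
    MeasurePreserving (toTorus (d := d) (n := n)) (cellMeasure d n) (torusMeasure d n) := by
  have hm : Measurable (toTorus (d := d) (n := n)) :=
    measurable_pi_lambda _ fun p => measurePreserving_unit.measurable.comp
      ((measurable_pi_apply p.2).comp (measurable_pi_apply p.1))
  refine ⟨hm, ?_⟩
  refine (Measure.pi_eq fun s hs => ?_).symm
  rw [Measure.map_apply hm (MeasurableSet.univ_pi hs), cellMeasure_eq_pi]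
  have : toTorus ⁻¹' Set.univ.pi s
      = Set.univ.pi fun i => Set.univ.pi fun k => ((↑) : ℝ → UnitAddCircle) ⁻¹' s (i, k) := by
    ext y
    simp [toTorus]
  rw [this, Measure.pi_pi]
  simp only [Measure.pi_pi]
  rw [Fintype.prod_prod_type]
  exact Finset.prod_congr rfl fun i _ => Finset.prod_congr rfl fun k _ =>
    measurePreserving_unit.measure_preimage (hs _).nullMeasurableSet

theorem measurable_repr : Measurable (repr (d := d) (n := n)) :=
  measurable_pi_lambda _ fun i => measurable_pi_lambda _ fun k =>
    measurable_subtype_coe.comp ((AddCircle.measurableEquivIco 1 0).measurable.comp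
      (measurable_pi_apply (i, k)))

theorem measurePreserving_repr :
    MeasurePreserving (repr (d := d) (n := n)) (torusMeasure d n) (cellMeasure d n) := by
  refine ⟨measurable_repr, ?_⟩
  rw [← measurePreserving_toTorus.map_eq,
    Measure.map_map measurable_repr measurePreserving_toTorus.measurable]
  have : repr ∘ toTorus =ᵐ[cellMeasure d n] id := by
    filter_upwards [ae_mem_cell d n] with y hy
    rw [Function.comp_apply, repr_toTorus, fract_of_mem hy, id]
  rw [Measure.map_congr this, Measure.map_id]

instance : (torusMeasure d n).IsAddHaarMeasure := by
  unfold torusMeasure; infer_instance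

/-- Translation by `h`, followed by the reduction to the cell. -/
def translate (h y : Var d n) : Var d n := fract (y + h)

/-- On the torus this is the invariance of Haar measure; `toTorus` and `repr` carry it to the cell.
-/
theorem measurePreserving_translate (h : Var d n) :
    MeasurePreserving (translate h) (cellMeasure d n) (cellMeasure d n) := by
  have h1 := measurePreserving_repr.comp
    ((measurePreserving_add_right (torusMeasure d n) (toTorus h)).comp measurePreserving_toTorus)
  have h2 : repr ∘ (fun t => t + toTorus h) ∘ toTorus = translate h := by
    ext1 y
    rw [Function.comp_apply, Function.comp_apply, translate, ← repr_toTorus]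
    rfl
  rwa [h2] at h1

theorem IsPeriodic.fract {F : Type*} {f : Var d n → F} (hf : IsPeriodic f) (y : Var d n) :
    f (fract y) = f y := by
  rw [← hf (fun i k => ⌊y i k⌋) (Multiscale.fract y)]
  congr 1
  ext i k
  exact Int.fract_add_floor _

theorem IsPeriodic.translate {F : Type*} {f : Var d n → F} (hf : IsPeriodic f) (h y : Var d n) :
    f (translate h y) = f (y + h) := hf.fract _

/-- The phase `k · y`. -/
def phase (k : Fin n → Fin d → ℤ) (y : Var d n) : ℝ := ∑ i, ∑ b, k i b * y i b

/-- The exponential `exp (2πi k · y)`. -/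
def mode (k : Fin n → Fin d → ℤ) (y : Var d n) : ℂ :=
  Complex.exp (2 * Real.pi * Complex.I * phase k y)

theorem phase_add (k : Fin n → Fin d → ℤ) (y h : Var d n) :
    phase k (y + h) = phase k y + phase k h := by
  simp only [phase, Pi.add_apply, mul_add, Finset.sum_add_distrib]

theorem mode_add (k : Fin n → Fin d → ℤ) (y h : Var d n) :
    mode k (y + h) = mode k h * mode k y := by
  rw [mode, mode, mode, ← Complex.exp_add, phase_add]
  congr 1
  push_cast
  ring

theorem continuous_phase (k : Fin n → Fin d → ℤ) : Continuous (phase k) := by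
  unfold phase; fun_prop

theorem continuous_mode (k : Fin n → Fin d → ℤ) : Continuous (mode k) :=
  Complex.continuous_exp.comp (continuous_const.mul
    (Complex.continuous_ofReal.comp (continuous_phase k)))

theorem norm_mode (k : Fin n → Fin d → ℤ) (y : Var d n) : ‖mode k y‖ = 1 := by
  rw [mode, Complex.norm_exp]
  simp

theorem phase_int (k z : Fin n → Fin d → ℤ) :
    phase k (fun i b => (z i b : ℝ)) = ((∑ i, ∑ b, k i b * z i b : ℤ) : ℝ) := by
  simp [phase]

theorem isPeriodic_mode (k : Fin n → Fin d → ℤ) : IsPeriodic (mode k) := fun z y => by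
  have h1 : (fun i b => y i b + (z i b : ℝ)) = y + fun i b => (z i b : ℝ) := rfl
  rw [h1, mode_add]
  have : mode k (fun i b => (z i b : ℝ)) = 1 := by
    rw [mode, phase_int, Complex.exp_eq_one_iff]
    exact ⟨∑ i, ∑ b, k i b * z i b, by push_cast; ring⟩
  rw [this, one_mul]

theorem mode_eq_mFourier (k : Fin n → Fin d → ℤ) (y : Var d n) :
    mode k y = UnitAddTorus.mFourier (fun p : Fin n × Fin d => k p.1 p.2) (toTorus y) := by
  simp only [UnitAddTorus.mFourier, ContinuousMap.coe_mk, toTorus, fourier_coe_apply]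
  rw [Fintype.prod_prod_type]
  simp only [← Complex.exp_sum]
  rw [mode, phase]
  congr 1
  push_cast
  simp only [Finset.mul_sum]
  exact Finset.sum_congr rfl fun i _ => Finset.sum_congr rfl fun b _ => by ring

/-- Complex-valued square integrable functions on the cell. -/
abbrev L2 (d n : ℕ) : Type := Lp ℂ 2 (cellMeasure d n)

theorem memLp_mode (k : Fin n → Fin d → ℤ) : MemLp (mode k) 2 (cellMeasure d n) :=
  MemLp.of_bound (continuous_mode k).aestronglyMeasurable 1
    (Eventually.of_forall fun y => (norm_mode k y).le)

/-- The exponentials as elements of `L²`. -/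
def modeL2 (k : Fin n → Fin d → ℤ) : L2 d n := (memLp_mode k).toLp _

/-- The Fourier basis of `L²` of the torus. -/
def torusBasis (d n : ℕ) : HilbertBasis (Fin n × Fin d → ℤ) ℂ (Lp ℂ 2 (torusMeasure d n)) :=
  UnitAddTorus.mFourierBasis

theorem coeFn_torusBasis (k : Fin n × Fin d → ℤ) :
    torusBasis d n k =ᵐ[torusMeasure d n] UnitAddTorus.mFourier k := by
  have : torusBasis d n k = UnitAddTorus.mFourierLp 2 k :=
    congrFun UnitAddTorus.coe_mFourierBasis k
  rw [this]
  exact UnitAddTorus.coeFn_mFourierLp 2 k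

/-- Pull-back from the torus to the cell. -/
def pullback (d n : ℕ) : Lp ℂ 2 (torusMeasure d n) →ₗᵢ[ℂ] L2 d n :=
  Lp.compMeasurePreservingₗᵢ ℂ toTorus measurePreserving_toTorus

theorem pullback_torusBasis (k : Fin n → Fin d → ℤ) :
    pullback d n (torusBasis d n fun p => k p.1 p.2) = modeL2 k := by
  refine Lp.ext ?_
  refine (Lp.coeFn_compMeasurePreserving _ measurePreserving_toTorus).trans ?_
  refine EventuallyEq.trans ?_ (memLp_mode k).coeFn_toLp.symm
  filter_upwards [measurePreserving_toTorus.quasiMeasurePreserving.ae_eq_comp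
    (coeFn_torusBasis fun p : Fin n × Fin d => k p.1 p.2)] with y hy
  rw [hy, mode_eq_mFourier]
  rfl

theorem orthonormal_modeL2 : Orthonormal ℂ (modeL2 (d := d) (n := n)) := by
  have h := (((torusBasis d n).orthonormal).comp_linearIsometry (pullback d n)).comp
    (fun (k : Fin n → Fin d → ℤ) (p : Fin n × Fin d) => k p.1 p.2)
    (fun k k' h => by ext i b; exact congrFun h (i, b))
  convert h using 1
  ext1 k
  exact (pullback_torusBasis k).symm

/-- `repr` inverts `toTorus` almost everywhere. Surjectivity of the pull-back is what transfers
completeness of the exponentials from the torus to the cell. -/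
theorem exists_pullback_eq (f : L2 d n) : ∃ g, pullback d n g = f := by
  refine ⟨Lp.compMeasurePreserving repr measurePreserving_repr f, ?_⟩
  refine Lp.ext ?_
  refine (Lp.coeFn_compMeasurePreserving _ measurePreserving_toTorus).trans ?_
  filter_upwards [measurePreserving_toTorus.quasiMeasurePreserving.ae_eq_comp
    (Lp.coeFn_compMeasurePreserving f measurePreserving_repr), ae_mem_cell d n] with y hy hc
  rw [hy, Function.comp_apply, Function.comp_apply, repr_toTorus, fract_of_mem hc]

/-- The Fourier basis of `L²` of the cell. -/
def cellBasis (d n : ℕ) : HilbertBasis (Fin n → Fin d → ℤ) ℂ (L2 d n) :=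
  HilbertBasis.mkOfOrthogonalEqBot orthonormal_modeL2 (by
    rw [Submodule.eq_bot_iff]
    intro f hf
    obtain ⟨g, rfl⟩ := exists_pullback_eq f
    have h : g = 0 := by
      refine repr_ext (torusBasis d n) fun k => ?_
      rw [map_zero, lp.coeFn_zero, Pi.zero_apply, HilbertBasis.repr_apply_apply,
        ← (pullback d n).inner_map_map]
      have := pullback_torusBasis (d := d) (n := n) fun i b => k (i, b)
      refine (congrArg (inner ℂ · _) this).trans ?_
      exact (Submodule.mem_orthogonal _ _).1 hf _ (Submodule.subset_span ⟨_, rfl⟩)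
    rw [h, map_zero])

theorem cellBasis_apply (k : Fin n → Fin d → ℤ) : cellBasis d n k = modeL2 k :=
  congrFun (HilbertBasis.coe_mkOfOrthogonalEqBot _ _) k

theorem inner_eq_integral (f g : L2 d n) :
    inner ℂ f g = ∫ y, (starRingEnd ℂ) (f y) * g y ∂cellMeasure d n := by
  rw [MeasureTheory.L2.inner_def]
  simp only [RCLike.inner_apply, mul_comm]

theorem cellBasis_repr (f : L2 d n) (k : Fin n → Fin d → ℤ) :
    (cellBasis d n).repr f k
      = ∫ y, (starRingEnd ℂ) (mode k y) * f y ∂cellMeasure d n := by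
  rw [HilbertBasis.repr_apply_apply, cellBasis_apply, inner_eq_integral]
  refine integral_congr_ae ?_
  filter_upwards [(memLp_mode k).coeFn_toLp] with y hy
  rw [modeL2, hy]

theorem cellBasis_repr_toLp {f : Var d n → ℂ} (hf : MemLp f 2 (cellMeasure d n))
    (k : Fin n → Fin d → ℤ) : (cellBasis d n).repr (hf.toLp f) k
      = ∫ y, (starRingEnd ℂ) (mode k y) * f y ∂cellMeasure d n := by
  rw [cellBasis_repr]
  refine integral_congr_ae ?_
  filter_upwards [hf.coeFn_toLp] with y hy
  rw [hy]

/-- The action of translations on `L²`. -/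
def shift (h : Var d n) : L2 d n →ₗᵢ[ℂ] L2 d n :=
  Lp.compMeasurePreservingₗᵢ ℂ (translate h) (measurePreserving_translate h)

theorem coeFn_shift (h : Var d n) (f : L2 d n) :
    shift h f =ᵐ[cellMeasure d n] fun y => f (translate h y) :=
  Lp.coeFn_compMeasurePreserving f (measurePreserving_translate h)

/-- Translations are diagonal in the Fourier basis, as required by the abstract regularity estimate
and by `exists_deriv`. -/
theorem repr_shift (h : Var d n) (f : L2 d n) (k : Fin n → Fin d → ℤ) :
    (cellBasis d n).repr (shift h f) k = mode k h * (cellBasis d n).repr f k := by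
  rw [cellBasis_repr, cellBasis_repr]
  have h2 : ∫ y, (starRingEnd ℂ) (mode k y) * f y ∂cellMeasure d n
      = ∫ y, (starRingEnd ℂ) (mode k (translate h y)) * f (translate h y) ∂cellMeasure d n := by
    exact (integral_comp_measurePreserving (measurePreserving_translate h)
      ((Complex.continuous_conj.comp (continuous_mode k)).aestronglyMeasurable.mul
      (Lp.aestronglyMeasurable f))).symm
  rw [h2, ← integral_const_mul]
  refine integral_congr_ae ?_
  filter_upwards [coeFn_shift h f] with y hy
  rw [hy, (isPeriodic_mode k).translate, mode_add, map_mul, ← mul_assoc, ← mul_assoc,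
    Complex.mul_conj, Complex.normSq_eq_norm_sq, norm_mode]
  simp

end Cell

/-! ### Multiplication by a matrix function as an elliptic operator. -/

section Multiplication

open scoped InnerProductSpace

variable {d n : ℕ}

theorem exists_mulScalar {β : Var d n → ℝ} {C : ℝ} (hβ : Measurable β) (hC : ∀ y, |β y| ≤ C) :
    ∃ M : L2 d n →L[ℂ] L2 d n,
      ∀ f, M f =ᵐ[cellMeasure d n] fun y => (β y : ℂ) * f y := by
  have hb : ∀ f : L2 d n, MemLp (fun y => (β y : ℂ) * f y) 2 (cellMeasure d n) := fun f =>
    MemLp.of_le_mul (Lp.memLp f) ((Complex.measurable_ofReal.comp hβ).aestronglyMeasurable.mul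
      (Lp.aestronglyMeasurable f)) (c := C) (Eventually.of_forall fun y => by
        rw [norm_mul, Complex.norm_real]
        gcongr
        exact hC y)
  let M₀ : L2 d n →ₗ[ℂ] L2 d n :=
    { toFun := fun f => (hb f).toLp _
      map_add' := fun f g => by
        refine Lp.ext ?_
        filter_upwards [(hb (f + g)).coeFn_toLp, (hb f).coeFn_toLp, (hb g).coeFn_toLp,
          Lp.coeFn_add f g, Lp.coeFn_add ((hb f).toLp _) ((hb g).toLp _)] with y h1 h2 h3 h4 h5
        rw [h1, h5, Pi.add_apply, h2, h3, h4, Pi.add_apply, mul_add]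
      map_smul' := fun c f => by
        refine Lp.ext ?_
        filter_upwards [(hb (c • f)).coeFn_toLp, (hb f).coeFn_toLp, Lp.coeFn_smul c f,
          Lp.coeFn_smul c ((hb f).toLp _)] with y h1 h2 h3 h4
        rw [h1, RingHom.id_apply, h4, Pi.smul_apply, h2, h3, Pi.smul_apply, smul_eq_mul,
          smul_eq_mul, mul_left_comm] }
  refine ⟨M₀.mkContinuous C fun f => ?_, fun f => (hb f).coeFn_toLp⟩
  refine Lp.norm_le_mul_norm_of_ae_le_mul ?_
  filter_upwards [(hb f).coeFn_toLp] with y hy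
  change ‖((hb f).toLp _ : L2 d n) y‖ ≤ _
  rw [hy, norm_mul, Complex.norm_real]
  gcongr
  exact hC y

/-- Matrix functions with measurable bounded entries. -/
structure IsBoundedMatrix (Mu : ℝ) (B : Var d n → Matrix (Fin d) (Fin d) ℝ) : Prop where
  measurable : ∀ a b, Measurable fun y => B y a b
  bound : ∀ y a b, |B y a b| ≤ Mu

theorem exists_matOp {Mu : ℝ} {B : Var d n → Matrix (Fin d) (Fin d) ℝ}
    (hB : IsBoundedMatrix Mu B) : ∃ 𝔸 : VField d (L2 d n) →L[ℂ] VField d (L2 d n),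
      ∀ g a, 𝔸 g a =ᵐ[cellMeasure d n] fun y => ∑ b, (B y a b : ℂ) * g b y := by
  choose M hM using fun a b => exists_mulScalar (hB.measurable a b) (fun y => hB.bound y a b)
  refine ⟨(PiLp.continuousLinearEquiv 2 ℂ fun _ : Fin d => L2 d n).symm.toContinuousLinearMap ∘L
    ContinuousLinearMap.pi fun a => ∑ b, M a b ∘L PiLp.proj 2 (fun _ : Fin d => L2 d n) b,
    fun g a => ?_⟩
  have h1 : ((PiLp.continuousLinearEquiv 2 ℂ fun _ : Fin d => L2 d n).symm.toContinuousLinearMap ∘L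
    ContinuousLinearMap.pi fun a => ∑ b, M a b ∘L PiLp.proj 2 (fun _ : Fin d => L2 d n) b) g a
      = ∑ b, M a b (g b) := by
    simp
  rw [h1]
  refine (Lp.coeFn_finsetSum _ _).trans ?_
  filter_upwards [eventually_countable_forall.2 fun b => hM a b (g b)] with y hy
  rw [Finset.sum_apply]
  exact Finset.sum_congr rfl fun b _ => hy b

open Classical in
/-- The operator of multiplication by a bounded matrix function. -/
def matOp (B : Var d n → Matrix (Fin d) (Fin d) ℝ) :
    VField d (L2 d n) →L[ℂ] VField d (L2 d n) :=
  if h : ∃ Mu, IsBoundedMatrix Mu B then (exists_matOp h.choose_spec).choose else 0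

variable {Mu : ℝ} {B B' : Var d n → Matrix (Fin d) (Fin d) ℝ}

theorem coeFn_matOp (hB : IsBoundedMatrix Mu B) (g : VField d (L2 d n)) (a : Fin d) :
    matOp B g a =ᵐ[cellMeasure d n] fun y => ∑ b, (B y a b : ℂ) * g b y := by
  have h : ∃ Mu, IsBoundedMatrix Mu B := ⟨Mu, hB⟩
  rw [matOp, dif_pos h]
  exact (exists_matOp h.choose_spec).choose_spec g a

theorem field_ext {g h : VField d (L2 d n)} (H : ∀ a, g a =ᵐ[cellMeasure d n] h a) : g = h :=
  PiLp.ext fun a => Lp.ext (H a)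

theorem norm_le_of_ae_le_sum {f : L2 d n} {g : VField d (L2 d n)} {C : ℝ} (hC : 0 ≤ C)
    (h : ∀ᵐ y ∂cellMeasure d n, ‖f y‖ ≤ ∑ b, C * ‖g b y‖) : ‖f‖ ≤ d * C * ‖g‖ := by
  have hm : ∀ b, MemLp (fun y => ((C * ‖g b y‖ : ℝ) : ℂ)) 2 (cellMeasure d n) := fun b =>
    ((Lp.memLp (g b)).norm.const_mul C).ofReal
  have h1 : ‖f‖ ≤ ‖∑ b, (hm b).toLp _‖ := by
    refine Lp.norm_le_norm_of_ae_le ?_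
    filter_upwards [h, Lp.coeFn_finsetSum Finset.univ fun b => (hm b).toLp _,
      eventually_countable_forall.2 fun b => (hm b).coeFn_toLp] with y h1 h2 h3
    rw [h2, Finset.sum_apply, Finset.sum_congr rfl fun b _ => h3 b, ← Complex.ofReal_sum,
      Complex.norm_real]
    exact h1.trans (le_abs_self _)
  refine h1.trans ((norm_sum_le _ _).trans ?_)
  have h2 : ∀ b ∈ Finset.univ, ‖(hm b).toLp _‖ ≤ C * ‖g‖ := fun b _ => by
    have h3 : ‖(hm b).toLp _‖ ≤ C * ‖g b‖ := by
      refine Lp.norm_le_mul_norm_of_ae_le_mul ?_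
      filter_upwards [(hm b).coeFn_toLp] with y hy
      rw [hy, Complex.norm_real, Real.norm_of_nonneg (by positivity)]
    exact h3.trans (by gcongr; exact norm_apply_le g b)
  exact (Finset.sum_le_card_nsmul _ _ _ h2).trans_eq (by simp [mul_assoc])

theorem norm_matOp_le (hMu : 0 ≤ Mu) (hB : IsBoundedMatrix Mu B) (g : VField d (L2 d n)) :
    ‖matOp B g‖ ≤ d ^ 2 * Mu * ‖g‖ := by
  refine (norm_field_le _).trans ?_
  have h2 : ∀ a ∈ Finset.univ, ‖matOp B g a‖ ≤ d * Mu * ‖g‖ := fun a _ => by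
    refine norm_le_of_ae_le_sum hMu ?_
    filter_upwards [coeFn_matOp hB g a] with y hy
    rw [hy]
    refine (norm_sum_le _ _).trans (Finset.sum_le_sum fun b _ => ?_)
    rw [norm_mul, Complex.norm_real]
    gcongr
    exact hB.bound y a b
  exact (Finset.sum_le_card_nsmul _ _ _ h2).trans_eq (by simp; ring)

theorem IsBoundedMatrix.sub {Mu' : ℝ} (hB : IsBoundedMatrix Mu B) (hB' : IsBoundedMatrix Mu' B') :
    IsBoundedMatrix (Mu + Mu') fun y => B y - B' y :=
  ⟨fun a b => (hB.measurable a b).sub (hB'.measurable a b), fun y a b =>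
    (abs_sub _ _).trans (add_le_add (hB.bound y a b) (hB'.bound y a b))⟩

theorem matOp_sub_apply {Mu' : ℝ} (hB : IsBoundedMatrix Mu B) (hB' : IsBoundedMatrix Mu' B')
    (g : VField d (L2 d n)) : matOp B g - matOp B' g = matOp (fun y => B y - B' y) g := by
  refine field_ext fun a => ?_
  filter_upwards [coeFn_matOp hB g a, coeFn_matOp hB' g a, coeFn_matOp (hB.sub hB') g a,
    Lp.coeFn_sub (matOp B g a) (matOp B' g a)] with y h1 h2 h3 h4
  rw [PiLp.sub_apply, h4, Pi.sub_apply, h1, h2, h3, ← Finset.sum_sub_distrib]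
  refine Finset.sum_congr rfl fun b _ => ?_
  rw [Matrix.sub_apply]
  push_cast
  ring

theorem norm_matOp_sub_le {ε Mu' : ℝ} (hε : 0 ≤ ε) (hB : IsBoundedMatrix Mu B)
    (hB' : IsBoundedMatrix Mu' B') (h : ∀ y a b, |B y a b - B' y a b| ≤ ε)
    (g : VField d (L2 d n)) : ‖matOp B g - matOp B' g‖ ≤ d ^ 2 * ε * ‖g‖ := by
  rw [matOp_sub_apply hB hB']
  exact norm_matOp_le hε ⟨(hB.sub hB').measurable, h⟩ g

/-- For a real matrix, symmetric or not, the real part of the complex form splits into the forms of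
the real and of the imaginary part of `z`. -/
theorem re_quadratic_ge {lam : ℝ} {N : Matrix (Fin d) (Fin d) ℝ}
    (hN : ∀ ξ : Fin d → ℝ, lam * (ξ ⬝ᵥ ξ) ≤ ξ ⬝ᵥ (N *ᵥ ξ)) (z : Fin d → ℂ) :
    lam * ∑ a, ‖z a‖ ^ 2 ≤ (∑ a, (starRingEnd ℂ) (z a) * ∑ b, (N a b : ℂ) * z b).re := by
  have h1 := hN fun a => (z a).re
  have h2 := hN fun a => (z a).im
  have h3 : ∑ a, ‖z a‖ ^ 2
      = (fun a => (z a).re) ⬝ᵥ (fun a => (z a).re) + (fun a => (z a).im) ⬝ᵥ (fun a => (z a).im) := by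
    simp only [dotProduct, ← Finset.sum_add_distrib]
    refine Finset.sum_congr rfl fun a _ => ?_
    rw [← Complex.normSq_eq_norm_sq, Complex.normSq_apply]
  have h4 : (∑ a, (starRingEnd ℂ) (z a) * ∑ b, (N a b : ℂ) * z b).re
      = (fun a => (z a).re) ⬝ᵥ (N *ᵥ fun a => (z a).re)
        + (fun a => (z a).im) ⬝ᵥ (N *ᵥ fun a => (z a).im) := by
    simp only [dotProduct, Matrix.mulVec, ← Finset.sum_add_distrib, Complex.re_sum]
    refine Finset.sum_congr rfl fun a _ => ?_
    rw [Complex.mul_re, Complex.re_sum, Complex.im_sum]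
    simp
  rw [h3, h4, mul_add]
  exact add_le_add h1 h2

theorem re_inner_field (g f : VField d (L2 d n)) :
    (⟪g, f⟫_ℂ).re = ∫ y, (∑ a, (starRingEnd ℂ) (g a y) * f a y).re ∂cellMeasure d n := by
  have hi : ∀ a, Integrable (fun y => (starRingEnd ℂ) (g a y) * f a y) (cellMeasure d n) :=
    fun a => by
      have := L2.integrable_inner (𝕜 := ℂ) (g a) (f a)
      simpa only [RCLike.inner_apply, mul_comm] using this
  have h2 : ∫ y, RCLike.re (∑ a, (starRingEnd ℂ) (g a y) * f a y) ∂cellMeasure d n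
      = RCLike.re (∫ y, (∑ a, (starRingEnd ℂ) (g a y) * f a y) ∂cellMeasure d n) :=
    integral_re (integrable_finsetSum _ fun a _ => hi a)
  refine Eq.trans ?_ h2.symm
  rw [integral_finsetSum _ fun a _ => hi a, PiLp.inner_apply]
  simp only [inner_eq_integral]
  rfl

theorem isElliptic_matOp {lam : ℝ} (hMu : 0 ≤ Mu) (hB : IsBoundedMatrix Mu B)
    (hell : ∀ y (ξ : Fin d → ℝ), lam * (ξ ⬝ᵥ ξ) ≤ ξ ⬝ᵥ (B y *ᵥ ξ)) :
    IsElliptic lam (d ^ 2 * Mu) (matOp B) := by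
  refine ⟨fun g => ?_, norm_matOp_le hMu hB⟩
  have hi : ∀ f : VField d (L2 d n),
      Integrable (fun y => (∑ a, (starRingEnd ℂ) (g a y) * f a y).re) (cellMeasure d n) := fun f =>
    (integrable_finsetSum _ fun a _ => by
      have := L2.integrable_inner (𝕜 := ℂ) (g a) (f a)
      simpa only [RCLike.inner_apply, mul_comm] using this).re
  have h1 : ‖g‖ ^ 2 = (⟪g, g⟫_ℂ).re := by
    rw [inner_self_eq_norm_sq_to_K]
    norm_cast
  rw [h1, re_inner_field, re_inner_field, ← integral_const_mul]
  refine integral_mono_ae ((hi g).const_mul lam) (hi _) ?_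
  filter_upwards [eventually_countable_forall.2 fun a => coeFn_matOp hB g a] with y hy
  simp only [hy]
  refine le_trans (le_of_eq ?_) (re_quadratic_ge (hell y) fun a => g a y)
  rw [Complex.re_sum]
  congr 1
  refine Finset.sum_congr rfl fun a _ => ?_
  rw [mul_comm, Complex.mul_conj, Complex.ofReal_re, Complex.normSq_eq_norm_sq]

theorem mapField_shift_matOp (hB : IsBoundedMatrix Mu B) (hper : IsPeriodic B) (h : Var d n)
    (g : VField d (L2 d n)) :
    mapField (shift h) (matOp B g) = matOp (fun y => B (y + h)) (mapField (shift h) g) := by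
  have hB' : IsBoundedMatrix Mu fun y => B (y + h) :=
    ⟨fun a b => (hB.measurable a b).comp (measurable_id.add_const h),
      fun y a b => hB.bound (y + h) a b⟩
  refine field_ext fun a => ?_
  rw [mapField_apply]
  filter_upwards [coeFn_shift h (matOp B g a),
    (measurePreserving_translate h).quasiMeasurePreserving.ae_eq_comp (coeFn_matOp hB g a),
    coeFn_matOp hB' (mapField (shift h) g) a,
    eventually_countable_forall.2 fun b => coeFn_shift h (g b)] with y h1 h2 h3 h4
  rw [h1, h3]
  refine h2.trans ?_
  simp only [Function.comp_apply]
  refine Finset.sum_congr rfl fun b _ => ?_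
  rw [mapField_apply, h4, hper.translate]

/-- Past a translation, multiplication by `B` becomes multiplication by B(· + h), so the commutator
is multiplication by B(· + h) - B. -/
theorem norm_commutator_le {L : ℝ} (hL : 0 ≤ L) (hB : IsBoundedMatrix Mu B) (hper : IsPeriodic B)
    (hlip : ∀ y y' a b, |B y a b - B y' a b| ≤ L * ‖y - y'‖) (h : Var d n)
    (g : VField d (L2 d n)) :
    ‖mapField (shift h) (matOp B g) - matOp B (mapField (shift h) g)‖ ≤ d ^ 2 * (L * ‖h‖) * ‖g‖ := by
  have hB' : IsBoundedMatrix Mu fun y => B (y + h) :=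
    ⟨fun a b => (hB.measurable a b).comp (measurable_id.add_const h),
      fun y a b => hB.bound (y + h) a b⟩
  rw [mapField_shift_matOp hB hper]
  refine (norm_matOp_sub_le (ε := L * ‖h‖) (by positivity) hB' hB (fun y a b => ?_) _).trans ?_
  · simpa using hlip (y + h) y a b
  · rw [LinearIsometry.norm_map]

/-- Constant fields. -/
def constField (n : ℕ) (v : Fin d → ℂ) : VField d (L2 d n) :=
  WithLp.toLp 2 fun a => (memLp_const (v a)).toLp _

theorem coeFn_constField (v : Fin d → ℂ) (a : Fin d) :
    constField n v a =ᵐ[cellMeasure d n] fun _ => v a := (memLp_const (v a)).coeFn_toLp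

theorem mapField_shift_constField (h : Var d n) (v : Fin d → ℂ) :
    mapField (shift h) (constField n v) = constField n v := by
  refine field_ext fun a => ?_
  rw [mapField_apply]
  filter_upwards [coeFn_shift h (constField n v a), coeFn_constField (n := n) v a,
    (measurePreserving_translate h).quasiMeasurePreserving.ae_eq_comp
      (coeFn_constField (n := n) v a)] with y h1 h2 h3
  rw [h1, h2]
  exact h3

end Multiplication

/-! ### From weak solutions to Fourier correctors. -/

section Transfer

open scoped InnerProductSpace

variable {d n : ℕ}

/-- The symbol of the directional gradient `∑ i, w_i ∇_{y_i}`, without the factor `2πi`. -/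
def symb (w : Fin n → ℝ) (k : Fin n → Fin d → ℤ) (b : Fin d) : ℝ := ∑ i, w i * k i b

theorem phase_unitVec (k : Fin n → Fin d → ℤ) (i : Fin n) (b : Fin d) :
    phase k (unitVec i b) = k i b := by
  rw [phase, Finset.sum_eq_single i, Finset.sum_eq_single b]
  · simp [unitVec]
  · intro c _ hc
    simp [unitVec, hc]
  · simp
  · intro j _ hj
    simp [unitVec, hj]
  · simp

theorem phase_smul (k : Fin n → Fin d → ℤ) (t : ℝ) (y : Var d n) :
    phase k (t • y) = t * phase k y := by
  simp only [phase, Pi.smul_apply, smul_eq_mul, Finset.mul_sum]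
  exact Finset.sum_congr rfl fun i _ => Finset.sum_congr rfl fun b _ => by ring

/-- The phase as a linear form. -/
def phaseCLM (k : Fin n → Fin d → ℤ) : Var d n →L[ℝ] ℝ where
  toFun := phase k
  map_add' := phase_add k
  map_smul' := phase_smul k
  cont := continuous_phase k

/-- The real part of `mode k`. -/
def cosMode (k : Fin n → Fin d → ℤ) (y : Var d n) : ℝ := Real.cos (2 * Real.pi * phase k y)

/-- The imaginary part of `mode k`. -/
def sinMode (k : Fin n → Fin d → ℤ) (y : Var d n) : ℝ := Real.sin (2 * Real.pi * phase k y)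

theorem mode_eq (k : Fin n → Fin d → ℤ) (y : Var d n) :
    mode k y = cosMode k y + sinMode k y * Complex.I := by
  rw [mode, cosMode, sinMode, Complex.ofReal_cos, Complex.ofReal_sin, ← Complex.exp_mul_I]
  congr 1
  push_cast
  ring

theorem hasFDerivAt_arg (k : Fin n → Fin d → ℤ) (y : Var d n) :
    HasFDerivAt (fun y => 2 * Real.pi * phase k y) ((2 * Real.pi) • phaseCLM k) y :=
  (phaseCLM k).hasFDerivAt.const_mul (2 * Real.pi)

theorem contDiff_arg (k : Fin n → Fin d → ℤ) :
    ContDiff ℝ ∞ (fun y : Var d n => 2 * Real.pi * phase k y) :=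
  contDiff_const.mul (phaseCLM k).contDiff

theorem contDiff_cosMode (k : Fin n → Fin d → ℤ) : ContDiff ℝ ∞ (cosMode (d := d) k) :=
  Real.contDiff_cos.comp (contDiff_arg k)

theorem contDiff_sinMode (k : Fin n → Fin d → ℤ) : ContDiff ℝ ∞ (sinMode (d := d) k) :=
  Real.contDiff_sin.comp (contDiff_arg k)

theorem isPeriodic_cosMode (k : Fin n → Fin d → ℤ) : IsPeriodic (cosMode (d := d) k) := fun z y => by
  have := congrArg Complex.re (isPeriodic_mode k z y)
  simpa [mode_eq] using this

theorem isPeriodic_sinMode (k : Fin n → Fin d → ℤ) : IsPeriodic (sinMode (d := d) k) := fun z y => by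
  have := congrArg Complex.im (isPeriodic_mode k z y)
  simpa [mode_eq] using this

theorem hatGrad_cosMode (δ : Fin n → ℝ) (k : Fin n → Fin d → ℤ) (y : Var d n) (b : Fin d) :
    hatGrad δ (cosMode k) y b
      = -(2 * Real.pi * symb (fun i => (δ i)⁻¹) k b) * sinMode k y := by
  have h := (hasFDerivAt_arg k y).cos
  have h1 : fderiv ℝ (cosMode k) y = _ := h.fderiv
  simp only [hatGrad, h1, symb, Finset.mul_sum, Finset.sum_mul, ← Finset.sum_neg_distrib]
  refine Finset.sum_congr rfl fun i _ => ?_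
  have : phaseCLM k (unitVec i b) = k i b := phase_unitVec k i b
  simp only [smul_apply, this,
    smul_eq_mul, sinMode]
  ring

theorem hatGrad_sinMode (δ : Fin n → ℝ) (k : Fin n → Fin d → ℤ) (y : Var d n) (b : Fin d) :
    hatGrad δ (sinMode k) y b
      = (2 * Real.pi * symb (fun i => (δ i)⁻¹) k b) * cosMode k y := by
  have h := (hasFDerivAt_arg k y).sin
  have h1 : fderiv ℝ (sinMode k) y = _ := h.fderiv
  simp only [hatGrad, h1, symb, Finset.mul_sum, Finset.sum_mul]
  refine Finset.sum_congr rfl fun i _ => ?_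
  have : phaseCLM k (unitVec i b) = k i b := phase_unitVec k i b
  simp only [smul_apply, this, smul_eq_mul, cosMode]
  ring

theorem integrable_mul_bounded {X φ : Var d n → ℝ} (hX : MemLp X 2 (cellMeasure d n))
    (hφ : Continuous φ) (hb : ∃ C, ∀ y, |φ y| ≤ C) :
    Integrable (fun y => X y * φ y) (cellMeasure d n) := by
  obtain ⟨C, hC⟩ := hb
  exact (hX.integrable one_le_two).mul_bdd hφ.aestronglyMeasurable (Eventually.of_forall hC)

/-- A real square integrable function as an element of the complex `L²`. -/
def ofRealL2 {X : Var d n → ℝ} (hX : MemLp X 2 (cellMeasure d n)) : L2 d n :=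
  (hX.ofReal (K := ℂ)).toLp fun y => (X y : ℂ)

theorem coeFn_ofRealL2 {X : Var d n → ℝ} (hX : MemLp X 2 (cellMeasure d n)) :
    ofRealL2 hX =ᵐ[cellMeasure d n] fun y => (X y : ℂ) := MemLp.coeFn_toLp _

/-- The weak formulation admits real test functions only, so Fourier coefficients are assembled from
cosine and sine integrals. -/
theorem repr_ofReal {X : Var d n → ℝ} (hX : MemLp X 2 (cellMeasure d n))
    (k : Fin n → Fin d → ℤ) : (cellBasis d n).repr (ofRealL2 hX) k
      = ((∫ y, X y * cosMode k y ∂cellMeasure d n : ℝ) : ℂ)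
        - Complex.I * ((∫ y, X y * sinMode k y ∂cellMeasure d n : ℝ) : ℂ) := by
  have hc := integrable_mul_bounded hX (contDiff_cosMode k).continuous
    ⟨1, fun y => Real.abs_cos_le_one _⟩
  have hs := integrable_mul_bounded hX (contDiff_sinMode k).continuous
    ⟨1, fun y => Real.abs_sin_le_one _⟩
  rw [ofRealL2, cellBasis_repr_toLp, ← integral_complex_ofReal, ← integral_complex_ofReal,
    ← integral_const_mul, ← integral_sub hc.ofReal (hs.ofReal.const_mul _)]
  refine integral_congr_ae (Eventually.of_forall fun y => ?_)
  simp only [mode_eq, map_add, map_mul, Complex.conj_ofReal, Complex.conj_I]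
  push_cast
  ring

theorem memLp_flux {Mu : ℝ} {B : Var d n → Matrix (Fin d) (Fin d) ℝ} (hB : IsBoundedMatrix Mu B)
    {G : Var d n → Fin d → ℝ} (hG : ∀ k, MemLp (fun y => G y k) 2 (cellMeasure d n)) (a : Fin d) :
    MemLp (fun y => (B y *ᵥ G y) a) 2 (cellMeasure d n) := by
  simp only [Matrix.mulVec, dotProduct]
  refine memLp_finsetSum _ fun b _ => ?_
  refine MemLp.of_le_mul (hG b) ((hB.measurable a b).aestronglyMeasurable.mul
    (hG b).aestronglyMeasurable) (c := Mu) (Eventually.of_forall fun y => ?_)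
  rw [norm_mul]
  gcongr
  exact hB.bound y a b

/-- The weak formulation for the total flux. -/
theorem IsWeakCorrector.flux_eq {Mu : ℝ} {δ : Fin n → ℝ} {τ : ℝ}
    {B : Var d n → Matrix (Fin d) (Fin d) ℝ} (hB : IsBoundedMatrix Mu B) {v : Fin d → ℝ}
    {X : Var d n → ℝ} {G : Var d n → Fin d → ℝ} (h : IsWeakCorrector δ τ B v X G)
    {φ : Var d n → ℝ} (hφ : ContDiff ℝ ∞ φ) (hper : IsPeriodic φ) {ψ : Fin d → Var d n → ℝ}
    (hψ : ∀ y b, hatGrad δ φ y b = ψ b y) (hψc : ∀ b, Continuous (ψ b))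
    (hψb : ∀ b, ∃ C, ∀ y, |ψ b y| ≤ C) :
    ∑ b, ∫ y, (B y *ᵥ fun a => G y a + v a) b * ψ b y ∂cellMeasure d n
      = -(τ ^ 2 * ∫ y, X y * φ y ∂cellMeasure d n) := by
  have h1 := h.weak_eq φ hφ hper
  have hv : ∀ k : Fin d, MemLp (fun _ : Var d n => v k) 2 (cellMeasure d n) :=
    fun k => memLp_const _
  have i1 : ∀ b, Integrable (fun y => (B y *ᵥ G y) b * ψ b y) (cellMeasure d n) := fun b =>
    integrable_mul_bounded (memLp_flux hB h.memLp_grad b) (hψc b) (hψb b)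
  have i2 : ∀ b, Integrable (fun y => (B y *ᵥ v) b * ψ b y) (cellMeasure d n) := fun b =>
    integrable_mul_bounded (memLp_flux hB hv b) (hψc b) (hψb b)
  have e1 : ∫ y in cell d n, (B y *ᵥ G y) ⬝ᵥ hatGrad δ φ y
      = ∑ b, ∫ y, (B y *ᵥ G y) b * ψ b y ∂cellMeasure d n := by
    rw [← integral_finsetSum _ fun b _ => i1 b]
    simp only [dotProduct, hψ]
    rfl
  have e2 : ∫ y in cell d n, (B y *ᵥ v) ⬝ᵥ hatGrad δ φ y
      = ∑ b, ∫ y, (B y *ᵥ v) b * ψ b y ∂cellMeasure d n := by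
    rw [← integral_finsetSum _ fun b _ => i2 b]
    simp only [dotProduct, hψ]
    rfl
  rw [e1, e2] at h1
  have e3 : ∀ b, ∫ y, (B y *ᵥ fun a => G y a + v a) b * ψ b y ∂cellMeasure d n
      = ∫ y, (B y *ᵥ G y) b * ψ b y ∂cellMeasure d n
        + ∫ y, (B y *ᵥ v) b * ψ b y ∂cellMeasure d n := fun b => by
    rw [← integral_add (i1 b) (i2 b)]
    refine integral_congr_ae (Eventually.of_forall fun y => ?_)
    have : (B y *ᵥ fun a => G y a + v a) = B y *ᵥ G y + B y *ᵥ v := Matrix.mulVec_add _ _ _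
    simp only [this, Pi.add_apply]
    ring
  simp only [e3, Finset.sum_add_distrib]
  change _ + τ ^ 2 * ∫ y, X y * φ y ∂cellMeasure d n = _ at h1
  linarith

/-- The cosines and sines of 2πk·y are enough as test functions: they yield every Fourier
coefficient of both weak identities. -/
theorem IsWeakCorrector.isCorrector {Mu : ℝ} {δ : Fin n → ℝ} {τ : ℝ}
    {B : Var d n → Matrix (Fin d) (Fin d) ℝ} (hB : IsBoundedMatrix Mu B) {v : Fin d → ℝ}
    {X : Var d n → ℝ} {G : Var d n → Fin d → ℝ} (h : IsWeakCorrector δ τ B v X G)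
    (hX : MemLp X 2 (cellMeasure d n)) (hG : ∀ b, MemLp (fun y => G y b) 2 (cellMeasure d n)) :
    IsCorrector (cellBasis d n) (symb fun i => (δ i)⁻¹) τ (matOp B)
      (constField n fun a => (v a : ℂ))
      (ofRealL2 hX) (WithLp.toLp 2 fun b => ofRealL2 (hG b)) := by
  have hF : ∀ b, MemLp (fun y => (B y *ᵥ fun a => G y a + v a) b) 2 (cellMeasure d n) :=
    memLp_flux hB fun k => (hG k).add (memLp_const (v k))
  refine ⟨fun k b => ?_, fun k => ?_⟩
  · change (cellBasis d n).repr (ofRealL2 (hG b)) k = _ * (cellBasis d n).repr (ofRealL2 hX) k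
    rw [repr_ofReal, repr_ofReal]
    have h1 := h.weak_grad _ (contDiff_cosMode k) (isPeriodic_cosMode k) b
    have h2 := h.weak_grad _ (contDiff_sinMode k) (isPeriodic_sinMode k) b
    simp only [hatGrad_cosMode, hatGrad_sinMode, mul_left_comm (X _)] at h1 h2
    rw [integral_const_mul] at h1 h2
    change ∫ y, G y b * cosMode k y ∂cellMeasure d n
      = -(_ * ∫ y, X y * sinMode k y ∂cellMeasure d n) at h1
    change ∫ y, G y b * sinMode k y ∂cellMeasure d n
      = -(_ * ∫ y, X y * cosMode k y ∂cellMeasure d n) at h2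
    rw [h1, h2]
    push_cast
    ring_nf
    simp only [Complex.I_sq]
    ring
  · have hflux : ∀ b, matOp B ((WithLp.toLp 2 fun b => ofRealL2 (hG b))
        + constField n fun a => (v a : ℂ)) b = ofRealL2 (hF b) := fun b => by
      refine Lp.ext ?_
      refine (coeFn_matOp hB _ b).trans ?_
      filter_upwards [coeFn_ofRealL2 (hF b),
        eventually_countable_forall.2 fun a => coeFn_ofRealL2 (hG a),
        eventually_countable_forall.2 fun a => coeFn_constField (n := n) (fun a => (v a : ℂ)) a,
        eventually_countable_forall.2 fun a => Lp.coeFn_add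
          (ofRealL2 (hG a)) (constField n (fun a => (v a : ℂ)) a)]
        with y h1 h2 h3 h4
      rw [h1, Matrix.mulVec, dotProduct]
      push_cast
      refine Finset.sum_congr rfl fun a _ => ?_
      congr 1
      rw [PiLp.add_apply]
      refine (h4 a).trans ?_
      rw [Pi.add_apply, h2, h3]
    have h1 := h.flux_eq hB (contDiff_cosMode k) (isPeriodic_cosMode k)
      (fun y b => hatGrad_cosMode δ k y b) (fun b => continuous_const.mul (contDiff_sinMode k).continuous)
      (fun b => ⟨|2 * Real.pi * symb (fun i => (δ i)⁻¹) k b|, fun y => by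
        rw [abs_mul, abs_neg]
        exact mul_le_of_le_one_right (abs_nonneg _) (Real.abs_sin_le_one _)⟩)
    have h2 := h.flux_eq hB (contDiff_sinMode k) (isPeriodic_sinMode k)
      (fun y b => hatGrad_sinMode δ k y b) (fun b => continuous_const.mul (contDiff_cosMode k).continuous)
      (fun b => ⟨|2 * Real.pi * symb (fun i => (δ i)⁻¹) k b|, fun y => by
        rw [abs_mul]
        exact mul_le_of_le_one_right (abs_nonneg _) (Real.abs_cos_le_one _)⟩)
    rw [map_smul, lp.coeFn_smul, Pi.smul_apply, smul_eq_mul, repr_ofReal]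
    have e0 : ∀ b, (cellBasis d n).repr (matOp B ((WithLp.toLp 2 fun b =>
        ofRealL2 (hG b)) + constField n fun a => (v a : ℂ)) b) k = _ :=
      fun b => (congrArg (fun f => (cellBasis d n).repr f k) (hflux b)).trans (repr_ofReal (hF b) k)
    refine (Finset.sum_congr rfl fun b _ => congrArg (_ * ·) (e0 b)).trans ?_
    simp only [mul_left_comm _ (_ * symb _ _ _), mul_left_comm _ (-(_ * symb _ _ _))] at h1 h2
    simp only [integral_const_mul] at h1 h2
    have c1 := congrArg (fun r : ℝ => (r : ℂ)) h1
    have c2 := congrArg (fun r : ℝ => (r : ℂ)) h2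
    push_cast at c1 c2
    have : ∀ b, 2 * (Real.pi : ℂ) * Complex.I * (symb (fun i => (δ i)⁻¹) k b : ℂ)
        * (((∫ y, (B y *ᵥ fun a => G y a + v a) b * cosMode k y ∂cellMeasure d n : ℝ) : ℂ)
          - Complex.I * ((∫ y, (B y *ᵥ fun a => G y a + v a) b * sinMode k y
            ∂cellMeasure d n : ℝ) : ℂ))
        = Complex.I * (2 * Real.pi * symb (fun i => (δ i)⁻¹) k b *
            ((∫ y, (B y *ᵥ fun a => G y a + v a) b * cosMode k y ∂cellMeasure d n : ℝ) : ℂ))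
          - -(2 * Real.pi * symb (fun i => (δ i)⁻¹) k b) *
            ((∫ y, (B y *ᵥ fun a => G y a + v a) b * sinMode k y ∂cellMeasure d n : ℝ) : ℂ) :=
      fun b => by
        ring_nf
        simp only [Complex.I_sq]
        ring
    rw [Finset.sum_congr rfl fun b _ => this b, Finset.sum_sub_distrib, ← Finset.mul_sum, c1, c2]
    ring

end Transfer

/-! ### From Fourier correctors back to weak solutions. -/

section TransferBack

open scoped InnerProductSpace

variable {d n : ℕ}

theorem IsPeriodic.exists_bound {F : Type*} [SeminormedAddCommGroup F] {f : Var d n → F}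
    (hf : IsPeriodic f) (hc : Continuous f) : ∃ C, ∀ y, ‖f y‖ ≤ C := by
  have hK : IsCompact (Set.univ.pi fun _ : Fin n => Set.univ.pi fun _ : Fin d => Set.Icc (0 : ℝ) 1) :=
    isCompact_univ_pi fun _ => isCompact_univ_pi fun _ => isCompact_Icc
  obtain ⟨C, hC⟩ := hK.exists_bound_of_continuousOn hc.continuousOn
  refine ⟨C, fun y => ?_⟩
  rw [← hf.fract y]
  exact hC _ fun i _ k _ => ⟨Int.fract_nonneg _, (Int.fract_lt_one _).le⟩

theorem integral_translate {f : Var d n → ℂ} (hf : IsPeriodic f) (hc : Continuous f) (h : Var d n) :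
    ∫ y, f (y + h) ∂cellMeasure d n = ∫ y, f y ∂cellMeasure d n := by
  rw [← integral_comp_measurePreserving (measurePreserving_translate h) hc.aestronglyMeasurable]
  simp only [hf.translate]

/-- The mean of the derivative of a periodic function vanishes. -/
theorem integral_lineDeriv_eq_zero {f f' : Var d n → ℂ} (hf : IsPeriodic f) (hc : Continuous f)
    (hf' : IsPeriodic f') (hc' : Continuous f') {u : Var d n}
    (hd : ∀ y (t : ℝ), HasDerivAt (fun t : ℝ => f (y + t • u)) (f' (y + t • u)) t) :
    ∫ y, f' y ∂cellMeasure d n = 0 := by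
  obtain ⟨C, hC⟩ := hf'.exists_bound hc'
  obtain ⟨C₀, hC₀⟩ := hf.exists_bound hc
  have h := (hasDerivAt_integral_of_dominated_loc_of_deriv_le (μ := cellMeasure d n)
    (F := fun (t : ℝ) y => f (y + t • u)) (F' := fun (t : ℝ) y => f' (y + t • u)) (x₀ := 0)
    (s := Set.univ) (bound := fun _ => C) Filter.univ_mem
    (Eventually.of_forall fun t => (hc.comp (continuous_add_const _)).aestronglyMeasurable)
    (Integrable.of_bound (hc.comp (continuous_add_const _)).aestronglyMeasurable C₀
      (Eventually.of_forall fun y => hC₀ _))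
    (hc'.comp (continuous_add_const _)).aestronglyMeasurable
    (Eventually.of_forall fun y t _ => hC _) (integrable_const C)
    (Eventually.of_forall fun y t _ => hd y t)).2
  -- By translation invariance the differentiated integral is constant in `t`, so its derivative is
  -- 0.
  simp only [integral_translate hf hc] at h
  have := h.unique (hasDerivAt_const _ _)
  simpa using this

theorem conj_mode (k : Fin n → Fin d → ℤ) (y : Var d n) :
    (starRingEnd ℂ) (mode k y) = mode (-k) y := by
  rw [mode, mode, ← Complex.exp_conj]
  congr 1
  simp only [map_mul, Complex.conj_ofReal, Complex.conj_I, map_ofNat, phase, Pi.neg_apply]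
  push_cast
  simp only [neg_mul, Finset.sum_neg_distrib]
  ring

theorem hasDerivAt_mode_line (k : Fin n → Fin d → ℤ) (y u : Var d n) (t : ℝ) :
    HasDerivAt (fun t : ℝ => mode k (y + t • u))
      (2 * Real.pi * Complex.I * phase k u * mode k (y + t • u)) t := by
  have h1 : HasDerivAt (fun t : ℝ => 2 * Real.pi * Complex.I * (phase k (y + t • u) : ℂ))
      (2 * Real.pi * Complex.I * phase k u) t := by
    have h2 : HasDerivAt (fun t : ℝ => phase k (y + t • u)) (phase k u) t := by
      simp only [phase_add, phase_smul]
      simpa using ((hasDerivAt_id t).mul_const (phase k u)).const_add (phase k y)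
    exact h2.ofReal_comp.const_mul _
  exact h1.cexp.congr_deriv (mul_comm _ _)

theorem isPeriodic_fderiv_apply {φ : Var d n → ℝ} (hper : IsPeriodic φ) (u : Var d n) :
    IsPeriodic fun y => fderiv ℝ φ y u := fun z y => by
  have h1 : (fun i k => y i k + (z i k : ℝ)) = y + fun i k => (z i k : ℝ) := rfl
  have h2 : (fun x => φ (x + fun i k => (z i k : ℝ))) = φ := funext fun x => hper z x
  change fderiv ℝ φ (fun i k => y i k + (z i k : ℝ)) u = _
  rw [h1, ← fderiv_comp_add_right, h2]

variable {φ : Var d n → ℝ}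

theorem memLp_of_periodic (hc : Continuous φ) (hper : IsPeriodic φ) :
    MemLp φ 2 (cellMeasure d n) := by
  obtain ⟨C, hC⟩ := hper.exists_bound hc
  exact MemLp.of_bound hc.aestronglyMeasurable C (Eventually.of_forall hC)

/-- Integration by parts: the derivative of the periodic product mode(-k) φ has mean zero. -/
theorem integral_mode_mul_fderiv (hφ : ContDiff ℝ ∞ φ) (hper : IsPeriodic φ)
    (k : Fin n → Fin d → ℤ) (u : Var d n) :
    ∫ y, (starRingEnd ℂ) (mode k y) * (fderiv ℝ φ y u : ℂ) ∂cellMeasure d n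
      = 2 * Real.pi * Complex.I * phase k u
        * ∫ y, (starRingEnd ℂ) (mode k y) * (φ y : ℂ) ∂cellMeasure d n := by
  have hcd : Continuous fun y => fderiv ℝ φ y u :=
    (hφ.continuous_fderiv (by simp)).clm_apply continuous_const
  have hpd := isPeriodic_fderiv_apply hper u
  have hc := hφ.continuous
  have hm := continuous_mode (-k)
  have hpm := isPeriodic_mode (-k)
  simp only [conj_mode]
  have c1 : Continuous fun y => mode (-k) y * (φ y : ℂ) := hm.mul (Complex.continuous_ofReal.comp hc)
  have c2 : Continuous fun y => mode (-k) y * (fderiv ℝ φ y u : ℂ) :=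
    hm.mul (Complex.continuous_ofReal.comp hcd)
  have p1 : IsPeriodic fun y => mode (-k) y * (φ y : ℂ) := fun z y => by
    have h1 := hpm z y
    have h2 := hper z y
    simp only [h1, h2]
  have p2 : IsPeriodic fun y => mode (-k) y * (fderiv ℝ φ y u : ℂ) := fun z y => by
    have h1 := hpm z y
    have h2 := hpd z y
    simp only at h2
    simp only [h1, h2]
  have key := integral_lineDeriv_eq_zero (u := u)
    (f' := fun y => 2 * Real.pi * Complex.I * phase (-k) u * (mode (-k) y * (φ y : ℂ))
      + mode (-k) y * (fderiv ℝ φ y u : ℂ)) p1 c1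
    (fun z y => congrArg₂ (· + ·) (congrArg (_ * ·) (p1 z y)) (p2 z y))
    ((continuous_const.mul c1).add c2) (fun y t => by
      have h1 := hasDerivAt_mode_line (-k) y u t
      have h2 : HasDerivAt (fun t : ℝ => φ (y + t • u)) (fderiv ℝ φ (y + t • u) u) t := by
        have h3 : HasDerivAt (fun t : ℝ => y + t • u) u t := by
          simpa using ((hasDerivAt_id t).smul_const u).const_add y
        exact ((hφ.differentiable (by simp)) _).hasFDerivAt.comp_hasDerivAt t h3
      have h4 := h1.mul h2.ofReal_comp
      refine h4.congr_deriv ?_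
      ring)
  obtain ⟨C₁, hC₁⟩ := p1.exists_bound c1
  obtain ⟨C₂, hC₂⟩ := p2.exists_bound c2
  have i1 : Integrable (fun y => mode (-k) y * (φ y : ℂ)) (cellMeasure d n) :=
    Integrable.of_bound c1.aestronglyMeasurable C₁ (Eventually.of_forall hC₁)
  have i2 : Integrable (fun y => mode (-k) y * (fderiv ℝ φ y u : ℂ)) (cellMeasure d n) :=
    Integrable.of_bound c2.aestronglyMeasurable C₂ (Eventually.of_forall hC₂)
  rw [integral_add (i1.const_mul _) i2, integral_const_mul] at key
  have hneg : phase (-k) u = -phase k u := by simp [phase, Finset.sum_neg_distrib]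
  rw [hneg] at key
  push_cast at key
  linear_combination key

theorem continuous_hatGrad (δ : Fin n → ℝ) (hφ : ContDiff ℝ ∞ φ) (b : Fin d) :
    Continuous fun y => hatGrad δ φ y b :=
  continuous_finsetSum _ fun i _ => continuous_const.mul
    ((hφ.continuous_fderiv (by simp)).clm_apply continuous_const)

theorem isPeriodic_hatGrad (δ : Fin n → ℝ) (hper : IsPeriodic φ) (b : Fin d) :
    IsPeriodic fun y => hatGrad δ φ y b := fun z y =>
  Finset.sum_congr rfl fun i _ => congrArg (_ * ·) (isPeriodic_fderiv_apply hper (unitVec i b) z y)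

/-- The classical directional gradient of a smooth periodic function is its gradient in the sense
of Fourier series. -/
theorem isGrad_hatGrad (δ : Fin n → ℝ) (hφ : ContDiff ℝ ∞ φ) (hper : IsPeriodic φ)
    (h0 : MemLp φ 2 (cellMeasure d n))
    (h1 : ∀ b, MemLp (fun y => hatGrad δ φ y b) 2 (cellMeasure d n)) :
    IsGrad (cellBasis d n) (symb fun i => (δ i)⁻¹) (ofRealL2 h0)
      (WithLp.toLp 2 fun b => ofRealL2 (h1 b)) := fun k b => by
  change (cellBasis d n).repr (ofRealL2 (h1 b)) k = _
  rw [ofRealL2, cellBasis_repr_toLp, ofRealL2, cellBasis_repr_toLp]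
  have hi : ∀ i, Integrable (fun y => (starRingEnd ℂ) (mode k y)
      * (((δ i)⁻¹ * fderiv ℝ φ y (unitVec i b) : ℝ) : ℂ)) (cellMeasure d n) := fun i => by
    have hc : Continuous fun y => fderiv ℝ φ y (unitVec i b) :=
      (hφ.continuous_fderiv (by simp)).clm_apply continuous_const
    obtain ⟨C, hC⟩ := (isPeriodic_fderiv_apply hper (unitVec i b)).exists_bound hc
    refine Integrable.of_bound ((Complex.continuous_conj.comp (continuous_mode k)).mul
      (Complex.continuous_ofReal.comp (continuous_const.mul hc))).aestronglyMeasurable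
      (|(δ i)⁻¹| * C) (Eventually.of_forall fun y => ?_)
    rw [norm_mul, RCLike.norm_conj, norm_mode, one_mul, Complex.norm_real, norm_mul]
    exact mul_le_mul_of_nonneg_left (hC y) (abs_nonneg _)
  simp only [hatGrad, Complex.ofReal_sum, Finset.mul_sum]
  rw [integral_finsetSum _ fun i _ => hi i]
  have : ∀ i, ∫ y, (starRingEnd ℂ) (mode k y)
      * (((δ i)⁻¹ * fderiv ℝ φ y (unitVec i b) : ℝ) : ℂ) ∂cellMeasure d n
      = 2 * Real.pi * Complex.I * (((δ i)⁻¹ * k i b : ℝ) : ℂ)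
        * ∫ y, (starRingEnd ℂ) (mode k y) * (φ y : ℂ) ∂cellMeasure d n := fun i => by
    have h2 := integral_mode_mul_fderiv hφ hper k (unitVec i b)
    rw [phase_unitVec] at h2
    push_cast
    simp only [mul_left_comm _ (((δ i : ℝ) : ℂ)⁻¹)]
    rw [integral_const_mul, h2]
    push_cast
    ring
  simp only [this, ← Finset.sum_mul, ← Finset.mul_sum, ← Complex.ofReal_sum]
  rfl

theorem inner_ofRealL2 (h0 : MemLp φ 2 (cellMeasure d n)) (f : L2 d n) :
    (⟪ofRealL2 h0, f⟫_ℂ).re = ∫ y, (f y).re * φ y ∂cellMeasure d n := by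
  have hi := L2.integrable_inner (𝕜 := ℂ) (ofRealL2 h0) f
  rw [L2.inner_def]
  refine (integral_re hi).symm.trans (integral_congr_ae ?_)
  filter_upwards [coeFn_ofRealL2 h0] with y hy
  rw [hy]
  simp

theorem memLp_re (f : L2 d n) : MemLp (fun y => (f y).re) 2 (cellMeasure d n) := (Lp.memLp f).re

theorem IsGrad.inner_comp_eq {I E : Type*} [NormedAddCommGroup E] [InnerProductSpace ℂ E]
    {e : HilbertBasis I ℂ E} {κ : I → Fin d → ℝ} {x y : E} {g h : VField d E}
    (hx : IsGrad e κ x g) (hy : IsGrad e κ y h) (b : Fin d) : ⟪x, h b⟫_ℂ = -⟪g b, y⟫_ℂ := by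
  refine (hasSum_inner e x (h b)).unique ?_
  refine (hasSum_inner e (g b) y).neg.congr_fun fun k => ?_
  rw [hx k b, hy k b]
  simp only [map_mul, Complex.conj_ofReal, Complex.conj_I, map_ofNat]
  ring

variable {Mu : ℝ} {B : Var d n → Matrix (Fin d) (Fin d) ℝ}

theorem re_matOp_add_constField (hB : IsBoundedMatrix Mu B) (g : VField d (L2 d n))
    (v : Fin d → ℝ) : ∀ᵐ y ∂cellMeasure d n, ∀ b,
      (matOp B (g + constField n fun a => (v a : ℂ)) b y).re
        = (B y *ᵥ fun a => (g a y).re + v a) b := by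
  filter_upwards [eventually_countable_forall.2 fun b =>
      coeFn_matOp hB (g + constField n fun a => (v a : ℂ)) b,
    eventually_countable_forall.2 fun a => coeFn_constField (n := n) (fun a => (v a : ℂ)) a,
    eventually_countable_forall.2 fun a =>
      Lp.coeFn_add (g a) (constField n (fun a => (v a : ℂ)) a)] with y h1 h2 h3 b
  rw [h1, Complex.re_sum, Matrix.mulVec, dotProduct]
  refine Finset.sum_congr rfl fun a _ => ?_
  rw [Complex.re_ofReal_mul, PiLp.add_apply]
  congr 1
  refine (congrArg Complex.re (h3 a)).trans ?_
  rw [Pi.add_apply, h2, Complex.add_re, Complex.ofReal_re]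

/-- Matrix, data and test functions are real, so the real part of a complex solution solves the real
problem. Smooth periodic test functions are Fourier gradients by `isGrad_hatGrad`, and Parseval
gives both identities. -/
theorem IsCorrector.isWeakCorrector (hB : IsBoundedMatrix Mu B) {δ : Fin n → ℝ} {τ : ℝ}
    {v : Fin d → ℝ} {x : L2 d n} {g : VField d (L2 d n)}
    (h : IsCorrector (cellBasis d n) (symb fun i => (δ i)⁻¹) τ (matOp B)
      (constField n fun a => (v a : ℂ)) x g) :
    IsWeakCorrector δ τ B v (fun y => (x y).re) fun y b => (g b y).re := by
  refine ⟨memLp_re x, fun k => memLp_re (g k), fun φ hφ hper b => ?_, fun φ hφ hper => ?_⟩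
  · have h0 := memLp_of_periodic hφ.continuous hper
    have h1 := fun b => memLp_of_periodic (continuous_hatGrad δ hφ b) (isPeriodic_hatGrad δ hper b)
    have h2 := congrArg Complex.re ((isGrad_hatGrad δ hφ hper h0 h1).inner_comp_eq h.grad b)
    rw [inner_ofRealL2, Complex.neg_re] at h2
    refine h2.trans (congrArg Neg.neg ?_)
    exact inner_ofRealL2 (h1 b) x
  · have h0 := memLp_of_periodic hφ.continuous hper
    have h1 := fun b => memLp_of_periodic (continuous_hatGrad δ hφ b) (isPeriodic_hatGrad δ hper b)
    have h2 := congrArg Complex.re ((isGrad_hatGrad δ hφ hper h0 h1).inner_eq h.div)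
    rw [PiLp.inner_apply, Complex.re_sum, Complex.neg_re, inner_smul_right] at h2
    have h3 : ((τ : ℂ) ^ 2 * ⟪ofRealL2 h0, x⟫_ℂ).re
        = τ ^ 2 * ∫ y, (x y).re * φ y ∂cellMeasure d n := by
      rw [← inner_ofRealL2 h0 x, ← Complex.ofReal_pow, Complex.re_ofReal_mul]
    rw [h3] at h2
    have hv : ∀ k : Fin d, MemLp (fun _ : Var d n => v k) 2 (cellMeasure d n) :=
      fun k => memLp_const _
    have hbd : ∀ b, ∃ C, ∀ y, |hatGrad δ φ y b| ≤ C := fun b =>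
      (isPeriodic_hatGrad δ hper b).exists_bound (continuous_hatGrad δ hφ b)
    have i1 : ∀ b, Integrable (fun y => (B y *ᵥ fun a => (g a y).re) b * hatGrad δ φ y b)
        (cellMeasure d n) := fun b =>
      integrable_mul_bounded (memLp_flux hB (fun k => memLp_re (g k)) b)
        (continuous_hatGrad δ hφ b) (hbd b)
    have i2 : ∀ b, Integrable (fun y => (B y *ᵥ v) b * hatGrad δ φ y b) (cellMeasure d n) :=
      fun b => integrable_mul_bounded (memLp_flux hB hv b) (continuous_hatGrad δ hφ b) (hbd b)
    have h4 : ∀ b, (⟪ofRealL2 (h1 b), matOp B (g + constField n fun a => (v a : ℂ)) b⟫_ℂ).re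
        = ∫ y, (B y *ᵥ fun a => (g a y).re) b * hatGrad δ φ y b ∂cellMeasure d n
          + ∫ y, (B y *ᵥ v) b * hatGrad δ φ y b ∂cellMeasure d n := fun b => by
      rw [inner_ofRealL2, ← integral_add (i1 b) (i2 b)]
      refine integral_congr_ae ?_
      filter_upwards [re_matOp_add_constField hB g v] with y hy
      rw [hy b]
      have : (B y *ᵥ fun a => (g a y).re + v a) = B y *ᵥ (fun a => (g a y).re) + B y *ᵥ v :=
        Matrix.mulVec_add _ _ _
      rw [this, Pi.add_apply, add_mul]
    have h5 : ∑ b, (⟪ofRealL2 (h1 b), matOp B (g + constField n fun a => (v a : ℂ)) b⟫_ℂ).re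
        = -(τ ^ 2 * ∫ y, (x y).re * φ y ∂cellMeasure d n) := h2
    simp only [h4, Finset.sum_add_distrib] at h5
    rw [← integral_finsetSum _ fun b _ => i1 b, ← integral_finsetSum _ fun b _ => i2 b] at h5
    simp only [dotProduct]
    change ∫ y, ∑ b, _ ∂cellMeasure d n + τ ^ 2 * ∫ y, _ ∂cellMeasure d n
      = -∫ y, ∑ b, _ ∂cellMeasure d n
    linarith

end TransferBack

/-! ### Existence and uniqueness of effective matrices. -/

section Effective

variable {d n : ℕ} {Mu lam : ℝ} {B : Var d n → Matrix (Fin d) (Fin d) ℝ}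

/-- The `j`-th constant unit field. -/
def unitField (d n : ℕ) (j : Fin d) : VField d (L2 d n) :=
  constField n fun a => ((Pi.single j 1 : Fin d → ℝ) a : ℂ)

/-- The mean value of a function on the cell. -/
theorem repr_zero (f : L2 d n) : (cellBasis d n).repr f 0 = ∫ y, f y ∂cellMeasure d n := by
  rw [cellBasis_repr]
  simp [mode, phase]

theorem integrable_L2 (f : L2 d n) : Integrable (fun y => f y) (cellMeasure d n) :=
  (Lp.memLp f).integrable one_le_two

theorem integral_flux_re (hB : IsBoundedMatrix Mu B) (g : VField d (L2 d n)) (i j : Fin d) :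
    ((cellBasis d n).repr (matOp B (g + unitField d n j) i) 0).re
      = ∫ y in cell d n, (B y i j + (B y *ᵥ fun b => (g b y).re) i) := by
  rw [repr_zero]
  refine (integral_re (integrable_L2 _)).symm.trans (integral_congr_ae ?_)
  filter_upwards [re_matOp_add_constField hB g (Pi.single j 1)] with y hy
  refine (hy i).trans ?_
  have : (B y *ᵥ fun a => (g a y).re + (Pi.single j 1 : Fin d → ℝ) a)
      = B y *ᵥ (fun a => (g a y).re) + B y *ᵥ Pi.single j 1 := Matrix.mulVec_add _ _ _
  rw [this, Pi.add_apply, Matrix.mulVec_single_one, Matrix.col_apply, add_comm]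

/-- Gradients are unique, so any complex corrector may be used to compute the effective matrix. In
particular its mean flux is real. -/
theorem IsEffectiveMatrix.eq (hlam : 0 < lam) (hMu : 0 ≤ Mu) (hB : IsBoundedMatrix Mu B)
    (hell : ∀ y (ξ : Fin d → ℝ), lam * (ξ ⬝ᵥ ξ) ≤ ξ ⬝ᵥ (B y *ᵥ ξ)) {δ : Fin n → ℝ} {τ : ℝ}
    {M : Matrix (Fin d) (Fin d) ℝ} (hM : IsEffectiveMatrix δ τ B M) {x : L2 d n}
    {g : VField d (L2 d n)} {j : Fin d}
    (h : IsCorrector (cellBasis d n) (symb fun i => (δ i)⁻¹) τ (matOp B) (unitField d n j) x g)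
    (i : Fin d) : (M i j : ℂ) = (cellBasis d n).repr (matOp B (g + unitField d n j) i) 0 := by
  obtain ⟨X, G, hXG, hMi⟩ := hM j
  have hX : MemLp X 2 (cellMeasure d n) := hXG.memLp
  have hG : ∀ b, MemLp (fun y => G y b) 2 (cellMeasure d n) := hXG.memLp_grad
  have h1 := hXG.isCorrector hB hX hG
  have h2 := h.grad_unique hlam (isElliptic_matOp hMu hB hell) h1
  have hGy : ∀ᵐ y ∂cellMeasure d n, ∀ b, g b y = (G y b : ℂ) := by
    filter_upwards [eventually_countable_forall.2 fun b => coeFn_ofRealL2 (hG b)] with y hy b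
    rw [h2]
    exact hy b
  have hre : ((cellBasis d n).repr (matOp B (g + unitField d n j) i) 0).re = M i j := by
    rw [integral_flux_re hB, hMi]
    refine integral_congr_ae ?_
    have hGy' : ∀ᵐ y ∂volume.restrict (cell d n), ∀ b, g b y = (G y b : ℂ) := hGy
    filter_upwards [hGy'] with y hy
    simp only [hy, Complex.ofReal_re]
  have him : ((cellBasis d n).repr (matOp B (g + unitField d n j) i) 0).im = 0 := by
    rw [repr_zero]
    refine (integral_im (integrable_L2 _)).symm.trans ?_
    refine (integral_congr_ae (g := fun _ => (0 : ℝ)) ?_).trans (integral_zero _ _)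
    filter_upwards [hGy, coeFn_matOp hB (g + unitField d n j) i,
      eventually_countable_forall.2 fun a =>
        coeFn_constField (n := n) (fun a => ((Pi.single j 1 : Fin d → ℝ) a : ℂ)) a,
      eventually_countable_forall.2 fun a => Lp.coeFn_add (g a) (unitField d n j a)]
      with y h1 h2 h3 h4
    refine (congrArg Complex.im h2).trans ?_
    rw [Complex.im_sum]
    refine Finset.sum_eq_zero fun b _ => ?_
    rw [Complex.im_ofReal_mul, PiLp.add_apply]
    refine mul_eq_zero_of_right _ ((congrArg Complex.im (h4 b)).trans ?_)
    rw [Pi.add_apply, h1]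
    have h5 : unitField d n j b y = _ := h3 b
    rw [h5]
    simp
  exact Complex.ext (by rw [hre]; simp) (by rw [him]; simp)

theorem exists_isEffectiveMatrix (hlam : 0 < lam) (hMu : 0 ≤ Mu) (hB : IsBoundedMatrix Mu B)
    (hell : ∀ y (ξ : Fin d → ℝ), lam * (ξ ⬝ᵥ ξ) ≤ ξ ⬝ᵥ (B y *ᵥ ξ)) {δ : Fin n → ℝ} {τ : ℝ}
    (h : τ ≠ 0 ∨ ∀ k : Fin n → Fin d → ℤ, symb (fun i => (δ i)⁻¹) k = 0 ∨
      1 ≤ ∑ b, symb (fun i => (δ i)⁻¹) k b ^ 2) :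
    ∃ M, IsEffectiveMatrix δ τ B M := by
  choose x g hc _ using fun j =>
    exists_corrector (e := cellBasis d n) hlam (isElliptic_matOp hMu hB hell) h (unitField d n j)
  refine ⟨fun i j => ((cellBasis d n).repr (matOp B (g j + unitField d n j) i) 0).re, fun j =>
    ⟨_, _, (hc j).isWeakCorrector hB, fun i => integral_flux_re hB (g j) i j⟩⟩

theorem IsEffectiveMatrix.unique (hlam : 0 < lam) (hMu : 0 ≤ Mu) (hB : IsBoundedMatrix Mu B)
    (hell : ∀ y (ξ : Fin d → ℝ), lam * (ξ ⬝ᵥ ξ) ≤ ξ ⬝ᵥ (B y *ᵥ ξ)) {δ : Fin n → ℝ} {τ : ℝ}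
    {M M' : Matrix (Fin d) (Fin d) ℝ} (hM : IsEffectiveMatrix δ τ B M)
    (hM' : IsEffectiveMatrix δ τ B M') : M = M' := by
  ext i j
  obtain ⟨X, G, hXG, -⟩ := hM j
  have hX : MemLp X 2 (cellMeasure d n) := hXG.memLp
  have hG : ∀ b, MemLp (fun y => G y b) 2 (cellMeasure d n) := hXG.memLp_grad
  have h := hXG.isCorrector hB hX hG
  exact Complex.ofReal_injective ((hM.eq hlam hMu hB hell h i).trans
    (hM'.eq hlam hMu hB hell h i).symm)

/-- A nonzero integer vector has length at least 1. This gap makes the cell problems with τ = 0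
solvable. -/
theorem symb_one_eq_zero_or (k : Fin 1 → Fin d → ℤ) :
    symb (fun _ => (1 : ℝ)⁻¹) k = 0 ∨ 1 ≤ ∑ b, symb (fun _ => (1 : ℝ)⁻¹) k b ^ 2 := by
  by_cases h : symb (fun _ => (1 : ℝ)⁻¹) k = 0
  · exact Or.inl h
  · right
    obtain ⟨b, hb⟩ := Function.ne_iff.1 h
    have h1 : ∀ b, symb (fun _ => (1 : ℝ)⁻¹) k b = k 0 b := fun b => by simp [symb]
    rw [h1] at hb
    have h2 : (k 0 b) ≠ 0 := fun h0 => hb (by rw [h0]; simp)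
    have h3 : (1 : ℝ) ≤ symb (fun _ => (1 : ℝ)⁻¹) k b ^ 2 := by
      rw [h1]
      have : 1 ≤ (k 0 b) ^ 2 := Int.one_le_abs h2 |>.trans (by nlinarith [sq_abs (k 0 b), Int.one_le_abs h2])
      exact_mod_cast this
    exact h3.trans (Finset.single_le_sum (f := fun b => symb (fun _ => (1 : ℝ)⁻¹) k b ^ 2)
      (fun c _ => sq_nonneg _) (Finset.mem_univ b))

end Effective

/-! ### Linearity of correctors in their data. -/

section CorrectorSum

open scoped InnerProductSpace

variable {E I : Type*} [NormedAddCommGroup E] [InnerProductSpace ℂ E]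
  {e : HilbertBasis I ℂ E} {d : ℕ} {κ : I → Fin d → ℝ}

theorem IsGrad.zero : IsGrad e κ (0 : E) (0 : VField d E) := fun k b => by simp

theorem IsDiv.zero : IsDiv e κ (0 : VField d E) (0 : E) := fun k => by simp

theorem IsGrad.sum {ι : Type*} (s : Finset ι) {x : ι → E} {g : ι → VField d E}
    (h : ∀ j, IsGrad e κ (x j) (g j)) : IsGrad e κ (∑ j ∈ s, x j) (∑ j ∈ s, g j) := by
  classical
  induction s using Finset.induction_on with
  | empty => simpa using IsGrad.zero
  | insert j s hj ih => rw [Finset.sum_insert hj, Finset.sum_insert hj]; exact (h j).add ih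

theorem IsDiv.sum {ι : Type*} (s : Finset ι) {f : ι → VField d E} {t : ι → E}
    (h : ∀ j, IsDiv e κ (f j) (t j)) : IsDiv e κ (∑ j ∈ s, f j) (∑ j ∈ s, t j) := by
  classical
  induction s using Finset.induction_on with
  | empty => simpa using IsDiv.zero
  | insert j s hj ih => rw [Finset.sum_insert hj, Finset.sum_insert hj]; exact (h j).add ih

theorem IsCorrector.sum_smul {ι : Type*} [Fintype ι] {τ : ℝ} {𝔸 : VField d E →L[ℂ] VField d E}
    {v g : ι → VField d E} {x : ι → E} (c : ι → ℂ)
    (h : ∀ j, IsCorrector e κ τ 𝔸 (v j) (x j) (g j)) :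
    IsCorrector e κ τ 𝔸 (∑ j, c j • v j) (∑ j, c j • x j) (∑ j, c j • g j) := by
  refine ⟨IsGrad.sum _ fun j => (h j).grad.smul (c j), ?_⟩
  have := IsDiv.sum Finset.univ fun j => (h j).div.smul (c j)
  convert this using 1
  · rw [← Finset.sum_add_distrib, map_sum]
    refine Finset.sum_congr rfl fun j _ => ?_
    rw [← smul_add, map_smul]
  · rw [Finset.smul_sum]
    exact Finset.sum_congr rfl fun j _ => smul_comm _ _ _

theorem field_sum_apply {F : Type*} [NormedAddCommGroup F] {ι : Type*} (s : Finset ι)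
    (f : ι → VField d F) (a : Fin d) :
    (∑ j ∈ s, f j) a = ∑ j ∈ s, f j a := by
  classical
  induction s using Finset.induction_on with
  | empty => simp
  | insert j s hj ih => rw [Finset.sum_insert hj, Finset.sum_insert hj, PiLp.add_apply, ih]

theorem norm_repr_le (f : E) (k : I) : ‖e.repr f k‖ ≤ ‖f‖ := by
  rw [HilbertBasis.repr_apply_apply]
  refine (norm_inner_le_norm _ _).trans ?_
  rw [e.orthonormal.1 k, one_mul]

end CorrectorSum

/-! ### Constant fields and the zero frequency. -/

section ConstField

open scoped InnerProductSpace

variable {d n : ℕ}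

theorem constField_apply_eq_smul (v : Fin d → ℂ) (a : Fin d) :
    constField n v a = v a • cellBasis d n 0 := by
  rw [cellBasis_apply, modeL2]
  refine Lp.ext ?_
  filter_upwards [coeFn_constField (n := n) v a, Lp.coeFn_smul (v a) ((memLp_mode 0).toLp _),
    (memLp_mode (0 : Fin n → Fin d → ℤ)).coeFn_toLp] with y h1 h2 h3
  rw [h1, h2, Pi.smul_apply, h3]
  simp [mode, phase]

theorem repr_constField (v : Fin d → ℂ) (a : Fin d) (k : Fin n → Fin d → ℤ) :
    (cellBasis d n).repr (constField n v a) k = if k = 0 then v a else 0 := by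
  classical
  rw [constField_apply_eq_smul, map_smul, HilbertBasis.repr_self, lp.coeFn_smul, Pi.smul_apply,
    lp.single_apply]
  by_cases h : k = 0
  · subst h; simp
  · simp [h]

theorem norm_sq_constField (v : Fin d → ℂ) : ‖constField n v‖ ^ 2 = ∑ a, ‖v a‖ ^ 2 := by
  rw [PiLp.norm_sq_eq_of_L2]
  refine Finset.sum_congr rfl fun a _ => ?_
  rw [constField_apply_eq_smul, norm_smul, (cellBasis d n).orthonormal.1, mul_one]

theorem norm_unitField (j : Fin d) : ‖unitField d n j‖ = 1 := by
  have h : ‖unitField d n j‖ ^ 2 = 1 := by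
    rw [unitField, norm_sq_constField, Finset.sum_eq_single j]
    · simp
    · intro b _ hb; simp [hb]
    · simp
  exact (pow_eq_one_iff_of_nonneg (norm_nonneg _) two_ne_zero).1 h

theorem constField_eq_sum (v : Fin d → ℂ) : constField n v = ∑ j, v j • unitField d n j := by
  refine PiLp.ext fun a => ?_
  refine repr_ext (cellBasis d n) fun k => ?_
  have h : (∑ j, v j • unitField d n j) a = ∑ j, v j • unitField d n j a := by simp
  rw [h, map_sum, lp.coeFn_sum, Finset.sum_apply, Finset.sum_eq_single a]
  · rw [map_smul, lp.coeFn_smul, Pi.smul_apply, unitField, repr_constField, repr_constField]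
    simp
  · intro b _ hb
    rw [map_smul, lp.coeFn_smul, Pi.smul_apply, unitField, repr_constField]
    simp [hb.symm]
  · simp

theorem symb_zero (w : Fin n → ℝ) : symb w (0 : Fin n → Fin d → ℤ) = 0 := by
  ext b; simp [symb]

theorem isDiv_constField (w : Fin n → ℝ) (v : Fin d → ℂ) :
    IsDiv (cellBasis d n) (symb w) (constField n v) 0 := fun k => by
  simp only [repr_constField]
  by_cases h : k = 0
  · subst h; simp [symb_zero]
  · simp [h]

end ConstField

/-! ### Homogenizing one variable preserves the class of Lipschitz coefficients. -/

section LipCoeff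

open scoped InnerProductSpace

/-- Elliptic, bounded, periodic and Lipschitz matrix functions. -/
structure IsLipCoeff {d n : ℕ} (lam Mu L : ℝ) (A : Var d n → Matrix (Fin d) (Fin d) ℝ) : Prop where
  elliptic : ∀ y (ξ : Fin d → ℝ), lam * (ξ ⬝ᵥ ξ) ≤ ξ ⬝ᵥ (A y *ᵥ ξ)
  bound : ∀ y a b, |A y a b| ≤ Mu
  periodic : IsPeriodic A
  lipschitz : ∀ y y' a b, |A y a b - A y' a b| ≤ L * ‖y - y'‖

variable {d n : ℕ} {lam Mu L : ℝ}

theorem measurable_of_lipschitz {f : Var d n → ℝ} (h : ∀ y y', |f y - f y'| ≤ L * ‖y - y'‖) :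
    Measurable f := by
  have : LipschitzWith L.toNNReal f := LipschitzWith.of_dist_le_mul fun y y' => by
    rw [Real.dist_eq, dist_eq_norm]
    refine (h y y').trans ?_
    gcongr
    exact Real.le_coe_toNNReal L
  exact this.continuous.measurable

theorem IsLipCoeff.isBoundedMatrix {A : Var d n → Matrix (Fin d) (Fin d) ℝ}
    (hA : IsLipCoeff lam Mu L A) : IsBoundedMatrix Mu A :=
  ⟨fun a b => measurable_of_lipschitz fun y y' => hA.lipschitz y y' a b, hA.bound⟩

theorem norm_snoc_sub_le (x x' : Var d n) (z z' : Fin d → ℝ) {r : ℝ} (hx : ‖x - x'‖ ≤ r)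
    (hz : ‖z - z'‖ ≤ r) :
    ‖(Fin.snoc (α := fun _ => Fin d → ℝ) x z - Fin.snoc (α := fun _ => Fin d → ℝ) x' z' :
      Var d (n + 1))‖ ≤ r := by
  refine (pi_norm_le_iff_of_nonneg ((norm_nonneg _).trans hx)).2 fun i => ?_
  refine Fin.lastCases ?_ (fun i => ?_) i
  · simpa using hz
  · simpa using (norm_le_pi_norm (x - x') i).trans hx

/-- The restriction of a coefficient matrix to the last variable. -/
def fiber (A : Var d (n + 1) → Matrix (Fin d) (Fin d) ℝ) (x : Var d n) :
    Var d 1 → Matrix (Fin d) (Fin d) ℝ :=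
  fun z => A (Fin.snoc (α := fun _ => Fin d → ℝ) x (z 0))

variable {A : Var d (n + 1) → Matrix (Fin d) (Fin d) ℝ}

theorem IsLipCoeff.fiber (hL : 0 ≤ L) (hA : IsLipCoeff lam Mu L A) (x : Var d n) :
    IsLipCoeff lam Mu L (fiber A x) := by
  refine ⟨fun _ => hA.elliptic _, fun _ => hA.bound _, fun k z => ?_, fun z z' a b => ?_⟩
  · have h := hA.periodic (Fin.snoc (α := fun _ => Fin d → ℤ) 0 (k 0))
      (Fin.snoc (α := fun _ => Fin d → ℝ) x (z 0))
    rw [Multiscale.fiber, Multiscale.fiber, ← h]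
    congr 1
    ext i b
    refine Fin.lastCases ?_ (fun i => ?_) i <;> simp
  · refine (hA.lipschitz _ _ a b).trans ?_
    gcongr
    exact norm_snoc_sub_le x x _ _ (by simp) (norm_le_pi_norm (z - z') 0)

theorem fiber_add_int (hA : IsPeriodic A) (k : Fin n → Fin d → ℤ) (x : Var d n) :
    fiber A (fun i b => x i b + (k i b : ℝ)) = fiber A x := by
  ext1 z
  have h := hA (Fin.snoc (α := fun _ => Fin d → ℤ) k 0)
      (Fin.snoc (α := fun _ => Fin d → ℝ) x (z 0))
  rw [fiber, fiber, ← h]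
  congr 1
  ext i b
  refine Fin.lastCases ?_ (fun i => ?_) i <;> simp

theorem abs_fiber_sub_le (hL : 0 ≤ L) (hA : IsLipCoeff lam Mu L A) (x x' : Var d n) (z : Var d 1)
    (a b : Fin d) : |fiber A x z a b - fiber A x' z a b| ≤ L * ‖x - x'‖ := by
  refine (hA.lipschitz _ _ a b).trans ?_
  gcongr
  exact norm_snoc_sub_le x x' _ _ le_rfl (by simp)

/-- `A'` is obtained from `A` by homogenizing the last variable. -/
def IsHomogenization (A : Var d (n + 1) → Matrix (Fin d) (Fin d) ℝ)
    (A' : Var d n → Matrix (Fin d) (Fin d) ℝ) : Prop :=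
  ∀ x, IsEffectiveMatrix (n := 1) (fun _ => 1) 0 (fiber A x) (A' x)

theorem exists_isHomogenization (hlam : 0 < lam) (hMu : 0 ≤ Mu) (hL : 0 ≤ L)
    (hA : IsLipCoeff lam Mu L A) : ∃ A', IsHomogenization A A' := by
  choose A' hA' using fun x => exists_isEffectiveMatrix (δ := fun _ => 1) (τ := 0) hlam hMu
    (hA.fiber hL x).isBoundedMatrix (hA.fiber hL x).elliptic (Or.inr symb_one_eq_zero_or)
  exact ⟨A', hA'⟩

theorem exists_fiber_corrector (hlam : 0 < lam) (hMu : 0 ≤ Mu) (hL : 0 ≤ L)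
    (hA : IsLipCoeff lam Mu L A) (x : Var d n) (j : Fin d) :
    ∃ X g, IsCorrector (cellBasis d 1) (symb fun _ => (1 : ℝ)⁻¹) 0 (matOp (fiber A x))
      (unitField d 1 j) X g := by
  obtain ⟨X, g, h, -⟩ := exists_corrector (e := cellBasis d 1) hlam
    (isElliptic_matOp hMu (hA.fiber hL x).isBoundedMatrix (hA.fiber hL x).elliptic)
    (Or.inr symb_one_eq_zero_or) (unitField d 1 j)
  exact ⟨X, g, h⟩

/-- The amplification of the constants by one homogenization. -/
def amp (d : ℕ) (lam Mu : ℝ) : ℝ := lam⁻¹ * (d ^ 2 * Mu) + 1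

variable {A' : Var d n → Matrix (Fin d) (Fin d) ℝ}

/-- Ellipticity passes to `A'` with the same constant, because ξ·A'ξ is the energy of the field ξ +
G with G a gradient, orthogonal to constants. The two other constants depend only on d, λ and the
old ones, which is what an induction on the number of scales needs. -/
theorem IsHomogenization.isLipCoeff (hlam : 0 < lam) (hMu : 0 ≤ Mu) (hL : 0 ≤ L)
    (hA : IsLipCoeff lam Mu L A) (hA' : IsHomogenization A A') :
    IsLipCoeff lam (d ^ 2 * Mu * amp d lam Mu) (d ^ 2 * L * amp d lam Mu ^ 2) A' := by
  have hB := fun x => (hA.fiber hL x).isBoundedMatrix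
  have hell := fun x => isElliptic_matOp hMu (hB x) (hA.fiber hL x).elliptic
  have hamp : 0 ≤ amp d lam Mu := by unfold amp; positivity
  choose X g hg using fun x j => exists_fiber_corrector hlam hMu hL hA x j
  have heq : ∀ x i j, (A' x i j : ℂ)
      = (cellBasis d 1).repr (matOp (Multiscale.fiber A x) (g x j + unitField d 1 j) i) 0 :=
    fun x i j => (hA' x).eq hlam hMu (hB x) (hA.fiber hL x).elliptic (hg x j) i
  have hgn : ∀ x j, ‖g x j + unitField d 1 j‖ ≤ amp d lam Mu := fun x j => by
    have h1 := (hg x j).norm_grad_le hlam (hell x)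
    rw [norm_unitField, mul_one] at h1
    refine (norm_add_le _ _).trans ?_
    rw [norm_unitField]
    unfold amp
    linarith
  refine ⟨fun x ξ => ?_, fun x i j => ?_, fun k x => ?_, fun x x' i j => ?_⟩
  · set 𝔸 := matOp (Multiscale.fiber A x)
    have hc := IsCorrector.sum_smul (fun j => (ξ j : ℂ)) (hg x)
    rw [← constField_eq_sum (n := 1) fun j => (ξ j : ℂ)] at hc
    set Ξ := constField 1 fun j => (ξ j : ℂ) with hΞ
    set G := ∑ j, (ξ j : ℂ) • g x j
    -- The flux and the constant fields are both divergence free, hence orthogonal to the gradient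
    -- `G`.
    have h1 : ⟪G, 𝔸 (G + Ξ)⟫_ℂ = 0 := by
      rw [hc.grad.inner_eq hc.div]
      simp
    have h2 : ⟪G, Ξ⟫_ℂ = 0 := by
      rw [hc.grad.inner_eq (isDiv_constField _ _)]
      simp
    have h3 : ⟪Ξ, 𝔸 (G + Ξ)⟫_ℂ = ((ξ ⬝ᵥ (A' x *ᵥ ξ) : ℝ) : ℂ) := by
      have h4 : G + Ξ = ∑ j, (ξ j : ℂ) • (g x j + unitField d 1 j) := by
        rw [hΞ, constField_eq_sum, ← Finset.sum_add_distrib]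
        simp only [smul_add]
      rw [PiLp.inner_apply, dotProduct, Complex.ofReal_sum]
      refine Finset.sum_congr rfl fun i _ => ?_
      have h5 : Ξ i = (ξ i : ℂ) • cellBasis d 1 0 := constField_apply_eq_smul _ i
      have h6 : 𝔸 (G + Ξ) i = ∑ j, (ξ j : ℂ) • 𝔸 (g x j + unitField d 1 j) i := by
        rw [h4, map_sum, field_sum_apply]
        refine Finset.sum_congr rfl fun j _ => ?_
        rw [map_smul, PiLp.smul_apply]
      rw [h5, inner_smul_left, ← HilbertBasis.repr_apply_apply, Complex.conj_ofReal, h6, map_sum,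
        lp.coeFn_sum, Finset.sum_apply, Matrix.mulVec, dotProduct, Complex.ofReal_mul,
        Complex.ofReal_sum]
      congr 1
      refine Finset.sum_congr rfl fun j _ => ?_
      rw [map_smul, lp.coeFn_smul, Pi.smul_apply, Complex.ofReal_mul, heq, smul_eq_mul, mul_comm]
    have h7 : ⟪G + Ξ, 𝔸 (G + Ξ)⟫_ℂ = ((ξ ⬝ᵥ (A' x *ᵥ ξ) : ℝ) : ℂ) := by
      rw [inner_add_left, h1, zero_add, h3]
    have h8 := (hell x).coercive (G + Ξ)
    rw [h7, Complex.ofReal_re] at h8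
    refine le_trans ?_ h8
    gcongr
    have h9 : ‖G + Ξ‖ ^ 2 = ‖G‖ ^ 2 + ‖Ξ‖ ^ 2 := by
      have := @norm_add_sq ℂ _ _ _ _ G Ξ
      rw [h2] at this
      simpa using this
    have h10 : ‖Ξ‖ ^ 2 = ξ ⬝ᵥ ξ := by
      rw [hΞ, norm_sq_constField, dotProduct]
      exact Finset.sum_congr rfl fun a _ => by simp [sq]
    rw [h9, h10]
    nlinarith [sq_nonneg ‖G‖]
  · have h1 : |A' x i j| = ‖(A' x i j : ℂ)‖ := by rw [Complex.norm_real, Real.norm_eq_abs]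
    rw [h1, heq]
    refine (norm_repr_le _ _).trans ((norm_apply_le _ i).trans (((hell x).bounded _).trans ?_))
    gcongr
    exact hgn x j
  · have h := hA' fun i b => x i b + (k i b : ℝ)
    rw [fiber_add_int hA.periodic k x] at h
    exact h.unique hlam hMu (hB x) (hA.fiber hL x).elliptic (hA' x)
  · have h1 : |A' x i j - A' x' i j| = ‖(A' x i j : ℂ) - (A' x' i j : ℂ)‖ := by
      rw [← Complex.ofReal_sub, Complex.norm_real, Real.norm_eq_abs]
    have h2 : ‖(matOp (Multiscale.fiber A x) - matOp (Multiscale.fiber A x'))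
        (g x' j + unitField d 1 j)‖ ≤ d ^ 2 * (L * ‖x - x'‖) * amp d lam Mu := by
      rw [sub_apply]
      refine (norm_matOp_sub_le (ε := L * ‖x - x'‖) (by positivity) (hB x) (hB x')
        (fun z a b => abs_fiber_sub_le hL hA x x' z a b) _).trans ?_
      gcongr
      exact hgn x' j
    have h3 := (hg x j).norm_sub_le hlam (hell x) (hg x' j)
    have h4 : ‖matOp (Multiscale.fiber A x) (g x j + unitField d 1 j)
        - matOp (Multiscale.fiber A x') (g x' j + unitField d 1 j)‖
        ≤ amp d lam Mu * (d ^ 2 * (L * ‖x - x'‖) * amp d lam Mu) := by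
      -- The flux changes through the field and through the coefficient. The two contributions add
      -- up to one factor `amp`; the other comes from the norm of the total field.
      have h5 : matOp (Multiscale.fiber A x) (g x j + unitField d 1 j)
          - matOp (Multiscale.fiber A x') (g x' j + unitField d 1 j)
          = matOp (Multiscale.fiber A x) (g x j - g x' j)
            + (matOp (Multiscale.fiber A x) - matOp (Multiscale.fiber A x'))
              (g x' j + unitField d 1 j) := by
        simp only [sub_apply, map_add, map_sub]
        abel
      rw [h5]
      refine (norm_add_le _ _).trans ?_
      have h6 := (hell x).bounded (g x j - g x' j)
      calc _ ≤ d ^ 2 * Mu * (lam⁻¹ * (d ^ 2 * (L * ‖x - x'‖) * amp d lam Mu))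
            + d ^ 2 * (L * ‖x - x'‖) * amp d lam Mu := by
            refine add_le_add (h6.trans ?_) h2
            gcongr
            exact h3.trans (by gcongr)
        _ = amp d lam Mu * (d ^ 2 * (L * ‖x - x'‖) * amp d lam Mu) := by
            have h7 : amp d lam Mu = lam⁻¹ * (d ^ 2 * Mu) + 1 := rfl
            linear_combination (-(d ^ 2 * (L * ‖x - x'‖) * amp d lam Mu)) * h7
    rw [h1, heq, heq, ← Pi.sub_apply, ← lp.coeFn_sub, ← map_sub, ← PiLp.sub_apply]
    refine (norm_repr_le _ _).trans ((norm_apply_le _ i).trans (h4.trans_eq ?_))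
    ring

end LipCoeff

/-! ### Fubini in the last variable. -/

section Slice

open scoped InnerProductSpace

variable {d n : ℕ}

/-- The point with first variables `p.1` and last variable `p.2`. -/
def join (p : Var d n × Var d 1) : Var d (n + 1) :=
  Fin.snoc (α := fun _ => Fin d → ℝ) p.1 (p.2 0)

/-- The first variables. -/
def initVar (y : Var d (n + 1)) : Var d n := fun i => y i.castSucc

theorem initVar_join (p : Var d n × Var d 1) : initVar (join p) = p.1 := by
  ext1 i
  simp [initVar, join]

theorem measurable_join : Measurable (join (d := d) (n := n)) := by
  refine measurable_pi_lambda _ fun i => ?_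
  refine Fin.lastCases ?_ (fun i => ?_) i
  · simp only [join, Fin.snoc_last]
    exact (measurable_pi_apply 0).comp measurable_snd
  · simp only [join, Fin.snoc_castSucc]
    exact (measurable_pi_apply i).comp measurable_fst

theorem measurePreserving_join :
    MeasurePreserving (join (d := d) (n := n)) ((cellMeasure d n).prod (cellMeasure d 1))
      (cellMeasure d (n + 1)) := by
  refine ⟨measurable_join, ?_⟩
  rw [cellMeasure_eq_pi d (n + 1)]
  refine (Measure.pi_eq fun s hs => ?_).symm
  rw [Measure.map_apply measurable_join (MeasurableSet.univ_pi hs)]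
  have : join ⁻¹' Set.univ.pi s
      = (Set.univ.pi fun i => s (Fin.castSucc i)) ×ˢ (Set.univ.pi fun _ : Fin 1 => s (Fin.last n)) := by
    ext p
    simp only [Set.mem_preimage, Set.mem_univ_pi, Set.mem_prod]
    constructor
    · intro h
      refine ⟨fun i => ?_, fun i => ?_⟩
      · simpa [join] using h i.castSucc
      · simpa [join, Subsingleton.elim i 0] using h (Fin.last n)
    · intro h i
      refine Fin.lastCases ?_ (fun i => ?_) i
      · simpa [join] using h.2 0
      · simpa [join] using h.1 i
  rw [this, Measure.prod_prod, cellMeasure_eq_pi, cellMeasure_eq_pi, Measure.pi_pi, Measure.pi_pi,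
    Fin.prod_univ_castSucc (n := n), Fin.prod_univ_one]

theorem measurePreserving_initVar :
    MeasurePreserving (initVar (d := d) (n := n)) (cellMeasure d (n + 1)) (cellMeasure d n) := by
  have hm : Measurable (initVar (d := d) (n := n)) :=
    measurable_pi_lambda _ fun i => measurable_pi_apply _
  refine ⟨hm, ?_⟩
  rw [← measurePreserving_join.map_eq, Measure.map_map hm measurable_join]
  have : initVar ∘ join = (Prod.fst : Var d n × Var d 1 → Var d n) := funext initVar_join
  rw [this]
  exact measurePreserving_fst.map_eq

theorem ae_ae_join {p : Var d (n + 1) → Prop} (h : ∀ᵐ y ∂cellMeasure d (n + 1), p y) :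
    ∀ᵐ x ∂cellMeasure d n, ∀ᵐ z ∂cellMeasure d 1, p (join (x, z)) :=
  Measure.ae_ae_of_ae_prod (measurePreserving_join.quasiMeasurePreserving.ae h)

/-- Functions of the first variables as functions of all variables. -/
def lift : L2 d n →ₗᵢ[ℂ] L2 d (n + 1) :=
  Lp.compMeasurePreservingₗᵢ ℂ initVar measurePreserving_initVar

theorem coeFn_lift (f : L2 d n) :
    lift f =ᵐ[cellMeasure d (n + 1)] fun y => f (initVar y) :=
  Lp.coeFn_compMeasurePreserving f measurePreserving_initVar

theorem memLp_comp_join (F : L2 d (n + 1)) :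
    MemLp (fun p => F (join p)) 2 ((cellMeasure d n).prod (cellMeasure d 1)) :=
  (Lp.memLp F).comp_measurePreserving measurePreserving_join

theorem ae_memLp_slice (F : L2 d (n + 1)) :
    ∀ᵐ x ∂cellMeasure d n, MemLp (fun z => F (join (x, z))) 2 (cellMeasure d 1) := by
  have h := memLp_comp_join F
  have h2 := ((memLp_two_iff_integrable_sq_norm h.1).1 h).prod_right_ae
  filter_upwards [h2, h.1.prodMk_left] with x h3 h4
  exact (memLp_two_iff_integrable_sq_norm h4).2 h3

open Classical in
/-- The restriction of a function to the last variable. -/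
def slice (F : L2 d (n + 1)) (x : Var d n) : L2 d 1 :=
  if h : MemLp (fun z => F (join (x, z))) 2 (cellMeasure d 1) then h.toLp _ else 0

theorem coeFn_slice (F : L2 d (n + 1)) :
    ∀ᵐ x ∂cellMeasure d n, slice F x =ᵐ[cellMeasure d 1] fun z => F (join (x, z)) := by
  filter_upwards [ae_memLp_slice F] with x hx
  rw [slice, dif_pos hx]
  exact hx.coeFn_toLp

theorem slice_repr (F : L2 d (n + 1)) (m : Fin 1 → Fin d → ℤ) : ∀ᵐ x ∂cellMeasure d n,
    (cellBasis d 1).repr (slice F x) m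
      = ∫ z, (starRingEnd ℂ) (mode m z) * F (join (x, z)) ∂cellMeasure d 1 := by
  filter_upwards [coeFn_slice F] with x hx
  rw [cellBasis_repr]
  refine integral_congr_ae ?_
  filter_upwards [hx] with z hz
  rw [hz]

theorem memLp_slice_repr (F : L2 d (n + 1)) (m : Fin 1 → Fin d → ℤ) :
    MemLp (fun x => (cellBasis d 1).repr (slice F x) m) 2 (cellMeasure d n) := by
  have h := memLp_comp_join F
  have hi := ((memLp_two_iff_integrable_sq_norm h.1).1 h).integral_prod_left
  have hs : AEStronglyMeasurable (fun x => ∫ z, (starRingEnd ℂ) (mode m z) * F (join (x, z))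
      ∂cellMeasure d 1) (cellMeasure d n) := by
    refine AEStronglyMeasurable.integral_prod_right' (f := fun p : Var d n × Var d 1 =>
      (starRingEnd ℂ) (mode m p.2) * F (join p)) ?_
    exact ((Complex.continuous_conj.comp ((continuous_mode m).comp
      continuous_snd)).aestronglyMeasurable).mul h.1
  have hs' : AEStronglyMeasurable (fun x => (cellBasis d 1).repr (slice F x) m) (cellMeasure d n) :=
    hs.congr ((slice_repr F m).mono fun x hx => hx.symm)
  refine (memLp_two_iff_integrable_sq_norm hs').2 (hi.mono' (hs'.norm.pow 2) ?_)
  filter_upwards [coeFn_slice F] with x hx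
  rw [Real.norm_of_nonneg (by positivity)]
  have h1 := norm_repr_le (e := cellBasis d 1) (slice F x) m
  have h2 : ‖slice F x‖ ^ 2 = ∫ z, ‖F (join (x, z))‖ ^ 2 ∂cellMeasure d 1 := by
    have h3 : ((‖slice F x‖ ^ 2 : ℝ) : ℂ) = ⟪slice F x, slice F x⟫_ℂ := by
      rw [inner_self_eq_norm_sq_to_K]; norm_cast
    have h4 : ⟪slice F x, slice F x⟫_ℂ = ((∫ z, ‖F (join (x, z))‖ ^ 2 ∂cellMeasure d 1 : ℝ) : ℂ) := by
      rw [inner_eq_integral, ← integral_complex_ofReal]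
      refine integral_congr_ae ?_
      filter_upwards [hx] with z hz
      rw [hz, mul_comm, Complex.mul_conj, Complex.normSq_eq_norm_sq]
    exact_mod_cast h3.trans h4
  rw [← h2]
  gcongr

/-- Fourier coefficients with respect to the last variable. -/
def sliceCoef (F : L2 d (n + 1)) (m : Fin 1 → Fin d → ℤ) : L2 d n := (memLp_slice_repr F m).toLp _

theorem coeFn_sliceCoef (F : L2 d (n + 1)) (m : Fin 1 → Fin d → ℤ) :
    sliceCoef F m =ᵐ[cellMeasure d n] fun x => (cellBasis d 1).repr (slice F x) m :=
  (memLp_slice_repr F m).coeFn_toLp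

/-- The frequency with first components `k` and last component `m`. -/
def joinFreq (k : Fin n → Fin d → ℤ) (m : Fin 1 → Fin d → ℤ) : Fin (n + 1) → Fin d → ℤ :=
  Fin.snoc (α := fun _ => Fin d → ℤ) k (m 0)

theorem exists_eq_joinFreq (k : Fin (n + 1) → Fin d → ℤ) :
    k = joinFreq (fun i => k i.castSucc) (fun _ => k (Fin.last n)) := by
  ext i b
  refine Fin.lastCases ?_ (fun i => ?_) i <;> simp [joinFreq]

theorem mode_join (k : Fin n → Fin d → ℤ) (m : Fin 1 → Fin d → ℤ) (p : Var d n × Var d 1) :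
    mode (joinFreq k m) (join p) = mode k p.1 * mode m p.2 := by
  rw [mode, mode, mode, ← Complex.exp_add]
  congr 1
  have : phase (joinFreq k m) (join p) = phase k p.1 + phase m p.2 := by
    simp [phase, Fin.sum_univ_castSucc, joinFreq, join]
  rw [this]
  push_cast
  ring

/-- By Fubini, joint Fourier coefficients are iterated ones. Identities between joint coefficients
thus become identities between slices for almost every value of the first variables. -/
theorem repr_sliceCoef (F : L2 d (n + 1)) (k : Fin n → Fin d → ℤ) (m : Fin 1 → Fin d → ℤ) :
    (cellBasis d n).repr (sliceCoef F m) k = (cellBasis d (n + 1)).repr F (joinFreq k m) := by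
  have hm : AEStronglyMeasurable (fun y => (starRingEnd ℂ) (mode (joinFreq k m) y) * F y)
      (cellMeasure d (n + 1)) :=
    (Complex.continuous_conj.comp (continuous_mode _)).aestronglyMeasurable.mul
      (Lp.aestronglyMeasurable F)
  have hi : Integrable (fun y => (starRingEnd ℂ) (mode (joinFreq k m) y) * F y)
      (cellMeasure d (n + 1)) := by
    refine (integrable_L2 F).norm.mono' hm (Eventually.of_forall fun y => ?_)
    rw [norm_mul, RCLike.norm_conj, norm_mode, one_mul]
  rw [cellBasis_repr (d := d) (n := n + 1), ← integral_comp_measurePreserving measurePreserving_join hm,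
    integral_prod (fun p => (starRingEnd ℂ) (mode (joinFreq k m) (join p)) * F (join p))
      (measurePreserving_join.integrable_comp_of_integrable hi), cellBasis_repr]
  refine integral_congr_ae ?_
  filter_upwards [coeFn_sliceCoef F m, slice_repr F m] with x h1 h2
  rw [h1, h2, ← integral_const_mul]
  refine integral_congr_ae (Eventually.of_forall fun z => ?_)
  simp only [mode_join, map_mul]
  ring

theorem symb_last_joinFreq (k : Fin n → Fin d → ℤ) (m : Fin 1 → Fin d → ℤ) :
    symb (Pi.single (Fin.last n) 1) (joinFreq k m) = symb (fun _ => (1 : ℝ)⁻¹) m := by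
  ext b
  simp [symb, joinFreq, Pi.single_apply]

/-- The restriction of a field to the last variable. -/
def sliceField (g : VField d (L2 d (n + 1))) (x : Var d n) : VField d (L2 d 1) :=
  WithLp.toLp 2 fun b => slice (g b) x

/-- The symbol depends on the last frequency `m` only. For each `m` the relation is an equality in
L² of the first variables, hence holds almost everywhere; there are countably many `m`. -/
theorem IsGrad.slice {V : L2 d (n + 1)} {H : VField d (L2 d (n + 1))}
    (h : IsGrad (cellBasis d (n + 1)) (symb (Pi.single (Fin.last n) 1)) V H) :
    ∀ᵐ x ∂cellMeasure d n, IsGrad (cellBasis d 1) (symb fun _ => (1 : ℝ)⁻¹) (slice V x)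
      (sliceField H x) := by
  refine eventually_countable_forall.2 fun m => eventually_countable_forall.2 fun b => ?_
  set c : ℂ := 2 * Real.pi * Complex.I * symb (fun _ => (1 : ℝ)⁻¹) m b with hc
  have h1 : sliceCoef (H b) m = c • sliceCoef V m := by
    refine repr_ext (cellBasis d n) fun k => ?_
    rw [map_smul, lp.coeFn_smul, Pi.smul_apply, repr_sliceCoef, repr_sliceCoef, h,
      symb_last_joinFreq, smul_eq_mul]
  filter_upwards [coeFn_sliceCoef (H b) m, coeFn_sliceCoef V m, Lp.coeFn_smul c (sliceCoef V m)]
    with x h2 h3 h4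
  rw [← h3]
  change _ = (c • (sliceCoef V m : Var d n → ℂ)) x
  rw [← h4, ← h1, h2]
  rfl

theorem IsDiv.slice {f : VField d (L2 d (n + 1))}
    (h : IsDiv (cellBasis d (n + 1)) (symb (Pi.single (Fin.last n) 1)) f 0) :
    ∀ᵐ x ∂cellMeasure d n, IsDiv (cellBasis d 1) (symb fun _ => (1 : ℝ)⁻¹) (sliceField f x) 0 := by
  refine eventually_countable_forall.2 fun m => ?_
  set c : Fin d → ℂ := fun b => 2 * Real.pi * Complex.I * symb (fun _ => (1 : ℝ)⁻¹) m b with hc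
  have h1 : ∑ b, c b • sliceCoef (f b) m = 0 := by
    refine repr_ext (cellBasis d n) fun k => ?_
    have h2 := h (joinFreq k m)
    rw [symb_last_joinFreq] at h2
    rw [map_sum, lp.coeFn_sum, Finset.sum_apply]
    simp only [map_smul, lp.coeFn_smul, Pi.smul_apply, repr_sliceCoef, smul_eq_mul]
    rw [h2]
    simp
  filter_upwards [eventually_countable_forall.2 fun b => coeFn_sliceCoef (f b) m,
    eventually_countable_forall.2 fun b => Lp.coeFn_smul (c b) (sliceCoef (f b) m),
    Lp.coeFn_finsetSum Finset.univ fun b => c b • sliceCoef (f b) m,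
    Lp.coeFn_zero ℂ 2 (cellMeasure d n)] with x h2 h3 h4 h5
  rw [h1, h5, Finset.sum_apply] at h4
  rw [map_zero, lp.coeFn_zero, Pi.zero_apply]
  refine Eq.trans (Finset.sum_congr rfl fun b _ => ?_) h4.symm
  rw [h3, Pi.smul_apply, h2, smul_eq_mul]
  rfl

theorem coeFn_sliceField (g : VField d (L2 d (n + 1))) : ∀ᵐ x ∂cellMeasure d n,
    ∀ b, sliceField g x b =ᵐ[cellMeasure d 1] fun z => g b (join (x, z)) :=
  eventually_countable_forall.2 fun b => coeFn_slice (g b)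

theorem sliceField_add (g h : VField d (L2 d (n + 1))) : ∀ᵐ x ∂cellMeasure d n,
    sliceField (g + h) x = sliceField g x + sliceField h x := by
  filter_upwards [coeFn_sliceField (g + h), coeFn_sliceField g, coeFn_sliceField h,
    eventually_countable_forall.2 fun b => ae_ae_join (Lp.coeFn_add (g b) (h b))] with x h1 h2 h3 h4
  refine field_ext fun b => ?_
  filter_upwards [h1 b, h2 b, h3 b, h4 b, Lp.coeFn_add (sliceField g x b) (sliceField h x b)]
    with z h5 h6 h7 h8 h9
  rw [PiLp.add_apply, h9, Pi.add_apply, h6, h7, h5]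
  exact h8

theorem sliceField_matOp {Mu : ℝ} {A : Var d (n + 1) → Matrix (Fin d) (Fin d) ℝ}
    (hA : IsBoundedMatrix Mu A) (hf : ∀ x, IsBoundedMatrix Mu (fiber A x))
    (g : VField d (L2 d (n + 1))) : ∀ᵐ x ∂cellMeasure d n,
    sliceField (matOp A g) x = matOp (fiber A x) (sliceField g x) := by
  filter_upwards [coeFn_sliceField (matOp A g), coeFn_sliceField g,
    eventually_countable_forall.2 fun a => ae_ae_join (coeFn_matOp hA g a)] with x h1 h2 h3
  refine field_ext fun a => ?_
  filter_upwards [h1 a, eventually_countable_forall.2 h2, h3 a,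
    coeFn_matOp (hf x) (sliceField g x) a] with z h4 h5 h6 h7
  rw [h4, h6, h7]
  exact Finset.sum_congr rfl fun b _ => by rw [h5]; rfl

theorem sliceField_lift (Q : VField d (L2 d n)) : ∀ᵐ x ∂cellMeasure d n,
    sliceField (mapField lift Q) x = constField 1 fun b => Q b x := by
  filter_upwards [coeFn_sliceField (mapField lift Q),
    eventually_countable_forall.2 fun b => ae_ae_join (coeFn_lift (Q b))] with x h1 h2
  refine field_ext fun b => ?_
  filter_upwards [h1 b, h2 b, coeFn_constField (n := 1) (fun b => Q b x) b] with z h3 h4 h5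
  rw [h3, h5, mapField_apply, h4, initVar_join]

/-- The average of the flux over the last variable. -/
theorem repr_flux_eq {lam Mu L : ℝ} (hlam : 0 < lam) (hMu : 0 ≤ Mu) (hL : 0 ≤ L)
    {A : Var d (n + 1) → Matrix (Fin d) (Fin d) ℝ} {A' : Var d n → Matrix (Fin d) (Fin d) ℝ}
    (hA : IsLipCoeff lam Mu L A) (hA' : IsHomogenization A A') {Q : VField d (L2 d n)}
    {V : L2 d (n + 1)} {H : VField d (L2 d (n + 1))}
    (hV : IsCorrector (cellBasis d (n + 1)) (symb (Pi.single (Fin.last n) 1)) 0 (matOp A)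
      (mapField lift Q) V H) (i : Fin d) (k : Fin n → Fin d → ℤ) :
    (cellBasis d (n + 1)).repr (matOp A (H + mapField lift Q) i) (joinFreq k 0)
      = (cellBasis d n).repr (matOp A' Q i) k := by
  have hB := hA.isBoundedMatrix
  have hBf := fun x => (hA.fiber hL x).isBoundedMatrix
  have hell := fun x => isElliptic_matOp hMu (hBf x) (hA.fiber hL x).elliptic
  have hB' := (hA'.isLipCoeff hlam hMu hL hA).isBoundedMatrix
  choose X g hg using fun x j => exists_fiber_corrector hlam hMu hL hA x j
  have heq : ∀ x i j, (A' x i j : ℂ)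
      = (cellBasis d 1).repr (matOp (fiber A x) (g x j + unitField d 1 j) i) 0 :=
    fun x i j => (hA' x).eq hlam hMu (hBf x) (hA.fiber hL x).elliptic (hg x j) i
  have hdiv : IsDiv (cellBasis d (n + 1)) (symb (Pi.single (Fin.last n) 1))
      (matOp A (H + mapField lift Q)) 0 := by
    have := hV.div
    simpa using this
  rw [← repr_sliceCoef]
  refine congrArg (fun f => (cellBasis d n).repr f k) ?_
  refine Lp.ext ?_
  filter_upwards [coeFn_sliceCoef (matOp A (H + mapField lift Q) i) 0, hV.grad.slice, hdiv.slice,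
    sliceField_matOp hB hBf (H + mapField lift Q), sliceField_add H (mapField lift Q),
    sliceField_lift Q, coeFn_matOp hB' Q i] with x h1 h2 h3 h4 h5 h6 h7
  rw [h1, h7]
  have h8 : (cellBasis d 1).repr (slice (matOp A (H + mapField lift Q) i) x) 0
      = (cellBasis d 1).repr (sliceField (matOp A (H + mapField lift Q)) x i) 0 := rfl
  rw [h8, h4, h5, h6]
  rw [h4, h5, h6] at h3
  -- For almost every `x` the slice solves the cell problem with the constant data Q(x). By
  -- uniqueness and linearity its gradient is the combination of the `g x j` with weights Q_j(x), so
  -- its mean flux is A'(x)Q(x). The family `g` need not be measurable in `x`.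
  have hc : IsCorrector (cellBasis d 1) (symb fun _ => (1 : ℝ)⁻¹) 0 (matOp (fiber A x))
      (constField 1 fun b => Q b x) (slice V x) (sliceField H x) := ⟨h2, by simpa using h3⟩
  have hs := IsCorrector.sum_smul (fun j => Q j x) (hg x)
  rw [← constField_eq_sum] at hs
  rw [hc.grad_unique hlam (hell x) hs, constField_eq_sum, ← Finset.sum_add_distrib, map_sum,
    field_sum_apply, map_sum, lp.coeFn_sum, Finset.sum_apply]
  refine Finset.sum_congr rfl fun j _ => ?_
  rw [← smul_add, map_smul, PiLp.smul_apply, map_smul, lp.coeFn_smul, Pi.smul_apply, heq,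
    smul_eq_mul, mul_comm]

theorem lift_mode (k : Fin n → Fin d → ℤ) :
    lift (cellBasis d n k) = cellBasis d (n + 1) (joinFreq k 0) := by
  rw [cellBasis_apply, cellBasis_apply]
  refine Lp.ext ?_
  filter_upwards [coeFn_lift (modeL2 k), (memLp_mode (joinFreq k (0 : Fin 1 → Fin d → ℤ))).coeFn_toLp,
    measurePreserving_initVar.quasiMeasurePreserving.ae_eq_comp (memLp_mode k).coeFn_toLp]
    with y h1 h2 h3
  refine h1.trans (Eq.trans h3 (Eq.trans ?_ h2.symm))
  simp [mode, phase, Fin.sum_univ_castSucc, joinFreq, initVar]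

theorem repr_lift (f : L2 d n) (k : Fin n → Fin d → ℤ) (m : Fin 1 → Fin d → ℤ) :
    (cellBasis d (n + 1)).repr (lift f) (joinFreq k m)
      = if m = 0 then (cellBasis d n).repr f k else 0 := by
  rw [← repr_sliceCoef]
  have h1 : sliceCoef (lift f) m = if m = 0 then f else 0 := by
    refine Lp.ext ?_
    filter_upwards [coeFn_sliceCoef (lift f) m, coeFn_slice (lift f),
      ae_ae_join (coeFn_lift f), Lp.coeFn_zero ℂ 2 (cellMeasure d n)] with x h1 h2 h3 h4
    have h5 : slice (lift f) x = f x • cellBasis d 1 0 := by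
      rw [cellBasis_apply, modeL2]
      refine Lp.ext ?_
      filter_upwards [h2, h3, Lp.coeFn_smul (f x) ((memLp_mode 0).toLp _),
        (memLp_mode (0 : Fin 1 → Fin d → ℤ)).coeFn_toLp] with z h6 h7 h8 h9
      rw [h6, h7, initVar_join, h8, Pi.smul_apply, h9]
      simp [mode, phase]
    classical
    rw [h1, h5, map_smul, HilbertBasis.repr_self, lp.coeFn_smul, Pi.smul_apply, lp.single_apply]
    by_cases h : m = 0
    · subst h; simp
    · rw [if_neg h, h4]; simp [h]
  rw [h1]
  split_ifs <;> simp

end Slice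

/-! ### Regularity of fields measured by translations. -/

section TransLip

variable {d n : ℕ} {lam Mu L a a' q : ℝ}

/-- Translations act on the field `g` in a Lipschitz way. -/
def TransLip (a : ℝ) (g : VField d (L2 d n)) : Prop :=
  ∀ h, ‖mapField (shift h) g - g‖ ≤ a * ‖h‖

theorem TransLip.add {g g' : VField d (L2 d n)} (h : TransLip a g) (h' : TransLip a' g') :
    TransLip (a + a') (g + g') := fun t => by
  rw [map_add, add_sub_add_comm, add_mul]
  exact (norm_add_le _ _).trans (add_le_add (h t) (h' t))

theorem TransLip.sub {g g' : VField d (L2 d n)} (h : TransLip a g) (h' : TransLip a' g') :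
    TransLip (a + a') (g - g') := fun t => by
  rw [map_sub, sub_sub_sub_comm, add_mul]
  exact (norm_sub_le _ _).trans (add_le_add (h t) (h' t))

theorem transLip_constField (v : Fin d → ℂ) : TransLip 0 (constField n v) := fun t => by
  rw [mapField_shift_constField]; simp

variable {A : Var d n → Matrix (Fin d) (Fin d) ℝ}

theorem TransLip.matOp (hMu : 0 ≤ Mu) (hL : 0 ≤ L) (hA : IsLipCoeff lam Mu L A)
    {g : VField d (L2 d n)} (h : TransLip a g) (hg : ‖g‖ ≤ q) :
    TransLip (d ^ 2 * L * q + d ^ 2 * Mu * a) (matOp A g) := fun t => by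
  have h1 := norm_commutator_le hL hA.isBoundedMatrix hA.periodic hA.lipschitz t g
  have h2 := norm_matOp_le hMu hA.isBoundedMatrix (mapField (shift t) g - g)
  rw [map_sub] at h2
  have h3 := norm_sub_le_norm_sub_add_norm_sub (mapField (shift t) (Multiscale.matOp A g))
    (Multiscale.matOp A (mapField (shift t) g)) (Multiscale.matOp A g)
  refine h3.trans ((add_le_add h1 h2).trans ?_)
  have h4 := h t
  calc _ ≤ d ^ 2 * (L * ‖t‖) * q + d ^ 2 * Mu * (a * ‖t‖) := by gcongr
    _ = _ := by ring

/-- The constant involves neither κ nor τ, so the regularity is uniform in all the scales. -/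
theorem IsCorrector.transLip (hlam : 0 < lam) (hMu : 0 ≤ Mu) (hL : 0 ≤ L)
    (hA : IsLipCoeff lam Mu L A) {κ : (Fin n → Fin d → ℤ) → Fin d → ℝ} {τ : ℝ}
    {v g : VField d (L2 d n)} {x : L2 d n}
    (hc : IsCorrector (cellBasis d n) κ τ (matOp A) v x g) (h : TransLip a v) (hg : ‖g + v‖ ≤ q) :
    TransLip (lam⁻¹ * (d ^ 2 * L * q + d ^ 2 * Mu * a)) g := fun t => by
  have hell := isElliptic_matOp hMu hA.isBoundedMatrix hA.elliptic
  have h1 := norm_commutator_le hL hA.isBoundedMatrix hA.periodic hA.lipschitz t (g + v)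
  have h2 := hc.norm_map_sub_le hlam hell (repr_shift t)
  have h4 := h t
  calc _ ≤ lam⁻¹ * (d ^ 2 * (L * ‖t‖) * q + d ^ 2 * Mu * (a * ‖t‖)) := by
        refine h2.trans ?_
        gcongr
        exact h1.trans (by gcongr)
    _ = _ := by ring

theorem shift_lift (t : Var d (n + 1)) (f : L2 d n) :
    shift t (lift f) = lift (shift (initVar t) f) := by
  refine Lp.ext ?_
  filter_upwards [coeFn_shift t (lift f), coeFn_lift (shift (initVar t) f),
    (measurePreserving_translate t).quasiMeasurePreserving.ae_eq_comp (coeFn_lift f),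
    measurePreserving_initVar.quasiMeasurePreserving.ae_eq_comp (coeFn_shift (initVar t) f)]
    with y h1 h2 h3 h4
  rw [h1, h2]
  exact h3.trans h4.symm

theorem norm_initVar_le (t : Var d (n + 1)) : ‖initVar t‖ ≤ ‖t‖ :=
  (pi_norm_le_iff_of_nonneg (norm_nonneg _)).2 fun i => norm_le_pi_norm t i.castSucc

theorem TransLip.lift (ha : 0 ≤ a) {g : VField d (L2 d n)} (h : TransLip a g) :
    TransLip a (mapField lift g) := fun t => by
  have h1 : mapField (shift t) (mapField Multiscale.lift g)
      = mapField Multiscale.lift (mapField (shift (initVar t)) g) := by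
    refine PiLp.ext fun b => ?_
    simp only [mapField_apply, shift_lift]
  rw [h1, ← map_sub, LinearIsometry.norm_map]
  refine (h _).trans ?_
  gcongr
  exact norm_initVar_le t

theorem norm_unitVec_le (i : Fin n) (c : Fin d) : ‖(unitVec i c : Var d n)‖ ≤ 1 := by
  refine (pi_norm_le_iff_of_nonneg zero_le_one).2 fun j =>
    (pi_norm_le_iff_of_nonneg zero_le_one).2 fun b => ?_
  by_cases hj : j = i
  · subst hj
    by_cases hb : b = c
    · subst hb; simp [unitVec]
    · simp [unitVec, hb]
  · simp [unitVec, hj]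

theorem exists_symb_deriv (ha : 0 ≤ a) {f : L2 d n} (hf : ∀ t, ‖shift t f - f‖ ≤ a * ‖t‖)
    {w : Fin n → ℝ} (hw : ∀ i, 0 ≤ w i) (c : Fin d) :
    ∃ f' : L2 d n, (∀ k, (cellBasis d n).repr f' k = symb w k c * (cellBasis d n).repr f k) ∧
      ‖f'‖ ≤ (∑ i, w i) * a := by
  have h1 : ∀ i, ∃ f' : L2 d n, (∀ k, (cellBasis d n).repr f' k
      = 2 * Real.pi * Complex.I * ((k i c : ℝ) : ℂ) * (cellBasis d n).repr f k) ∧ ‖f'‖ ≤ a := fun i =>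
    exists_deriv (T := fun t => shift (t • unitVec i c)) 
      (p := fun k : Fin n → Fin d → ℤ => (k i c : ℝ))
      (fun t f k => by
        rw [repr_shift, mode, phase_smul, phase_unitVec]
        congr 2
        push_cast
        ring) ha fun t => by
        refine (hf _).trans ?_
        gcongr
        rw [norm_smul, Real.norm_eq_abs]
        exact mul_le_of_le_one_right (abs_nonneg _) (norm_unitVec_le i c)
  choose D hD hDn using h1
  have hπ : (2 * Real.pi * Complex.I : ℂ) ≠ 0 := Complex.two_pi_I_ne_zero
  -- `symb` omits the factor 2πi that the derivatives `D i` carry; dividing by it only decreases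
  -- norms.
  refine ⟨∑ i, ((w i : ℂ) / (2 * Real.pi * Complex.I)) • D i, fun k => ?_, ?_⟩
  · rw [map_sum, lp.coeFn_sum, Finset.sum_apply, symb, Complex.ofReal_sum, Finset.sum_mul]
    refine Finset.sum_congr rfl fun i _ => ?_
    rw [map_smul, lp.coeFn_smul, Pi.smul_apply, hD, smul_eq_mul]
    field_simp
    push_cast
    ring
  · rw [Finset.sum_mul]
    refine (norm_sum_le _ _).trans (Finset.sum_le_sum fun i _ => ?_)
    rw [norm_smul, norm_div, Complex.norm_real, Real.norm_of_nonneg (hw i)]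
    have h2 : (1 : ℝ) ≤ ‖(2 * Real.pi * Complex.I : ℂ)‖ := by
      simp only [norm_mul, Complex.norm_ofNat, Complex.norm_real, Complex.norm_I,
        Real.norm_of_nonneg Real.pi_pos.le, mul_one]
      linarith [Real.pi_gt_three]
    have h3 := hDn i
    have h4 := hw i
    gcongr
    exact div_le_self h4 h2

theorem TransLip.apply {g : VField d (L2 d n)} (h : TransLip a g) (b : Fin d) (t : Var d n) :
    ‖shift t (g b) - g b‖ ≤ a * ‖t‖ :=
  (norm_apply_le (mapField (shift t) g - g) b).trans (h t)

end TransLip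

/-! ### Functions independent of the last variable. -/

section Lift

variable {d n : ℕ}

theorem symb_joinFreq_zero (w : Fin (n + 1) → ℝ) (k : Fin n → Fin d → ℤ) :
    symb w (joinFreq k 0) = symb (fun i => w i.castSucc) k := by
  ext b
  simp [symb, Fin.sum_univ_castSucc, joinFreq]

theorem IsGrad.lift {w : Fin (n + 1) → ℝ} {x : L2 d n} {g : VField d (L2 d n)}
    (h : IsGrad (cellBasis d n) (symb fun i => w i.castSucc) x g) :
    IsGrad (cellBasis d (n + 1)) (symb w) (lift x) (mapField lift g) := fun k b => by
  rw [exists_eq_joinFreq k, mapField_apply, repr_lift, repr_lift]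
  split_ifs with hm
  · rw [hm, symb_joinFreq_zero]
    exact h _ b
  · simp

theorem IsDiv.lift {w : Fin (n + 1) → ℝ} {f : VField d (L2 d n)} {s : L2 d n}
    (h : IsDiv (cellBasis d n) (symb fun i => w i.castSucc) f s) :
    IsDiv (cellBasis d (n + 1)) (symb w) (mapField lift f) (lift s) := fun k => by
  rw [exists_eq_joinFreq k]
  simp only [mapField_apply, repr_lift]
  split_ifs with hm
  · rw [hm, symb_joinFreq_zero]
    exact h _
  · simp

theorem mapField_lift_constField (v : Fin d → ℂ) :
    mapField lift (constField n v) = constField (n + 1) v := by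
  refine PiLp.ext fun a => ?_
  rw [mapField_apply, constField_apply_eq_smul, constField_apply_eq_smul, map_smul, lift_mode]
  congr 2
  ext i b
  refine Fin.lastCases ?_ (fun i => ?_) i <;> simp [joinFreq]

theorem symb_last_eq_zero_or (k : Fin (n + 1) → Fin d → ℤ) :
    symb (Pi.single (Fin.last n) (1 : ℝ)) k = 0
      ∨ 1 ≤ ∑ b, symb (Pi.single (Fin.last n) (1 : ℝ)) k b ^ 2 := by
  rw [exists_eq_joinFreq k, symb_last_joinFreq]
  exact symb_one_eq_zero_or _

theorem symb_one_eq_zero_iff (m : Fin 1 → Fin d → ℤ) : symb (fun _ => (1 : ℝ)⁻¹) m = 0 ↔ m = 0 := by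
  refine ⟨fun h => ?_, fun h => by rw [h, symb_zero]⟩
  ext i b
  have h1 := congrFun h b
  have h2 : ((m 0 b : ℤ) : ℝ) = 0 := by simpa [symb] using h1
  rw [Subsingleton.elim i 0]
  exact_mod_cast h2

end Lift

/-! ### Error of the elimination of one scale. -/

section Step

variable {d : ℕ} {lam Mu L : ℝ}

set_option maxHeartbeats 1600000 in
/-- Elimination of the last variable. -/
theorem exists_step_bound (n : ℕ) (hlam : 0 < lam) (hMu : 0 ≤ Mu) (hL : 0 ≤ L) :
    ∃ C, 0 ≤ C ∧ ∀ (A : Var d (n + 1) → Matrix (Fin d) (Fin d) ℝ)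
      (A' : Var d n → Matrix (Fin d) (Fin d) ℝ), IsLipCoeff lam Mu L A → IsHomogenization A A' →
      ∀ (δ : Fin (n + 1) → ℝ) (τ : ℝ), (∀ i, 0 < δ i) → 0 < τ →
      ∀ M M', IsEffectiveMatrix δ τ A M → IsEffectiveMatrix (fun i => δ i.castSucc) τ A' M' →
      ∀ i j, |M i j - M' i j| ≤ C * (δ (Fin.last n) * (∑ i : Fin n, (δ i.castSucc)⁻¹)
        + τ * δ (Fin.last n) ^ 2 * (∑ i : Fin n, (δ i.castSucc)⁻¹)
        + τ ^ 2 * δ (Fin.last n) ^ 2) := by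
  -- `Mu'` and `L'` are the constants of `A'`; `q` and `p` bound the total fields Q = G + e_j and H
  -- + Q; `a₁`, `a₂`, `a₃` are the translation constants of Q, of H and of the residual flux; `K₁`
  -- dominates those needed in the step. None of them depends on δ or τ.
  obtain ⟨Mu', hMu'⟩ : ∃ Mu', Mu' = d ^ 2 * Mu * amp d lam Mu := ⟨_, rfl⟩
  obtain ⟨L', hL'⟩ : ∃ L', L' = d ^ 2 * L * amp d lam Mu ^ 2 := ⟨_, rfl⟩
  have hamp : ∀ {r}, 0 ≤ r → 0 ≤ amp d lam r := fun hr => by unfold amp; positivity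
  have hMu'0 : 0 ≤ Mu' := by have := hamp hMu; rw [hMu']; positivity
  have hL'0 : 0 ≤ L' := by have := hamp hMu; rw [hL']; positivity
  obtain ⟨q, hq⟩ : ∃ q, q = amp d lam Mu' := ⟨_, rfl⟩
  have hq0 : 0 ≤ q := hq ▸ hamp hMu'0
  obtain ⟨p, hp⟩ : ∃ p, p = amp d lam Mu * q := ⟨_, rfl⟩
  have hp0 : 0 ≤ p := by have := hamp hMu; rw [hp]; positivity
  obtain ⟨a₁, ha₁⟩ : ∃ a₁, a₁ = lam⁻¹ * (d ^ 2 * L' * q + d ^ 2 * Mu' * 0) + 0 := ⟨_, rfl⟩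
  have ha₁0 : 0 ≤ a₁ := by rw [ha₁]; positivity
  obtain ⟨a₂, ha₂⟩ : ∃ a₂, a₂ = lam⁻¹ * (d ^ 2 * L * p + d ^ 2 * Mu * a₁) := ⟨_, rfl⟩
  have ha₂0 : 0 ≤ a₂ := by rw [ha₂]; positivity
  obtain ⟨a₃, ha₃⟩ : ∃ a₃, a₃ = (d ^ 2 * L * p + d ^ 2 * Mu * (a₂ + a₁))
    + (d ^ 2 * L' * q + d ^ 2 * Mu' * a₁) := ⟨_, rfl⟩
  have ha₃0 : 0 ≤ a₃ := by rw [ha₃]; positivity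
  obtain ⟨K₁, hK₁⟩ : ∃ K₁, K₁ = a₂ + a₃ + p := ⟨_, rfl⟩
  have hK₁0 : 0 ≤ K₁ := by rw [hK₁]; positivity
  have hm : 0 < min lam 1 := lt_min hlam one_pos
  have hs0 : 0 ≤ stepConst d lam (d ^ 2 * Mu) := by unfold stepConst; positivity
  refine ⟨d ^ 2 * Mu * (stepConst d lam (d ^ 2 * Mu) * K₁), by positivity, ?_⟩
  intro A A' hA hA' δ τ hδ hτ M M' hM hM' i j
  have hlip' : IsLipCoeff lam Mu' L' A' := by
    rw [hMu', hL']; exact hA'.isLipCoeff hlam hMu hL hA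
  have hB := hA.isBoundedMatrix
  have hB' := hlip'.isBoundedMatrix
  have hell := isElliptic_matOp hMu hB hA.elliptic
  have hell' := isElliptic_matOp hMu'0 hB' hlip'.elliptic
  set S := ∑ i : Fin n, (δ i.castSucc)⁻¹ with hS
  have hS0 : 0 ≤ S := Finset.sum_nonneg fun i _ => by have := hδ i.castSucc; positivity
  set t := δ (Fin.last n) with ht
  have ht0 : 0 < t := hδ _
  obtain ⟨x, g, hx, -⟩ := exists_corrector (e := cellBasis d (n + 1))
    (κ := symb fun i => (δ i)⁻¹) hlam hell (Or.inl hτ.ne') (unitField d (n + 1) j)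
  obtain ⟨X, G, hX, -⟩ := exists_corrector (e := cellBasis d n)
    (κ := symb fun i => (δ i.castSucc)⁻¹) hlam hell' (Or.inl hτ.ne') (unitField d n j)
  set ξ := unitField d (n + 1) j with hξ
  set Q := G + unitField d n j with hQ
  have hξQ : mapField lift Q = ξ + mapField lift G := by
    rw [hQ, map_add, unitField, mapField_lift_constField]; exact add_comm _ _
  obtain ⟨V, H, hV, hV₀⟩ := exists_corrector (e := cellBasis d (n + 1))
    (κ := symb (Pi.single (Fin.last n) (1 : ℝ))) (τ := 0) hlam hell (Or.inr symb_last_eq_zero_or)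
    (mapField lift Q)
  set F := mapField lift (matOp A' Q) with hF
  have hQn : ‖Q‖ ≤ q := by
    have h1 := hX.norm_grad_le hlam hell'
    rw [norm_unitField, mul_one] at h1
    refine (norm_add_le _ _).trans ?_
    rw [norm_unitField, hq, amp]
    linarith
  have hHn : ‖H‖ ≤ lam⁻¹ * (d ^ 2 * Mu * q) := by
    have h1 := hV.norm_grad_le hlam hell
    rw [LinearIsometry.norm_map] at h1
    exact h1.trans (by gcongr)
  have hPn : ‖H + mapField lift Q‖ ≤ p := by
    refine (norm_add_le _ _).trans ?_
    rw [LinearIsometry.norm_map, hp, amp]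
    linarith
  have hHp : ‖H‖ ≤ p := by
    refine hHn.trans ?_
    rw [hp, amp]
    linarith
  have hQt : TransLip a₁ Q := by
    rw [ha₁]
    exact (hX.transLip hlam hMu'0 hL'0 hlip' (transLip_constField _) hQn).add
      (transLip_constField _)
  have hHt : TransLip a₂ H := by
    rw [ha₂]
    exact hV.transLip hlam hMu hL hA (hQt.lift ha₁0) hPn
  have hσt : TransLip a₃ (matOp A (H + mapField lift Q) - F) := by
    rw [ha₃]
    exact ((hHt.add (hQt.lift ha₁0)).matOp hMu hL hA hPn).sub
      ((hQt.matOp hMu'0 hL'0 hlip' hQn).lift (by positivity))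
  have hVn : ‖V‖ ≤ p :=
    (hV.grad.norm_le fun k => (symb_last_eq_zero_or k).imp_left (hV₀ k)).trans hHp
  -- Translates of `V` still have mean zero in the last variable, so the Poincaré inequality reduces
  -- `V` to its fast gradient `H`.
  have hVt : ∀ h, ‖shift h V - V‖ ≤ a₂ * ‖h‖ := fun h => by
    refine le_trans ?_ (hHt h)
    refine ((hV.grad.map (repr_shift h)).sub hV.grad).norm_le fun k => ?_
    refine (symb_last_eq_zero_or k).imp_left fun hk => ?_
    rw [map_sub, lp.coeFn_sub, Pi.sub_apply, repr_shift, hV₀ k hk]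
    simp
  have hflux := fun i k => repr_flux_eq hlam hMu hL hA hA' hV i k
  have hF0 : ∀ (k : Fin n → Fin d → ℤ) m b, (cellBasis d (n + 1)).repr (F b) (joinFreq k m)
      = if m = 0 then (cellBasis d n).repr (matOp A' Q b) k else 0 := fun k m b => by
    rw [hF, mapField_apply, repr_lift]
  -- Weights of the slow gradient: `symb w` plays the role of κ', with total weight `S`.
  set w : Fin (n + 1) → ℝ := Fin.snoc (α := fun _ => ℝ) (fun i : Fin n => (δ i.castSucc)⁻¹) 0 with hw
  have hw0 : ∀ i, 0 ≤ w i := fun i => by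
    refine Fin.lastCases ?_ (fun i => ?_) i
    · simp [hw]
    · have := hδ i.castSucc
      simp only [hw, Fin.snoc_castSucc]
      positivity
  have hwS : ∑ i, w i = S := by simp [hw, Fin.sum_univ_castSucc, hS]
  rw [hξQ] at hV hσt hflux hPn
  have hDV : ∀ c, ∃ f : L2 d (n + 1), (∀ k, (cellBasis d (n + 1)).repr f k
      = symb w k c * (cellBasis d (n + 1)).repr V k) ∧ ‖f‖ ≤ S * K₁ := fun c => by
    obtain ⟨f, hf, hfn⟩ := exists_symb_deriv ha₂0 hVt hw0 c
    refine ⟨f, hf, hfn.trans ?_⟩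
    rw [hwS, hK₁]
    gcongr
    linarith
  have hDσ : ∀ b c, ∃ f : L2 d (n + 1), (∀ k, (cellBasis d (n + 1)).repr f k = symb w k c *
      (cellBasis d (n + 1)).repr ((matOp A (H + (ξ + mapField lift G)) - F) b) k) ∧ ‖f‖ ≤ S * K₁ :=
    fun b c => by
    have h1 := hσt.apply b
    obtain ⟨f, hf, hfn⟩ := exists_symb_deriv
      (f := (matOp A (H + (ξ + mapField lift G)) - F) b) ha₃0 h1 hw0 c
    refine ⟨f, hf, hfn.trans ?_⟩
    rw [hwS, hK₁]
    gcongr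
    linarith
  have hXd : IsDiv (cellBasis d (n + 1)) (symb fun i => (δ i)⁻¹) F ((τ ^ 2 : ℂ) • lift X) := by
    rw [← map_smul]; exact IsDiv.lift hX.div
  have hXg : IsGrad (cellBasis d (n + 1)) (symb fun i => (δ i)⁻¹) (lift X) (mapField lift G) :=
    IsGrad.lift hX.grad
  have hκ : ∀ (k : Fin (n + 1) → Fin d → ℤ) b, symb (fun i => (δ i)⁻¹) k b
      = symb w k b + t⁻¹ * symb (Pi.single (Fin.last n) (1 : ℝ)) k b := fun k b => by
    simp only [symb, Fin.sum_univ_castSucc, hw, Fin.snoc_castSucc, Fin.snoc_last]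
    simp [← ht]
  have hF0' : ∀ k, symb (Pi.single (Fin.last n) (1 : ℝ)) k ≠ 0 → ∀ b,
      (cellBasis d (n + 1)).repr (F b) k = 0 := fun k hk b => by
    rw [exists_eq_joinFreq k, symb_last_joinFreq, ne_eq, symb_one_eq_zero_iff] at hk
    rw [exists_eq_joinFreq k, hF0, if_neg hk]
  have hσ0 : ∀ k, symb (Pi.single (Fin.last n) (1 : ℝ)) k = 0 → ∀ b,
      (cellBasis d (n + 1)).repr (matOp A (H + (ξ + mapField lift G)) b) k
        = (cellBasis d (n + 1)).repr (F b) k := fun k hk b => by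
    rw [exists_eq_joinFreq k, symb_last_joinFreq, symb_one_eq_zero_iff] at hk
    rw [exists_eq_joinFreq k, hF0, hk, if_pos rfl, hflux]
  clear_value F w S t
  have hstep := norm_grad_sub_le hlam (by positivity : (0 : ℝ) ≤ d ^ 2 * Mu) ht0 hτ hell hκ
    symb_last_eq_zero_or hx hXg hXd hF0' hV hV₀ hσ0 hDV hDσ (by positivity)
    (hVn.trans (by rw [hK₁]; linarith) : ‖V‖ ≤ K₁)
  -- Both matrices are mean fluxes of `A`: by `repr_flux_eq` the mean of A'Q is that of A(H + Q).
  -- Their difference is therefore the mean flux of the gradient error.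
  have hMM : ((M i j - M' i j : ℝ) : ℂ)
      = (cellBasis d (n + 1)).repr (matOp A (g - (mapField lift G + H)) i) 0 := by
    have h0 : (0 : Fin (n + 1) → Fin d → ℤ) = joinFreq 0 0 := by
      rw [exists_eq_joinFreq (0 : Fin (n + 1) → Fin d → ℤ)]; rfl
    have h1 := hM.eq hlam hMu hB hA.elliptic hx i
    have h2 := hM'.eq hlam hMu'0 hB' hlip'.elliptic hX i
    rw [← hflux, ← h0] at h2
    rw [← hξ] at h1
    rw [Complex.ofReal_sub, h1, h2, ← Pi.sub_apply, ← lp.coeFn_sub, ← map_sub, ← PiLp.sub_apply,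
      ← map_sub]
    have h3 : g + ξ - (H + (ξ + mapField lift G)) = g - (mapField lift G + H) := by abel
    rw [h3]
  have habs : |M i j - M' i j| = ‖((M i j - M' i j : ℝ) : ℂ)‖ := by
    rw [Complex.norm_real, Real.norm_eq_abs]
  rw [habs, hMM]
  refine (norm_repr_le _ _).trans ((norm_apply_le _ i).trans ((hell.bounded _).trans ?_))
  calc _ ≤ d ^ 2 * Mu * (stepConst d lam (d ^ 2 * Mu) *
        (t * (S * K₁) + τ * t ^ 2 * (S * K₁) + τ ^ 2 * t ^ 2 * K₁)) := by gcongr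
    _ = _ := by ring

end Step

/-! ### Analytic coefficients are Lipschitz. -/

section Coefficient

variable {d n : ℕ} {lam C₀ Λ₀ : ℝ} {A : Var d n → Matrix (Fin d) (Fin d) ℝ}

theorem IsCoefficient.abs_le (hA : IsCoefficient lam C₀ Λ₀ A) (y : Var d n) (a b : Fin d) :
    |A y a b| ≤ lam⁻¹ := by
  have h := hA.bounded y (Pi.single b 1)
  rw [Matrix.mulVec_single_one, dotProduct_single_one, Pi.single_eq_same, Real.sqrt_one,
    mul_one] at h
  refine (Real.abs_le_sqrt ?_).trans h
  rw [dotProduct, sq]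
  exact Finset.single_le_sum (f := fun i => (A y).col b i * (A y).col b i)
    (fun i _ => mul_self_nonneg _) (Finset.mem_univ a)

theorem eq_sum_unitVec (v : Var d n) : v = ∑ p : Fin n × Fin d, v p.1 p.2 • unitVec p.1 p.2 := by
  ext i b
  rw [Finset.sum_apply, Finset.sum_apply, Finset.sum_eq_single (i, b)]
  · simp [unitVec]
  · rintro ⟨j, c⟩ _ h
    by_cases hj : i = j
    · subst hj
      have : b ≠ c := fun hb => h (by rw [hb])
      simp [unitVec, this]
    · simp [unitVec, hj]
  · simp

theorem IsCoefficient.sum_abs_fderiv_le (hA : IsCoefficient lam C₀ Λ₀ A) (y : Var d n)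
    (a b : Fin d) : ∑ p : Fin n × Fin d, |fderiv ℝ (fun x => A x a b) y (unitVec p.1 p.2)|
      ≤ C₀ * Λ₀ := by
  have h := hA.analytic 1 y
  simp only [derivNorm, iteratedFDeriv_one_apply, pow_one, Nat.factorial_one, Nat.cast_one,
    mul_one] at h
  refine le_trans ?_ h
  set φ : Fin d → Fin d → ℝ := fun a b => ∑ J : Fin 1 → Fin n × Fin d,
    |fderiv ℝ (fun x => A x a b) y (unitVec (J 0).1 (J 0).2)| with hφ
  have hφ0 : ∀ a b, 0 ≤ φ a b := fun a b => Finset.sum_nonneg fun _ _ => abs_nonneg _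
  have h1 : ∑ p : Fin n × Fin d, |fderiv ℝ (fun x => A x a b) y (unitVec p.1 p.2)| = φ a b :=
    (Fintype.sum_equiv (Equiv.funUnique (Fin 1) (Fin n × Fin d)) _ _ fun J => rfl).symm
  rw [h1]
  refine (Finset.single_le_sum (f := φ a) (fun b _ => hφ0 a b) (Finset.mem_univ b)).trans ?_
  exact Finset.single_le_sum (f := fun a => ∑ b, φ a b)
    (fun a _ => Finset.sum_nonneg fun b _ => hφ0 a b) (Finset.mem_univ a)

/-- Mean value inequality. The norm of `Var` is the supremum norm, dual to the sum of the absolute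
values of the partial derivatives, which the case ℓ = 1 of the analytic bound controls. -/
theorem IsCoefficient.isLipCoeff (hA : IsCoefficient lam C₀ Λ₀ A) (hL : 0 ≤ C₀ * Λ₀) :
    IsLipCoeff lam lam⁻¹ (C₀ * Λ₀) A := by
  refine ⟨hA.elliptic, hA.abs_le, hA.periodic, fun y y' a b => ?_⟩
  rw [← Real.norm_eq_abs]
  refine Convex.norm_image_sub_le_of_norm_fderiv_le (𝕜 := ℝ) (s := Set.univ)
    (f := fun x => A x a b)
    (fun x _ => ((hA.smooth a b).differentiable (by simp)).differentiableAt) (fun x _ => ?_)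
    convex_univ (Set.mem_univ y') (Set.mem_univ y)
  refine ContinuousLinearMap.opNorm_le_bound _ hL fun v => ?_
  have h1 : fderiv ℝ (fun x => A x a b) x v = ∑ p : Fin n × Fin d,
      v p.1 p.2 * fderiv ℝ (fun x => A x a b) x (unitVec p.1 p.2) := by
    conv_lhs => rw [eq_sum_unitVec v, map_sum]
    simp only [map_smul, smul_eq_mul]
  rw [h1]
  refine (norm_sum_le _ _).trans ?_
  refine le_trans ?_ (mul_le_mul_of_nonneg_right (hA.sum_abs_fderiv_le x a b) (norm_nonneg v))
  rw [Finset.sum_mul]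
  refine Finset.sum_le_sum fun p _ => ?_
  rw [norm_mul, mul_comm, Real.norm_eq_abs]
  gcongr
  exact (norm_le_pi_norm (v p.1) p.2).trans (norm_le_pi_norm v p.1)

end Coefficient

/-! ### Induction on the number of scales. -/

section Reiterated

variable {d : ℕ} {lam : ℝ}

theorem amp_nonneg (hlam : 0 < lam) {Mu : ℝ} (hMu : 0 ≤ Mu) : 0 ≤ amp d lam Mu := by
  unfold amp; positivity

theorem IsHomogenization.unique {n : ℕ} {Mu L : ℝ} (hlam : 0 < lam) (hMu : 0 ≤ Mu) (hL : 0 ≤ L)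
    {A : Var d (n + 1) → Matrix (Fin d) (Fin d) ℝ} (hA : IsLipCoeff lam Mu L A)
    {A' A'' : Var d n → Matrix (Fin d) (Fin d) ℝ} (h' : IsHomogenization A A')
    (h'' : IsHomogenization A A'') : A' = A'' :=
  funext fun x => (h' x).unique hlam hMu (hA.fiber hL x).isBoundedMatrix (hA.fiber hL x).elliptic
    (h'' x)

theorem isReiteratedMatrix_succ_iff {n : ℕ} {Mu L : ℝ} (hlam : 0 < lam) (hMu : 0 ≤ Mu) (hL : 0 ≤ L)
    {A : Var d (n + 1) → Matrix (Fin d) (Fin d) ℝ} (hA : IsLipCoeff lam Mu L A)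
    {A' : Var d n → Matrix (Fin d) (Fin d) ℝ} (h' : IsHomogenization A A')
    {M : Matrix (Fin d) (Fin d) ℝ} : IsReiteratedMatrix (n + 1) A M ↔ IsReiteratedMatrix n A' M := by
  constructor
  · rintro ⟨A'', h'', hM⟩
    rwa [h'.unique hlam hMu hL hA h'']
  · exact fun hM => ⟨A', h', hM⟩

theorem exists_isReiteratedMatrix_iff (hlam : 0 < lam) (n : ℕ) : ∀ {Mu L : ℝ}, 0 ≤ Mu → 0 ≤ L →
    ∀ {A : Var d n → Matrix (Fin d) (Fin d) ℝ}, IsLipCoeff lam Mu L A →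
    ∃ A₀, ∀ M, IsReiteratedMatrix n A M ↔ M = A₀ := by
  induction n with
  | zero => exact fun _ _ A _ => ⟨A _, fun M => Iff.rfl⟩
  | succ n ih =>
    intro Mu L hMu hL A hA
    obtain ⟨A', hA'⟩ := exists_isHomogenization hlam hMu hL hA
    have := amp_nonneg (d := d) hlam hMu
    obtain ⟨A₀, h⟩ := ih (by positivity) (by positivity) (hA'.isLipCoeff hlam hMu hL hA)
    exact ⟨A₀, fun M => (isReiteratedMatrix_succ_iff hlam hMu hL hA hA').trans (h M)⟩

/-- Base of the induction: with no variables the cell is a point and the corrector is 0. -/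
theorem isEffectiveMatrix_zero (A : Var d 0 → Matrix (Fin d) (Fin d) ℝ) (δ : Fin 0 → ℝ) (τ : ℝ) :
    IsEffectiveMatrix δ τ A (A fun i => i.elim0) := by
  intro j
  refine ⟨fun _ => 0, fun _ _ => 0, ⟨memLp_const 0, fun _ => memLp_const 0, fun φ _ _ k => ?_,
    fun φ _ _ => ?_⟩, fun i => ?_⟩
  · simp
  · simp [hatGrad, dotProduct]
  · have h1 : ∀ y : Var d 0, A y i j + (A y *ᵥ fun _ => (0 : ℝ)) i = A (fun i => i.elim0) i j :=
      fun y => by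
        rw [Subsingleton.elim y fun i => i.elim0]
        simp [Matrix.mulVec, dotProduct]
    simp only [h1]
    change _ = ∫ _, _ ∂cellMeasure d 0
    simp

/-- The error of the elimination of all the scales, up to a constant factor. -/
def scaleError : (n : ℕ) → (Fin n → ℝ) → ℝ → ℝ
  | 0, _, _ => 0
  | n + 1, δ, τ => scaleError n (fun i => δ i.castSucc) τ
    + (δ (Fin.last n) * (∑ i : Fin n, (δ i.castSucc)⁻¹)
      + τ * δ (Fin.last n) ^ 2 * (∑ i : Fin n, (δ i.castSucc)⁻¹) + τ ^ 2 * δ (Fin.last n) ^ 2)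

theorem stepError_nonneg {n : ℕ} {δ : Fin (n + 1) → ℝ} {τ : ℝ} (hδ : ∀ i, 0 < δ i) (hτ : 0 < τ) :
    0 ≤ δ (Fin.last n) * (∑ i : Fin n, (δ i.castSucc)⁻¹)
      + τ * δ (Fin.last n) ^ 2 * (∑ i : Fin n, (δ i.castSucc)⁻¹) + τ ^ 2 * δ (Fin.last n) ^ 2 := by
  have h1 : 0 ≤ ∑ i : Fin n, (δ i.castSucc)⁻¹ :=
    Finset.sum_nonneg fun i _ => inv_nonneg.2 (hδ _).le
  have h2 := hδ (Fin.last n)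
  positivity

theorem scaleError_nonneg {n : ℕ} : ∀ {δ : Fin n → ℝ} {τ : ℝ}, (∀ i, 0 < δ i) → 0 < τ →
    0 ≤ scaleError n δ τ := by
  induction n with
  | zero => exact fun _ _ => le_rfl
  | succ n ih => exact fun hδ hτ => add_nonneg (ih (fun i => hδ _) hτ) (stepError_nonneg hδ hτ)

theorem exists_isEffectiveMatrix_of_pos {n : ℕ} {Mu L : ℝ} (hlam : 0 < lam) (hMu : 0 ≤ Mu)
    {A : Var d n → Matrix (Fin d) (Fin d) ℝ} (hA : IsLipCoeff lam Mu L A) (δ : Fin n → ℝ) {τ : ℝ}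
    (hτ : 0 < τ) : ∃ M, IsEffectiveMatrix δ τ A M :=
  exists_isEffectiveMatrix hlam hMu hA.isBoundedMatrix hA.elliptic (Or.inl hτ.ne')

/-- The effective matrix `N` of `A'` for the first scales is inserted between `A₀` and `M`. The
constant is uniform over the class given by `lam`, `Mu`, `L`, and the induction hypothesis is
applied with the larger constants of `A'`. -/
theorem exists_scaleError_bound (hlam : 0 < lam) (n : ℕ) : ∀ {Mu L : ℝ}, 0 ≤ Mu → 0 ≤ L →
    ∃ C, 0 ≤ C ∧ ∀ A : Var d n → Matrix (Fin d) (Fin d) ℝ, IsLipCoeff lam Mu L A →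
      ∀ A₀, IsReiteratedMatrix n A A₀ → ∀ (δ : Fin n → ℝ) (τ : ℝ), (∀ i, 0 < δ i) → 0 < τ →
      ∀ M, IsEffectiveMatrix δ τ A M → ∀ i j, |A₀ i j - M i j| ≤ C * scaleError n δ τ := by
  induction n with
  | zero =>
    refine fun hMu hL => ⟨0, le_rfl, fun A hA A₀ hA₀ δ τ _ _ M hM i j => ?_⟩
    have h1 : M = A₀ := (hM.unique hlam hMu hA.isBoundedMatrix hA.elliptic
      (isEffectiveMatrix_zero A δ τ)).trans (Eq.symm hA₀)
    simp [h1]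
  | succ n ih =>
    intro Mu L hMu hL
    have := amp_nonneg (d := d) hlam hMu
    obtain ⟨C, hC, h⟩ := ih (Mu := d ^ 2 * Mu * amp d lam Mu) (L := d ^ 2 * L * amp d lam Mu ^ 2)
      (by positivity) (by positivity)
    obtain ⟨C', hC', h'⟩ := exists_step_bound (d := d) n hlam hMu hL
    refine ⟨C + C', by positivity, ?_⟩
    intro A hA A₀ hA₀ δ τ hδ hτ M hM i j
    obtain ⟨A', hA', hM'⟩ := hA₀
    have hlip := IsHomogenization.isLipCoeff hlam hMu hL hA hA'
    obtain ⟨N, hN⟩ := exists_isEffectiveMatrix_of_pos (τ := τ) hlam (by positivity) hlip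
      (fun i => δ i.castSucc) hτ
    have h1 := h A' hlip A₀ hM' (fun i => δ i.castSucc) τ (fun i => hδ _) hτ N hN i j
    have h2 := h' A A' hA hA' δ τ hδ hτ M N hM hN i j
    rw [abs_sub_comm] at h2
    have h3 := abs_sub_le (A₀ i j) (N i j) (M i j)
    have h4 := scaleError_nonneg (δ := fun i : Fin n => δ i.castSucc) (fun i => hδ _) hτ
    have h5 := stepError_nonneg hδ hτ
    rw [scaleError]
    nlinarith

/-- For decreasing weights each δ_i⁻¹ with i < n is at most δ_{n-1}⁻¹, so the sum costs only the
number of scales times the last ratio. The first scale, of weight 1, contributes τ². -/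
theorem scaleError_le (τ : ℝ) (hτ : 0 < τ) (m : ℕ) : ∀ {δ : Fin (m + 1) → ℝ}, (∀ i, 0 < δ i) →
    Antitone δ → δ 0 = 1 →
    scaleError (m + 1) δ τ ≤ (m + 1) ^ 2 * (τ ^ 2 + ∑ j : Fin m, δ j.succ / δ j.castSucc) := by
  induction m with
  | zero =>
    intro δ _ _ h0
    simp [scaleError, h0]
  | succ m ih =>
    intro δ hδ hanti h0
    have h1 := ih (δ := fun i => δ i.castSucc) (fun i => hδ _)
      (fun i j hij => hanti (Fin.castSucc_le_castSucc_iff.2 hij)) h0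
    set R := ∑ j : Fin m, δ j.succ.castSucc / δ j.castSucc.castSucc with hR
    have hR0 : 0 ≤ R := Finset.sum_nonneg fun j _ => (div_pos (hδ _) (hδ _)).le
    set t := δ (Fin.last (m + 1)) with ht
    set s := δ (Fin.last m).castSucc with hs
    have ht0 : 0 < t := hδ _
    have hs0 : 0 < s := hδ _
    have hts : t ≤ s := hanti (Fin.le_last _)
    have ht1 : t ≤ 1 := h0 ▸ hanti (Fin.zero_le _)
    set ρ := t / s with hρ
    have hρ0 : 0 < ρ := div_pos ht0 hs0
    have hρ1 : ρ ≤ 1 := (div_le_one hs0).2 hts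
    have hsum : ∑ j : Fin (m + 1), δ j.succ / δ j.castSucc = R + ρ := by
      rw [Fin.sum_univ_castSucc]
      rfl
    have hS : t * ∑ i : Fin (m + 1), (δ i.castSucc)⁻¹ ≤ (m + 1) * ρ := by
      have h2 : ∑ i : Fin (m + 1), (δ i.castSucc)⁻¹ ≤ (m + 1) * s⁻¹ := by
        have h3 : ∀ i ∈ Finset.univ, (δ (Fin.castSucc i : Fin (m + 2)))⁻¹ ≤ s⁻¹ := fun i _ => by
          have h4 := hδ i.castSucc
          have h5 : s ≤ δ i.castSucc := hanti (Fin.castSucc_le_castSucc_iff.2 (Fin.le_last i))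
          gcongr
        exact (Finset.sum_le_card_nsmul _ _ _ h3).trans_eq (by simp)
      calc _ ≤ t * ((m + 1) * s⁻¹) := by gcongr
        _ = _ := by rw [hρ]; ring
    rw [scaleError, hsum]
    set T := ∑ i : Fin (m + 1), (δ i.castSucc)⁻¹
    have hT0 : 0 ≤ T := Finset.sum_nonneg fun i _ => inv_nonneg.2 (hδ _).le
    have e1 : τ * t ^ 2 * T ≤ (m + 1) * (τ ^ 2 + ρ) := by
      have e2 : τ * t ≤ τ := mul_le_of_le_one_right hτ.le ht1
      -- Young's inequality together with ρ² ≤ ρ; this disposes of the mixed term for every size of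
      -- τ.
      have e3 : τ * ρ ≤ τ ^ 2 + ρ := by nlinarith [sq_nonneg (τ - ρ)]
      calc τ * t ^ 2 * T = τ * t * (t * T) := by ring
        _ ≤ τ * ((m + 1) * ρ) := mul_le_mul e2 hS (mul_nonneg ht0.le hT0) hτ.le
        _ = (m + 1) * (τ * ρ) := by ring
        _ ≤ _ := by gcongr
    have e4 : τ ^ 2 * t ^ 2 ≤ τ ^ 2 := mul_le_of_le_one_right (sq_nonneg _) (by nlinarith)
    have hm : (0 : ℝ) ≤ m := Nat.cast_nonneg m
    push_cast
    have e5 : (0 : ℝ) ≤ m * R := by positivity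
    have e6 : (0 : ℝ) ≤ m ^ 2 * ρ := by positivity
    have e7 : (0 : ℝ) ≤ m * ρ := by positivity
    have e8 : (0 : ℝ) ≤ m * τ ^ 2 := by positivity
    have h6 : scaleError (m + 1) (fun i => δ i.castSucc) τ ≤ (m + 1) ^ 2 * (τ ^ 2 + R) := h1
    nlinarith

end Reiterated

/-! ### The iterated limit. -/

section Limit

variable {d : ℕ} {lam : ℝ}

theorem tendsto_matrix_of_abs_le {f : ℝ → Matrix (Fin d) (Fin d) ℝ} {M : Matrix (Fin d) (Fin d) ℝ}
    {b : ℝ → ℝ} (h : ∀ t > 0, ∀ i j, |f t i j - M i j| ≤ b t) (hb : Continuous b) (hb0 : b 0 = 0) :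
    Tendsto f (𝓝[>] 0) (𝓝 M) := by
  refine tendsto_pi_nhds.2 fun i => tendsto_pi_nhds.2 fun j => ?_
  rw [tendsto_iff_norm_sub_tendsto_zero]
  have h1 : Tendsto b (𝓝[>] 0) (𝓝 (b 0)) := (hb.tendsto 0).mono_left nhdsWithin_le_nhds
  rw [hb0] at h1
  refine squeeze_zero' (Eventually.of_forall fun _ => norm_nonneg _) ?_ h1
  filter_upwards [self_mem_nhdsWithin] with t ht
  exact h t ht i j

/-- The one-step bound requires no ordering of the weights and tends to 0 with the last one when the
others are fixed. The innermost limit is thus the effective matrix of `A'`, and the induction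
continues. With one scale left the error is at most a constant times τ². -/
theorem hasIteratedLimit (hlam : 0 < lam) (m : ℕ) : ∀ {Mu L : ℝ}, 0 ≤ Mu → 0 ≤ L →
    ∀ {A : Var d (m + 1) → Matrix (Fin d) (Fin d) ℝ}, IsLipCoeff lam Mu L A →
    ∀ {A₀ : Matrix (Fin d) (Fin d) ℝ}, IsReiteratedMatrix (m + 1) A A₀ →
    ∀ {Abar : ℝ → (Fin (m + 1) → ℝ) → Matrix (Fin d) (Fin d) ℝ},
    (∀ τ > 0, ∀ δ : Fin (m + 1) → ℝ, (∀ i, 0 < δ i) → IsEffectiveMatrix δ τ A (Abar τ δ)) →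
    HasIteratedLimit (m + 1)
      (fun s => Abar (s 0) (Fin.cons (α := fun _ => ℝ) 1 (Fin.tail s))) A₀ := by
  induction m with
  | zero =>
    intro Mu L hMu hL A hA A₀ hA₀ Abar hAbar
    obtain ⟨C, -, h⟩ := exists_scaleError_bound (d := d) hlam 1 hMu hL
    refine ⟨fun _ => A₀, fun s _ => ?_, rfl⟩
    refine tendsto_matrix_of_abs_le (b := fun t => C * t ^ 2) (fun t ht i j => ?_) (by fun_prop)
      (by simp)
    have h0 : (Fin.snoc (α := fun _ => ℝ) s t : Fin 1 → ℝ) 0 = t := by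
      simpa using Fin.snoc_last (α := fun _ => ℝ) (n := 0) t s
    beta_reduce
    rw [h0, abs_sub_comm]
    have hpos : ∀ i, (0 : ℝ) < (Fin.cons (α := fun _ => ℝ) 1
        (Fin.tail (Fin.snoc (α := fun _ => ℝ) s t)) : Fin 1 → ℝ) i := fun i => by
      rw [show i = 0 from Subsingleton.elim (α := Fin 1) i 0, Fin.cons_zero]; exact one_pos
    refine (h A hA A₀ hA₀ _ t hpos ht _ (hAbar t ht _ hpos) i j).trans_eq ?_
    simp [scaleError]
  | succ m ih =>
    intro Mu L hMu hL A hA A₀ hA₀ Abar hAbar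
    obtain ⟨A', hA', hM'⟩ := hA₀
    have := amp_nonneg (d := d) hlam hMu
    have hlip := IsHomogenization.isLipCoeff hlam hMu hL hA hA'
    obtain ⟨C, -, h⟩ := exists_step_bound (d := d) (m + 1) hlam hMu hL
    choose! Abar' hAbar' using fun (τ : ℝ) (hτ : 0 < τ) (δ : Fin (m + 1) → ℝ) =>
      exists_isEffectiveMatrix_of_pos hlam (by positivity) hlip δ hτ
    refine ⟨fun s => Abar' (s 0) (Fin.cons (α := fun _ => ℝ) 1 (Fin.tail s)), fun s hs => ?_,
      ih (by positivity) (by positivity) hlip hM' fun τ hτ δ _ => hAbar' τ hτ δ⟩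
    set δ' : Fin (m + 1) → ℝ := Fin.cons (α := fun _ => ℝ) 1 (Fin.tail s) with hδ'
    have hδ'0 : ∀ i, 0 < δ' i := fun i => by
      refine Fin.cases ?_ (fun i => ?_) i
      · rw [hδ', Fin.cons_zero]; exact one_pos
      · rw [hδ', Fin.cons_succ]; exact hs _
    refine tendsto_matrix_of_abs_le (b := fun t => C * (t * (∑ i, (δ' i)⁻¹)
      + s 0 * t ^ 2 * (∑ i, (δ' i)⁻¹) + s 0 ^ 2 * t ^ 2)) (fun t ht i j => ?_) (by fun_prop)
      (by simp)
    have h0 : (Fin.snoc (α := fun _ => ℝ) s t : Fin (m + 2) → ℝ) 0 = s 0 :=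
      Fin.snoc_castSucc (α := fun _ => ℝ) t s 0
    -- Slot 0 of the parameter tuple holds τ and is replaced by δ_1 = 1. The replacement commutes
    -- with appending the last weight.
    have hδ : (Fin.cons (α := fun _ => ℝ) 1 (Fin.tail (Fin.snoc (α := fun _ => ℝ) s t)) :
        Fin (m + 2) → ℝ) = Fin.snoc (α := fun _ => ℝ) δ' t := by
      ext i
      refine Fin.lastCases ?_ (fun i => ?_) i
      · rw [Fin.snoc_last, ← Fin.succ_last, Fin.cons_succ, Fin.tail, Fin.succ_last, Fin.snoc_last]
      · rw [Fin.snoc_castSucc]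
        refine Fin.cases ?_ (fun i => ?_) i
        · rw [Fin.castSucc_zero, hδ', Fin.cons_zero, Fin.cons_zero]
        · rw [Fin.castSucc_succ, hδ', Fin.cons_succ, Fin.cons_succ, Fin.tail, Fin.tail,
            Fin.succ_castSucc, Fin.snoc_castSucc]
    beta_reduce
    rw [h0, hδ]
    have hpos : ∀ i, (0 : ℝ) < (Fin.snoc (α := fun _ => ℝ) δ' t : Fin (m + 2) → ℝ) i := fun i => by
      refine Fin.lastCases ?_ (fun i => ?_) i
      · rw [Fin.snoc_last]; exact ht
      · rw [Fin.snoc_castSucc]; exact hδ'0 i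
    have h1 := h A A' hA hA' _ (s 0) hpos (hs 0) _ (Abar' (s 0) δ')
      (hAbar _ (hs 0) _ hpos) (by simpa using hAbar' (s 0) (hs 0) δ') i j
    simpa using h1

end Limit

end Multiscale

end

/-- There are `n = m + 1` scales; `ε 0, …, ε (Fin.last m)` are `ε_1, …, ε_n`, and
`δ_i = ε_i / ε_1`. -/
theorem proposition4p1 (d m : ℕ) (lam C₀ Λ₀ : ℝ) (hlam : 0 < lam) (hC₀ : 0 < C₀) (hΛ₀ : 0 < Λ₀) :
    ∃ C > (0 : ℝ), ∃ c > (0 : ℝ), ∀ κ > (0 : ℝ), ∃ cs : Fin m → ℝ, (∀ j, 0 < cs j) ∧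
      ∀ A : Multiscale.Var d (m + 1) → Matrix (Fin d) (Fin d) ℝ,
        Multiscale.IsCoefficient lam C₀ Λ₀ A →
        ∃ (A₀ : Matrix (Fin d) (Fin d) ℝ)
          (Abar : ℝ → (Fin (m + 1) → ℝ) → Matrix (Fin d) (Fin d) ℝ),
          -- `A₀` is the reiterated-homogenization matrix
          (∀ M, Multiscale.IsReiteratedMatrix (m + 1) A M ↔ M = A₀) ∧
          -- `Abar τ δ` is the effective matrix
          (∀ τ > 0, ∀ δ : Fin (m + 1) → ℝ, (∀ i, 0 < δ i) →
            ∀ M, Multiscale.IsEffectiveMatrix δ τ A M ↔ M = Abar τ δ) ∧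
          -- the error estimate
          (∀ ε : Fin (m + 1) → ℝ, (∀ i, 0 < ε i) → StrictAnti ε →
            (∀ j : Fin m, ε j.succ ≤
              cs j * ε j.castSucc / (1 + Real.log (ε 0 / ε j.castSucc))) →
            ∀ δ : Fin (m + 1) → ℝ, (∀ i, δ i = ε i / ε 0) →
            ∀ τ > 0, (∀ j : Fin m, κ * Real.exp (-c * (ε j.castSucc / ε j.succ)) ≤ τ ^ 2) →
              ∑ a, ∑ b, |A₀ a b - Abar τ δ a b| ≤
                C * (τ ^ 2 + ∑ j : Fin m, δ j.succ / δ j.castSucc)) ∧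
          -- the iterated limit `δ_n → 0`, …, `δ_2 → 0`, `τ → 0`, with `δ_1 = 1`
          Multiscale.HasIteratedLimit (m + 1)
            (fun s => Abar (s 0) (Fin.cons (α := fun _ => ℝ) 1 (Fin.tail s))) A₀ := by
  have hL : 0 ≤ C₀ * Λ₀ := by positivity
  have hMu : 0 ≤ lam⁻¹ := by positivity
  obtain ⟨C, hC, hbound⟩ := Multiscale.exists_scaleError_bound (d := d) hlam (m + 1) hMu hL
  -- The factor d² sums the entrywise bounds, (m + 1)² comes from `scaleError_le`, and the added 1
  -- makes the constant positive.
  refine ⟨d ^ 2 * (C * (m + 1) ^ 2) + 1, by positivity, 1, one_pos, fun κ _ =>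
    ⟨fun _ => 1, fun _ => one_pos, fun A hcoeff => ?_⟩⟩
  have hA := hcoeff.isLipCoeff hL
  obtain ⟨A₀, hA₀⟩ := Multiscale.exists_isReiteratedMatrix_iff hlam (m + 1) hMu hL hA
  choose! Abar hAbar using fun (τ : ℝ) (hτ : 0 < τ) (δ : Fin (m + 1) → ℝ) =>
    Multiscale.exists_isEffectiveMatrix_of_pos hlam hMu hA δ hτ
  refine ⟨A₀, Abar, hA₀, fun τ hτ δ _ M => ⟨fun hM => ?_, fun hM => hM ▸ hAbar τ hτ δ⟩, ?_,
    Multiscale.hasIteratedLimit hlam m hMu hL hA ((hA₀ A₀).2 rfl) fun τ hτ δ _ => hAbar τ hτ δ⟩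
  · exact hM.unique hlam hMu hA.isBoundedMatrix hA.elliptic (hAbar τ hτ δ)
  · intro ε hε hanti _ δ hδ τ hτ _
    have hδ0 : ∀ i, 0 < δ i := fun i => by rw [hδ]; exact div_pos (hε _) (hε _)
    have hδanti : Antitone δ := fun i j hij => by
      rw [hδ, hδ]
      have h1 := hanti.antitone hij
      have h2 := hε 0
      gcongr
    have h1 := Multiscale.scaleError_le τ hτ m hδ0 hδanti
      (by rw [hδ, div_self (hε 0).ne'])
    set r := τ ^ 2 + ∑ j : Fin m, δ j.succ / δ j.castSucc with hr
    have hr0 : 0 ≤ r := add_nonneg (sq_nonneg _)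
      (Finset.sum_nonneg fun j _ => (div_pos (hδ0 _) (hδ0 _)).le)
    have h2 : ∀ a b, |A₀ a b - Abar τ δ a b| ≤ C * (m + 1) ^ 2 * r := fun a b => by
      refine (hbound A hA A₀ ((hA₀ A₀).2 rfl) δ τ hδ0 hτ _ (hAbar τ hτ δ) a b).trans ?_
      rw [mul_assoc]
      gcongr
    calc ∑ a, ∑ b, |A₀ a b - Abar τ δ a b| ≤ ∑ _a : Fin d, ∑ _b : Fin d, C * (m + 1) ^ 2 * r :=
          Finset.sum_le_sum fun a _ => Finset.sum_le_sum fun b _ => h2 a b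
      _ = d ^ 2 * (C * (m + 1) ^ 2) * r := by simp; ring
      _ ≤ _ := by gcongr; linarith
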